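/- Let $g\ge 2$ and let $\Gamma_g=\langle a_1,\dots,a_g,b_1,\dots,b_g\mid [a_1,b_1]\cdots[a_g,b_g]=e\rangle$, with generating set $S=\{a_i^{\pm1},b_i^{\pm1}\}$ and word length $|\cdot|$. The successors of $x$ are the neighbours $y=xs$, $s\in S$, with $|y|=|x|+1$. A $4g$-gon is (the vertex set of) a loop in the Cayley graph labelled by the defining relator. The Cannon type $t(x)\in\{0,\dots,2g\}$ is the maximal length of a common suffix of a geodesic word representing $x$ and a cyclic permutation of the defining relator or of its inverse. The modified type $t'(x)$ equals $t(x)$, except in two cases. If $y$ has Cannon type $2g-1$, $z$ is its successor of type $2g$, and $P$ is a $4g$-gon containing $y$, $z$ and a successor $x$ of $y$ of type $1$, then $t'(x)=1'$; and a successor of this $x$ that has type $2$ and lies on $P$ has modified type $2'$. For $n=|x|$ and $0\le i\le n$, let $x_i$ be the common position at time $i$ of all geodesics from $e$ to $x$ if they agree at time $i$, and $x_i=*$ otherwise; put $t'(*)=*$. The essential type of $x$ is $t_{\rm ess}(x)=(t'(x_n),t'(x_{n-1}),\dots,t'(x_0))$. For $k\ge1$ let $t_{\rm ess}^{(k)}(x)$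 consist of its first $k$ entries (all entries if there are fewer). For weights $w=(w_0,\dots,w_{2g},w_{1'},w_{2'},w_*)$ in $[0,\infty)$ and a threshold $k\in\mathbb R$, let $t_{\rm ess}^{(k,w)}(x)$ be obtained by cutting $t_{\rm ess}(x)=(s_0,s_1,\dots)$ just after the entry $s_m$, for the smallest $m$ with $w_{s_0}+\dots+w_{s_m}>k$ (no cut if there is no such $m$). Say that $\sigma$ determines $\tau$ on successors if, whenever $\sigma(x)=\sigma(x')$, the points $x$ and $x'$ have the same number of successors with each value of $\tau$, and moreover any successor $y$ of $x$ and successor $y'$ of $x'$ with $t'(y)=t'(y')$ satisfy $\tau(y)=\tau(y')$. A function $f$ on $\Gamma_g$ is called a Perron--Frobenius type system if the set $T$ of values that $f$ takes infinitely often is finite, there is $t:\Gamma_g\to T$ equal to $f$ outside a finite set, and there is a nonnegative matrix $M$ indexed by $T$, some positive power of which has only positive entries, such that for all $i,j\in T$, all but finitely many $x$ with $t(x)=j$ have exactly $M_{ij}$ successors $y$ with $t(y)=i$. Then: 1. $t_{\rm ess}$ determines $t_{\rm ess}$ on successors. 2. For every integer $k\ge1$, $t_{\rm ess}^{(k)}$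 determines both $t_{\rm ess}^{(k+1)}$ and $t_{\rm ess}^{(k)}$ on successors, and $t_{\rm ess}^{(k)}$ is a Perron--Frobenius type system. 3. Let $k\in\mathbb R$ and let $w$ be weights in $[0,\infty)$ such that $w_*$ is maximal among all the weights. Then $t_{\rm ess}^{(k,w)}$ determines $t_{\rm ess}^{(k,w)}$ on successors. If moreover $t_{\rm ess}^{(k,w)}$ takes only finitely many values, then it is a Perron--Frobenius type system; this is so in particular if all weights other than $w_0$ are positive. -/

import Mathlib

/-! ### Word length, successors and type systems in a group with a generating set -/

/-- The word length `d(e, x)` of `x` with respect to `S`. -/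
noncomputable def wordLength {Γ : Type*} [Group Γ] (S : Set Γ) (x : Γ) : ℕ :=
  sInf {n | ∃ l : List Γ, (∀ s ∈ l, s ∈ S) ∧ l.length = n ∧ l.prod = x}

/-- The successors of `x`: the neighbours `y = x s` of `x` in the Cayley graph with
`d(e, y) = d(e, x) + 1`. -/
def successors {Γ : Type*} [Group Γ] (S : Set Γ) (x : Γ) : Set Γ :=
  {y | (∃ s ∈ S, y = x * s) ∧ wordLength S y = wordLength S x + 1}

/-- `(T, t, M)` is a type system for `(Γ, S)`: for all `i j`, all but finitely many points `x` of
type `j` have exactly `M i j` successors of type `i`. -/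
def IsTypeSystem {Γ : Type*} [Group Γ] (S : Set Γ) {T : Type*} [Finite T] (t : Γ → T)
    (M : Matrix T T ℝ) : Prop :=
  ∀ i j : T, {x | t x = j ∧ (({y | y ∈ successors S x ∧ t y = i}.ncard : ℕ) : ℝ) ≠ M i j}.Finite

open Classical in
/-- The function `f` on `Γ` is, up to finitely many points, a Perron-Frobenius type system.
The set `T` of types consists of the values that `f` takes infinitely often (the values attained
finitely often are discarded), and `t` agrees with `f` at all but finitely many points. -/
def FormsPerronFrobeniusTypeSystem {Γ : Type*} [Group Γ] (S : Set Γ) {A : Type*}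
    (f : Γ → A) : Prop :=
  ∃ (T : Finset A) (t : Γ → T) (M : Matrix T T ℝ),
    (∀ a, a ∈ T ↔ {x | f x = a}.Infinite) ∧
    {x | (t x : A) ≠ f x}.Finite ∧
    IsTypeSystem S t M ∧ M.IsPrimitive

/-! ### The surface group -/

/-- Letters: `(Sum.inl i, true)` is `a_i`, `(Sum.inr i, true)` is `b_i`, and `false` marks the
inverse. -/
abbrev SurfaceLetter (g : ℕ) : Type := (Fin g ⊕ Fin g) × Bool

/-- The basic relation `[a_1, b_1] ⋯ [a_g, b_g]`, in the free group. -/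
def surfaceRelator (g : ℕ) : FreeGroup (Fin g ⊕ Fin g) :=
  (List.ofFn fun i : Fin g =>
    FreeGroup.of (Sum.inl i : Fin g ⊕ Fin g) * FreeGroup.of (Sum.inr i) *
      (FreeGroup.of (Sum.inl i))⁻¹ * (FreeGroup.of (Sum.inr i))⁻¹).prod

/-- The basic relation `[a_1, b_1] ⋯ [a_g, b_g]`, as a word of length `4g`. -/
def relatorWord (g : ℕ) : List (SurfaceLetter g) :=
  (List.ofFn fun i : Fin g =>
    [((Sum.inl i : Fin g ⊕ Fin g), true), (Sum.inr i, true),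
      (Sum.inl i, false), (Sum.inr i, false)]).flatten

theorem mk_relatorWord (g : ℕ) : FreeGroup.mk (relatorWord g) = surfaceRelator g := by
  have key : ∀ L : List (List (SurfaceLetter g)),
      FreeGroup.mk L.flatten = (L.map FreeGroup.mk).prod := by
    intro L
    induction L with
    | nil => rfl
    | cons a L ih => rw [List.flatten_cons, ← FreeGroup.mul_mk, ih]; simp
  rw [relatorWord, surfaceRelator, key, List.map_ofFn]
  rfl

/-- The surface group `Γ_g = ⟨a_1, …, a_g, b_1, …, b_g | [a_1, b_1] ⋯ [a_g, b_g] = e⟩`. -/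
abbrev SurfaceGroup (g : ℕ) : Type := PresentedGroup {surfaceRelator g}

/-- The element of `Γ_g` represented by a word. -/
def wordVal {g : ℕ} (c : List (SurfaceLetter g)) : SurfaceGroup g :=
  PresentedGroup.mk {surfaceRelator g} (FreeGroup.mk c)

/-- The symmetric generating set `{a_i, a_i⁻¹, b_i, b_i⁻¹}`. -/
def surfaceGens (g : ℕ) : Set (SurfaceGroup g) := {s | ∃ l : SurfaceLetter g, s = wordVal [l]}

/-- The length `|x|` of an element of `Γ_g`. -/
noncomputable def surfaceLength {g : ℕ} (x : SurfaceGroup g) : ℕ := wordLength (surfaceGens g) x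

/-- The word `c` is the label of a geodesic from `e` to `x`. -/
def IsGeodesicWord {g : ℕ} (c : List (SurfaceLetter g)) (x : SurfaceGroup g) : Prop :=
  wordVal c = x ∧ c.length = surfaceLength x

/-- Fundamental relators: the cyclic permutations of the basic relation or of its inverse. -/
def IsFundamentalRelator {g : ℕ} (r : List (SurfaceLetter g)) : Prop :=
  r ~r relatorWord g ∨ r ~r FreeGroup.invRev (relatorWord g)

/-- Cannon's canonical type of `x`: the maximal length of a common suffix of a geodesic word for
`x` and a fundamental relator, i.e. the maximal length along the last `4g`-gon of a geodesic from
`e` to `x`. -/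
noncomputable def cannonType {g : ℕ} (x : SurfaceGroup g) : ℕ :=
  sSup {n | ∃ c r u : List (SurfaceLetter g), IsGeodesicWord c x ∧ IsFundamentalRelator r ∧
    u <:+ c ∧ u <:+ r ∧ u.length = n}

/-- `P` is the vertex set of a `4g`-gon of the Cayley graph: the set of vertices visited by the
loop labelled by the basic relation and based at some point `p`. -/
def IsPolygon {g : ℕ} (P : Set (SurfaceGroup g)) : Prop :=
  ∃ p : SurfaceGroup g, P = {v | ∃ u, u <+: relatorWord g ∧ v = p * wordVal u}

/-- `P` is a `4g`-gon containing a point `y` of type `2g - 1`, the successor `z` of `y` of type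
`2g`, and the successor `x` of `y` of type `1`. -/
def IsOnePrimeOn {g : ℕ} (P : Set (SurfaceGroup g)) (x : SurfaceGroup g) : Prop :=
  IsPolygon P ∧ ∃ y z : SurfaceGroup g,
    cannonType y + 1 = 2 * g ∧
    z ∈ successors (surfaceGens g) y ∧ cannonType z = 2 * g ∧
    x ∈ successors (surfaceGens g) y ∧ cannonType x = 1 ∧
    y ∈ P ∧ z ∈ P ∧ x ∈ P

/-- `x` has type `2`, is a successor of a point `x₁` of modified type `1'`, and lies on the
`4g`-gon that makes `x₁` of modified type `1'`. -/
def IsTwoPrime {g : ℕ} (x : SurfaceGroup g) : Prop :=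
  ∃ (P : Set (SurfaceGroup g)) (x₁ : SurfaceGroup g), IsOnePrimeOn P x₁ ∧
    x ∈ successors (surfaceGens g) x₁ ∧ cannonType x = 2 ∧ x ∈ P

/-! ### Modified and essential types -/

/-- The symbols `0, 1, 2, …` (Cannon types), `1'`, `2'` and `*`. -/
inductive TypeSymbol : Type
  | cannon (i : ℕ) : TypeSymbol
  | onePrime : TypeSymbol
  | twoPrime : TypeSymbol
  | star : TypeSymbol

/-- The alphabet `{0, 1, …, 2g, 1', 2', *}` used in genus `g`. -/
def typeAlphabet (g : ℕ) : Set TypeSymbol :=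
  {a | (∃ i ≤ 2 * g, a = .cannon i) ∨ a = .onePrime ∨ a = .twoPrime ∨ a = .star}

open Classical in
/-- The modified Cannon type `t'(x)`. -/
noncomputable def modifiedType {g : ℕ} (x : SurfaceGroup g) : TypeSymbol :=
  if ∃ P, IsOnePrimeOn P x then .onePrime
  else if IsTwoPrime x then .twoPrime
  else .cannon (cannonType x)

open Classical in
/-- The entry at position `i` of `F_ess(x)`: the point `u` if all geodesics from `e` to `x` are at
`u` at position `i`, and `none` (standing for `*`) if two of them differ at position `i`. -/
noncomputable def essentialPoint {g : ℕ} (x : SurfaceGroup g) (i : ℕ) :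
    Option (SurfaceGroup g) :=
  if h : ∃ u, ∀ c, IsGeodesicWord c x → wordVal (c.take i) = u then some h.choose else none

/-- `t'`, extended by `t'(*) = *`. -/
noncomputable def modifiedTypeOrStar {g : ℕ} : Option (SurfaceGroup g) → TypeSymbol
  | none => .star
  | some u => modifiedType u

/-- The essential type `(t'(x_n), t'(x_{n-1}), …, t'(x_0))` of `x`, where `n = |x|` and
`(x_0, …, x_n) = F_ess(x)`. -/
noncomputable def essentialType {g : ℕ} (x : SurfaceGroup g) : List TypeSymbol :=
  (List.range (surfaceLength x + 1)).reverse.map fun i => modifiedTypeOrStar (essentialPoint x i)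

/-- The essential type truncated to its first `k` entries. -/
noncomputable def essentialTypeLen {g : ℕ} (k : ℕ) (x : SurfaceGroup g) : List TypeSymbol :=
  (essentialType x).take k

open Classical in
/-- Truncation according to the weights `w` and the threshold `k`: a sequence `(t_0, t_1, …)` is
cut just after `t_n`, for the smallest `n` such that `w t_0 + ⋯ + w t_n > k` (and is kept entire
if there is no such `n`). -/
noncomputable def weightTruncate (w : TypeSymbol → ℝ) : ℝ → List TypeSymbol → List TypeSymbol
  | _, [] => []
  | k, a :: l => if k < w a then [a] else a :: weightTruncate w (k - w a) l

/-- The essential type truncated according to the weights `w` and the threshold `k`. -/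
noncomputable def essentialTypeWeight {g : ℕ} (w : TypeSymbol → ℝ) (k : ℝ) (x : SurfaceGroup g) :
    List TypeSymbol :=
  weightTruncate w k (essentialType x)

/-- The value `σ x` determines the values of `τ` on the successors of `x`: if `σ x = σ x'`, then
`x` and `x'` have the same number of successors with any given value of `τ`, and moreover a
successor of `x` and a successor of `x'` that have the same modified type have the same value
of `τ`. -/
def DeterminesSuccessors {g : ℕ} {α β : Type*} (σ : SurfaceGroup g → α)
    (τ : SurfaceGroup g → β) : Prop :=
  ∀ x x' : SurfaceGroup g, σ x = σ x' →
    (∀ b : β, {y | y ∈ successors (surfaceGens g) x ∧ τ y = b}.ncard =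
      {y | y ∈ successors (surfaceGens g) x' ∧ τ y = b}.ncard) ∧
    ∀ y ∈ successors (surfaceGens g) x, ∀ y' ∈ successors (surfaceGens g) x',
      modifiedType y = modifiedType y' → τ y = τ y'

/-!
The Cayley graph of the surface group is the edge graph of a tiling of the plane by `4g`-gons, with
`4g` of them around each vertex. The proof builds this tiling outwards from the root, without any
geometry, and reads everything off from it.

*The tiling.* A vertex is encoded as a term of type `Node`, which records its one or two
predecessors and the labels of the edges from them. The number `run ε v` counts for how many edges
the geodesics to `v` have followed the polygon lying outside the incoming edge on side `ε`. Moving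
along an upward edge (`push`) creates a vertex with a single predecessor, unless this edge completes
one half of the boundary of a polygon; then the end point is the top of that polygon, and its second
predecessor is found by walking down to the bottom and up along the other side. `Level.good` is the
induction showing that the picture is consistent: both sides of a polygon lead to the same top.
Hence the boundary of each polygon is closed (`travel_period`), so the surface group acts on the
vertices, and evaluating the labels gives an inverse to the orbit map (`val_node`). Word length is
therefore the distance to the root (`wordLength_eq_depth`), and successors are upward edges. This
replaces small cancellation theory.

*Types.* The Cannon type of a vertex with one predecessor is the larger of its two runs, and that of
the top of a polygon is `2g` (`cannonType_eq`). Every polygon has a unique bottom, from which the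
definitions of the types `1'` and `2'` become conditions on the last two or three edges
(`modifiedType_eq`). Going once around a vertex, the modified types of its successors are given by a
table that depends only on its own modified type (`look_one`, `look_two`).

*Essential types.* A successor with a single predecessor has the essential type of that predecessor
with one entry added in front. At the top of a polygon the entries along the polygon become `*`.
Below its bottom `b`, the other side may provide further geodesics: this happens when that side
starts with the top of another polygon with predecessor `b`, and it is exactly then that the first
two vertices of the given side have types `1'` and `2'`. So the essential type itself tells how the
replacement goes on (`ess_push_of_full`, `Starred`). This procedure is causal: the first `k` entries
of the result depend only on the first `k` entries of the argument (`Node.Starred.take_eq`), which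
gives the claims about truncation to a fixed length. It only replaces entries by `*`, which does not
decrease the weight as `*` has maximal weight; so the part needed at the successor is already
determined by the part kept at the point (`determines_essentialTypeWeight`).

*Perron-Frobenius property.* When finitely many values occur, the truncation is a function of the
first `K` entries for some `K`. Every point has a successor of type `1`, the type of the points at
distance `1` from the root. From any point one can therefore follow points of type `1` for as long
as desired and then copy a geodesic to a distant point with a prescribed value
(`exists_path_essentialTypeLen`). The waiting time makes one exponent work for all pairs of values.
-/

namespace SurfaceTiling

/-! ### Letters, rotation at a vertex, and boundary letters of a polygon -/

variable {g : ℕ}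

/-- The inverse letter. -/
def bar (s : SurfaceLetter g) : SurfaceLetter g := (s.1, !s.2)

/-- The cyclic order of the `4g` edges leaving a vertex of the Cayley graph drawn in the plane:
`rot true` turns clockwise and `rot false` anticlockwise by one edge. -/
def rot : Bool → SurfaceLetter g → SurfaceLetter g
  | true, (Sum.inl i, true) => (Sum.inr i, false)
  | true, (Sum.inr i, false) => (Sum.inl i, false)
  | true, (Sum.inl i, false) => (Sum.inr i, true)
  | true, (Sum.inr i, true) => (Sum.inl (finRotate g i), true)
  | false, (Sum.inr i, false) => (Sum.inl i, true)
  | false, (Sum.inl i, false) => (Sum.inr i, false)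
  | false, (Sum.inr i, true) => (Sum.inl i, false)
  | false, (Sum.inl i, true) => (Sum.inr ((finRotate g).symm i), true)

/-- The letter that follows `s` on the boundary of the polygon to the left (`ε = true`) or to the
right (`ε = false`) of the edge `s`. -/
def nx (ε : Bool) (s : SurfaceLetter g) : SurfaceLetter g := rot ε (bar s)

@[simp] theorem bar_bar (s : SurfaceLetter g) : bar (bar s) = s := by
  simp [bar]

theorem bar_injective : Function.Injective (bar (g := g)) :=
  Function.LeftInverse.injective bar_bar

theorem bar_eq_iff {s t : SurfaceLetter g} : bar s = t ↔ s = bar t :=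
  ⟨fun h => by rw [← h, bar_bar], fun h => by rw [h, bar_bar]⟩

@[simp] theorem rot_not_rot (ε : Bool) (s : SurfaceLetter g) : rot (!ε) (rot ε s) = s := by
  obtain ⟨i | i, b⟩ := s <;> cases b <;> cases ε <;>
    simp only [rot, Equiv.apply_symm_apply, Equiv.symm_apply_apply, Bool.not_true, Bool.not_false]

@[simp] theorem rot_rot_not (ε : Bool) (s : SurfaceLetter g) : rot ε (rot (!ε) s) = s := by
  simpa using rot_not_rot (!ε) s

theorem rot_eq_iff (ε : Bool) {s t : SurfaceLetter g} : rot ε s = t ↔ s = rot (!ε) t :=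
  ⟨fun h => by rw [← h, rot_not_rot], fun h => by rw [h, rot_rot_not]⟩

theorem rot_injective (ε : Bool) : Function.Injective (rot (g := g) ε) :=
  Function.LeftInverse.injective (rot_not_rot ε)

theorem nx_injective (ε : Bool) : Function.Injective (nx (g := g) ε) :=
  (rot_injective ε).comp bar_injective

@[simp] theorem rot_not_nx (ε : Bool) (s : SurfaceLetter g) : rot (!ε) (nx ε s) = bar s :=
  rot_not_rot ε _

/-- Walking backwards along a polygon boundary. -/
@[simp] theorem nx_not_bar_nx (ε : Bool) (s : SurfaceLetter g) :
    nx (!ε) (bar (nx ε s)) = bar s := by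
  simp [nx]

@[simp] theorem nx_bar_nx_not (ε : Bool) (s : SurfaceLetter g) :
    nx ε (bar (nx (!ε) s)) = bar s := by
  simp [nx]

/-- The rank of a letter in the cyclic order at a vertex. -/
def rotRank : SurfaceLetter g → ZMod (4 * g)
  | (Sum.inl i, true) => ((4 * i : ℕ) : ZMod (4 * g))
  | (Sum.inr i, false) => ((4 * i + 1 : ℕ) : ZMod (4 * g))
  | (Sum.inl i, false) => ((4 * i + 2 : ℕ) : ZMod (4 * g))
  | (Sum.inr i, true) => ((4 * i + 3 : ℕ) : ZMod (4 * g))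

/-- The rank of a letter in the basic relation. -/
def faceRank : SurfaceLetter g → ZMod (4 * g)
  | (Sum.inl i, true) => ((4 * i : ℕ) : ZMod (4 * g))
  | (Sum.inr i, true) => ((4 * i + 1 : ℕ) : ZMod (4 * g))
  | (Sum.inl i, false) => ((4 * i + 2 : ℕ) : ZMod (4 * g))
  | (Sum.inr i, false) => ((4 * i + 3 : ℕ) : ZMod (4 * g))

/-- The wrap-around from the last index to the first costs `4 * g`, which vanishes in
`ZMod (4 * g)`. -/
theorem cast_four_mul_finRotate (i : Fin g) :
    ((4 * (finRotate g i : ℕ) : ℕ) : ZMod (4 * g)) = ((4 * (i : ℕ) + 4 : ℕ) : ZMod (4 * g)) := by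
  obtain _ | m := g
  · exact i.elim0
  rw [coe_finRotate]
  split_ifs with h
  · subst h
    simp only [Fin.val_last, mul_zero, Nat.cast_zero]
    rw [show 4 * m + 4 = 4 * (m + 1) by ring, ZMod.natCast_self]
  · rfl

theorem rotRank_rot_true (s : SurfaceLetter g) : rotRank (rot true s) = rotRank s + 1 := by
  obtain ⟨i | i, b⟩ := s <;> cases b <;> simp only [rot, rotRank]
  · push_cast; ring
  · push_cast; ring
  · push_cast; ring
  · rw [cast_four_mul_finRotate]; push_cast; ring

theorem faceRank_nx_true (s : SurfaceLetter g) : faceRank (nx true s) = faceRank s + 1 := by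
  obtain ⟨i | i, b⟩ := s <;> cases b <;> simp only [rot, nx, bar, faceRank, Bool.not_true,
    Bool.not_false]
  · push_cast; ring
  · push_cast; ring
  · rw [cast_four_mul_finRotate]; push_cast; ring
  · push_cast; ring

theorem rotRank_injective : Function.Injective (rotRank (g := g)) := by
  rintro ⟨i | i, b⟩ ⟨j | j, c⟩ h <;> cases b <;> cases c <;> simp only [rotRank] at h <;>
    have hi := i.2 <;> have hj := j.2 <;>
    rw [ZMod.natCast_eq_natCast_iff', Nat.mod_eq_of_lt (by omega), Nat.mod_eq_of_lt (by omega)]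
      at h <;> first | omega | (have : i = j := Fin.ext (by omega); rw [this])

theorem faceRank_injective : Function.Injective (faceRank (g := g)) := by
  rintro ⟨i | i, b⟩ ⟨j | j, c⟩ h <;> cases b <;> cases c <;> simp only [faceRank] at h <;>
    have hi := i.2 <;> have hj := j.2 <;>
    rw [ZMod.natCast_eq_natCast_iff', Nat.mod_eq_of_lt (by omega), Nat.mod_eq_of_lt (by omega)]
      at h <;> first | omega | (have : i = j := Fin.ext (by omega); rw [this])

/-- The sign `±1` by which `rot ε` moves the rank. -/
def sgn (g : ℕ) (ε : Bool) : ZMod (4 * g) := if ε then 1 else -1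

theorem rotRank_rot (ε : Bool) (s : SurfaceLetter g) :
    rotRank (rot ε s) = rotRank s + sgn g ε := by
  cases ε
  · have h := rotRank_rot_true (rot false s)
    have h2 : rot true (rot false s) = s := rot_rot_not true s
    rw [h2] at h
    simp [sgn, h]
  · simpa [sgn] using rotRank_rot_true s

theorem sgn_mul_self (ε : Bool) : sgn g ε * sgn g ε = 1 := by
  cases ε <;> simp [sgn]

theorem rotRank_iterate (ε : Bool) (j : ℕ) (s : SurfaceLetter g) :
    rotRank ((rot ε)^[j] s) = rotRank s + j * sgn g ε := by
  induction j with
  | zero => simp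
  | succ j ih => rw [Function.iterate_succ_apply', rotRank_rot, ih]; push_cast; ring

theorem rot_iterate_eq_iff (ε : Bool) (i j : ℕ) (s : SurfaceLetter g) :
    (rot ε)^[i] s = (rot ε)^[j] s ↔ i ≡ j [MOD 4 * g] := by
  rw [← rotRank_injective.eq_iff, rotRank_iterate, rotRank_iterate, add_right_inj,
    ← ZMod.natCast_eq_natCast_iff]
  constructor
  · intro h
    have := congrArg (· * sgn g ε) h
    simpa [mul_assoc, sgn_mul_self] using this
  · intro h; rw [h]

theorem rot_iterate_ne (ε : Bool) {j : ℕ} (h0 : 0 < j) (hj : j < 4 * g) (s : SurfaceLetter g) :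
    (rot ε)^[j] s ≠ s := by
  intro h
  have := (rot_iterate_eq_iff ε j 0 s).1 h
  rw [Nat.ModEq, Nat.mod_eq_of_lt hj, Nat.zero_mod] at this
  omega

/-- The rotations at a vertex act transitively on the letters. -/
theorem exists_rot_iterate (ε : Bool) (s t : SurfaceLetter g) :
    ∃ j < 4 * g, t = (rot ε)^[j] s := by
  have hg : 0 < g := by
    obtain ⟨i | i, -⟩ := s <;> exact Nat.lt_of_le_of_lt (Nat.zero_le _) i.2
  have : NeZero (4 * g) := ⟨by omega⟩
  refine ⟨((rotRank t - rotRank s) * sgn g ε).val, ZMod.val_lt _, rotRank_injective ?_⟩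
  rw [rotRank_iterate, ZMod.natCast_zmod_val, mul_assoc, sgn_mul_self]
  ring

theorem nx_iterate_bar_nx_iterate (ε : Bool) (k : ℕ) (s : SurfaceLetter g) :
    (nx ε)^[k] (bar ((nx (!ε))^[k] s)) = bar s := by
  induction k with
  | zero => rfl
  | succ k ih => rw [Function.iterate_succ_apply, Function.iterate_succ_apply' (nx (!ε)),
      nx_bar_nx_not, ih]

theorem nx_iterate_period (ε : Bool) (s : SurfaceLetter g) : (nx ε)^[4 * g] s = s := by
  have key : ∀ s : SurfaceLetter g, (nx true)^[4 * g] s = s := by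
    intro s
    have : ∀ k : ℕ, faceRank ((nx true)^[k] s) = faceRank s + k := by
      intro k
      induction k with
      | zero => simp
      | succ k ih => rw [Function.iterate_succ_apply', faceRank_nx_true, ih]; push_cast; ring
    apply faceRank_injective
    rw [this, ZMod.natCast_self, add_zero]
  cases ε
  · have h := nx_iterate_bar_nx_iterate true (4 * g) s
    rw [key] at h
    exact bar_injective h
  · exact key s

/-- The letters of the two sides of a polygon that start at a common vertex with the neighbouring
edges `s` and `rot (!ε) s`: the letters on one side are, in reverse order, the inverses of
the letters that continue the other side. -/
theorem nx_not_iterate_rot (ε : Bool) (s : SurfaceLetter g) {i j : ℕ} (h : i + j + 1 = 4 * g) :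
    (nx (!ε))^[i] (rot (!ε) s) = bar ((nx ε)^[j] s) := by
  have h1 : rot (!ε) s = bar ((nx ε)^[4 * g - 1] s) := by
    apply rot_injective ε
    rw [rot_rot_not, ← nx, ← Function.iterate_succ_apply' (nx ε), Nat.succ_eq_add_one,
      Nat.sub_add_cancel (by omega), nx_iterate_period]
  have h2 : ∀ i j, (nx (!ε))^[i] (bar ((nx ε)^[j + i] s)) = bar ((nx ε)^[j] s) := by
    intro i j
    have := nx_iterate_bar_nx_iterate (!ε) i ((nx ε)^[j] s)
    rwa [Bool.not_not, ← Function.iterate_add_apply, add_comm] at this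
  rw [h1, show 4 * g - 1 = j + i by omega, h2]

end SurfaceTiling

namespace SurfaceTiling

/-! ### Vertices of the tiling as trees of geodesics -/

variable {g : ℕ}

/-- Combinatorial vertices of the tiling, presented from the root outwards. A vertex with a single
predecessor `v` is `one v s`, where `s` labels the last edge; a vertex with two predecessors is the
top of a polygon and is `two v s w t`, where `v` and `w` are the predecessors on the left and
on the right side of that polygon. Only the terms satisfying `Level` below are meaningful. -/
inductive Node (g : ℕ) : Type
  | root : Node g
  | one (v : Node g) (s : SurfaceLetter g) : Node g
  | two (v : Node g) (s : SurfaceLetter g) (w : Node g) (t : SurfaceLetter g) : Node g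

namespace Node

/-- The leftmost (`ε = true`) or rightmost predecessor; the value at the root is irrelevant. -/
def par (ε : Bool) : Node g → Node g
  | root => root
  | one v _ => v
  | two v _ w _ => cond ε v w

/-- The label of the leftmost (`ε = true`) or rightmost incoming edge. -/
def lt (ε : Bool) : Node g → Option (SurfaceLetter g)
  | root => none
  | one _ s => some s
  | two _ s _ t => some (cond ε s t)

/-- The vertex with the predecessor `v` on side `ε` and the predecessor `w` on the other side. -/
def mkTwo (ε : Bool) (v : Node g) (s : SurfaceLetter g) (w : Node g) (t : SurfaceLetter g) :
    Node g :=
  cond ε (two v s w t) (two w t v s)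

/-- The letter `s` continues, at `v`, the boundary of the polygon lying outside the incoming edge
on side `ε`. -/
def Cont (ε : Bool) (v : Node g) (s : SurfaceLetter g) : Prop := (lt ε v).map (nx ε) = some s

/-- The letter `s` leads from `v` to one of its predecessors. -/
def IsBack (v : Node g) (s : SurfaceLetter g) : Prop := ∃ ε, lt ε v = some (bar s)

open Classical in
/-- The length of the final stretch of the geodesics to a vertex along the polygon lying outside
the incoming edge on side `ε`. -/
noncomputable def run (ε : Bool) : Node g → ℕ
  | root => 0
  | one v s => if Cont ε v s then run ε v + 1 else 1
  | two _ _ _ _ => 1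

/-- The edge `s` from `v` completes one half of the boundary of a polygon. -/
def Full (ε : Bool) (v : Node g) (s : SurfaceLetter g) : Prop :=
  Cont ε v s ∧ run ε v + 1 = 2 * g

/-- The distance to the root. -/
def depth : Node g → ℕ
  | root => 0
  | one v _ => depth v + 1
  | two v _ _ _ => depth v + 1

/-- The vertex reached from `w`, whose last letter is `a`, by following `k` more edges along the
polygon on side `ε`. -/
def arc (ε : Bool) (w : Node g) (a : SurfaceLetter g) : ℕ → Node g
  | 0 => w
  | k + 1 => one (arc ε w a k) ((nx ε)^[k + 1] a)

theorem sizeOf_par_le (ε : Bool) (v : Node g) : sizeOf (par ε v) ≤ sizeOf v := by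
  cases v <;> cases ε <;> simp [par] <;> omega

theorem sizeOf_par_iterate_le (ε : Bool) (v : Node g) (k : ℕ) :
    sizeOf ((par ε)^[k] v) ≤ sizeOf v := by
  induction k with
  | zero => exact le_rfl
  | succ k ih => rw [Function.iterate_succ_apply']; exact (sizeOf_par_le ε _).trans ih

theorem sizeOf_par_iterate_lt {ε : Bool} {v : Node g} {s : SurfaceLetter g} (h : Full ε v s) :
    sizeOf ((par ε)^[2 * g - 1] v) < sizeOf v := by
  obtain ⟨h1, h2⟩ := h
  obtain ⟨k, hk⟩ : ∃ k, 2 * g - 1 = k + 1 := ⟨2 * g - 2, by omega⟩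
  rw [hk, Function.iterate_succ_apply]
  refine (sizeOf_par_iterate_le ε _ k).trans_lt ?_
  cases v with
  | root => simp [Cont, lt] at h1
  | one v s => simp [par]; omega
  | two v s w t => cases ε <;> simp [par] <;> omega

open Classical in
/-- The end point of the edge `s` going upwards from `v`. If the edge completes a half of the
boundary of a polygon, the end point is the top of this polygon. The predecessor on the other
side is found by walking down from `v` to the bottom and then up along the other side. -/
noncomputable def push (v : Node g) (s : SurfaceLetter g) : Node g :=
  if h : Full true v s then
    mkTwo true
      (arc false (push ((par true)^[2 * g - 1] v) (bar ((nx true)^[2 * g] s)))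
        (bar ((nx true)^[2 * g] s)) (2 * g - 2))
      (bar (nx true s)) v s
  else if h : Full false v s then
    mkTwo false
      (arc true (push ((par false)^[2 * g - 1] v) (bar ((nx false)^[2 * g] s)))
        (bar ((nx false)^[2 * g] s)) (2 * g - 2))
      (bar (nx false s)) v s
  else one v s
termination_by sizeOf v
decreasing_by all_goals exact sizeOf_par_iterate_lt h

theorem push_of_full {ε : Bool} {v : Node g} {s : SurfaceLetter g} (h : Full ε v s)
    (h' : ¬ Full (!ε) v s) :
    push v s = mkTwo ε
      (arc (!ε) (push ((par ε)^[2 * g - 1] v) (bar ((nx ε)^[2 * g] s)))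
        (bar ((nx ε)^[2 * g] s)) (2 * g - 2))
      (bar (nx ε s)) v s := by
  cases ε
  · rw [push, dif_neg (show ¬ Full true v s from h'), dif_pos h]; rfl
  · rw [push, dif_pos h]; rfl

theorem push_of_not_full {v : Node g} {s : SurfaceLetter g} (h : ∀ ε, ¬ Full ε v s) :
    push v s = one v s := by
  rw [push, dif_neg (h _), dif_neg (h _)]

@[simp] theorem par_mkTwo (ε : Bool) (v : Node g) (s : SurfaceLetter g) (w : Node g)
    (t : SurfaceLetter g) : par ε (mkTwo ε v s w t) = v := by
  cases ε <;> rfl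

@[simp] theorem lt_mkTwo (ε : Bool) (v : Node g) (s : SurfaceLetter g) (w : Node g)
    (t : SurfaceLetter g) : lt ε (mkTwo ε v s w t) = some s := by
  cases ε <;> rfl

theorem mkTwo_not (ε : Bool) (v : Node g) (s : SurfaceLetter g) (w : Node g)
    (t : SurfaceLetter g) : mkTwo (!ε) v s w t = mkTwo ε w t v s := by
  cases ε <;> rfl

@[simp] theorem par_not_mkTwo (ε : Bool) (v : Node g) (s : SurfaceLetter g) (w : Node g)
    (t : SurfaceLetter g) : par (!ε) (mkTwo ε v s w t) = w := by
  cases ε <;> rfl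

@[simp] theorem lt_not_mkTwo (ε : Bool) (v : Node g) (s : SurfaceLetter g) (w : Node g)
    (t : SurfaceLetter g) : lt (!ε) (mkTwo ε v s w t) = some t := by
  cases ε <;> rfl

@[simp] theorem run_mkTwo (δ ε : Bool) (v : Node g) (s : SurfaceLetter g) (w : Node g)
    (t : SurfaceLetter g) : run δ (mkTwo ε v s w t) = 1 := by
  cases ε <;> rfl

theorem cont_iff {ε : Bool} {v : Node g} {s : SurfaceLetter g} :
    Cont ε v s ↔ ∃ a, lt ε v = some a ∧ s = nx ε a := by
  simp [Cont, eq_comm]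

theorem run_pos {ε : Bool} {v : Node g} (h : v ≠ root) : 0 < run ε v := by
  cases v with
  | root => exact absurd rfl h
  | one v s => rw [run]; split_ifs <;> omega
  | two v s w t => exact Nat.one_pos

theorem exists_lt_of_ne_root {v : Node g} (h : v ≠ root) (ε : Bool) : ∃ a, lt ε v = some a := by
  cases v with
  | root => exact absurd rfl h
  | one v s => exact ⟨s, rfl⟩
  | two v s w t => exact ⟨_, rfl⟩

theorem ne_root_of_lt {v : Node g} {ε : Bool} {a : SurfaceLetter g} (h : lt ε v = some a) :
    v ≠ root := by
  rintro rfl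
  simp [lt] at h

theorem par_iterate_arc (ε : Bool) (w : Node g) (a : SurfaceLetter g) (k : ℕ) :
    (par ε)^[k] (arc ε w a k) = w := by
  induction k with
  | zero => rfl
  | succ k ih => rw [Function.iterate_succ_apply]; exact ih

/-- `Level m v` says that `v` is obtained from the root by `m` steps upwards. -/
inductive Level : ℕ → Node g → Prop
  | base : Level 0 root
  | step {m : ℕ} {v : Node g} {s : SurfaceLetter g} : Level m v → ¬ IsBack v s →
      Level (m + 1) (push v s)

/-- The local structure of the tiling at a vertex `v` at distance `m` from the root: each recorded
predecessor is one level below and leads back to `v`; no outer polygon is already half traversed;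
at most one of the two outer polygons has been followed for more than one edge; and if there are
two incoming edges, they are neighbours in the cyclic order at `v`. -/
structure Good (m : ℕ) (v : Node g) : Prop where
  par_level : ∀ ε a, lt ε v = some a →
    ∃ k, m = k + 1 ∧ Level k (par ε v) ∧ ¬ IsBack (par ε v) a ∧ push (par ε v) a = v
  run_lt : ∀ ε, run ε v < 2 * g
  run_le : ∃ ε, run ε v ≤ 1
  back_adj : ∀ ε a c, lt ε v = some a → lt (!ε) v = some c →
    (v = one (par ε v) a ∧ a = c) ∨ rot ε (bar c) = bar a
  depth_eq : depth v = m

section local_structure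

variable [hg : Fact (2 ≤ g)]

theorem rot_ne (ε : Bool) (s : SurfaceLetter g) : rot ε s ≠ s :=
  rot_iterate_ne ε (j := 1) (by omega) (by have := hg.out; omega) s

theorem rot_rot_ne (ε : Bool) (s : SurfaceLetter g) : rot ε (rot ε s) ≠ s :=
  rot_iterate_ne ε (j := 2) (by omega) (by have := hg.out; omega) s

theorem rot_rot_rot_ne (ε : Bool) (s : SurfaceLetter g) : rot ε (rot ε (rot ε s)) ≠ s :=
  rot_iterate_ne ε (j := 3) (by omega) (by have := hg.out; omega) s

variable {m : ℕ} {v : Node g} {ε : Bool} {s : SurfaceLetter g}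

theorem Good.not_isBack (hv : Good m v) (h : Cont ε v s) : ¬ IsBack v s := by
  obtain ⟨a, ha, rfl⟩ := cont_iff.1 h
  rintro ⟨δ, hδ⟩
  rcases Bool.eq_or_eq_not δ ε with rfl | rfl
  · rw [ha] at hδ
    have : bar a = nx δ a := bar_eq_iff.2 (Option.some_injective _ hδ)
    exact rot_ne δ (bar a) this.symm
  · rcases hv.back_adj ε _ _ ha hδ with ⟨-, h⟩ | h
    · have : bar a = nx ε a := bar_eq_iff.2 h
      exact rot_ne ε (bar a) this.symm
    · rw [bar_bar] at h
      exact rot_rot_ne ε (bar a) h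

theorem Good.not_cont_not (hv : Good m v) (h : Cont ε v s) : ¬ Cont (!ε) v s := by
  intro h'
  obtain ⟨a, ha, rfl⟩ := cont_iff.1 h
  obtain ⟨c, hc, hac⟩ := cont_iff.1 h'
  have h2 : rot ε (rot ε (bar a)) = bar c := by
    rw [rot_eq_iff]; exact hac
  rcases hv.back_adj ε _ _ ha hc with ⟨-, h⟩ | h
  · rw [h] at h2; exact rot_rot_ne ε _ h2
  · rw [← h2] at h; exact rot_rot_rot_ne ε _ h

theorem Good.not_full_not (hv : Good m v) (h : Cont ε v s) : ¬ Full (!ε) v s :=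
  fun h' => hv.not_cont_not h h'.1

omit hg in
/-- If `s` goes up from `v` and does not continue the polygon on side `ε`, then the next edge in
that direction goes up as well: `v` is the bottom of the polygon between them. -/
theorem Good.not_isBack_rot (hv : Good m v) (hs : ¬ IsBack v s) (h : ¬ Cont ε v s) :
    ¬ IsBack v (rot (!ε) s) := by
  rintro ⟨δ, hδ⟩
  have key : ∀ c, bar (rot (!ε) s) = c → s = nx ε c := by
    rintro c rfl
    simp [nx]
  rcases Bool.eq_or_eq_not δ ε with rfl | rfl
  · exact h (cont_iff.2 ⟨_, hδ, key _ rfl⟩)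
  · obtain ⟨a, ha⟩ := exists_lt_of_ne_root (ne_root_of_lt hδ) ε
    rcases hv.back_adj ε _ _ ha hδ with ⟨-, h1⟩ | h1
    · exact h (cont_iff.2 ⟨_, ha, key _ h1.symm⟩)
    · refine hs ⟨ε, ?_⟩
      rw [ha, key _ rfl, nx, h1, bar_bar]

omit hg in
theorem not_cont_of_not_isBack (h : ¬ IsBack v (rot (!ε) s)) : ¬ Cont ε v s := by
  intro hc
  obtain ⟨a, ha, rfl⟩ := cont_iff.1 hc
  exact h ⟨ε, by rw [rot_not_nx, bar_bar, ha]⟩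

/-- At the bottom `v` of a polygon, the first edge `s` of a side starts a new stretch. -/
theorem Good.push_of_bottom (hv : Good m v) (h : ¬ IsBack v (rot (!ε) s)) :
    run ε (push v s) = 1 ∧ lt ε (push v s) = some s ∧ par ε (push v s) = v := by
  have h1 := not_cont_of_not_isBack h
  by_cases h2 : Full (!ε) v s
  · rw [push_of_full h2 (hv.not_full_not h2.1), mkTwo_not]
    simp
  · have h3 : push v s = one v s := by
      apply push_of_not_full
      intro δ
      rcases Bool.eq_or_eq_not δ ε with rfl | rfl
      · exact fun h => h1 h.1
      · exact h2
    rw [h3, run, if_neg h1]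
    exact ⟨rfl, rfl, rfl⟩

omit hg in
/-- Going down along a stretch. -/
theorem exists_eq_arc {M : ℕ} (good : ∀ m ≤ M, ∀ v : Node g, Level m v → Good m v) (ε : Bool) :
    ∀ (k m : ℕ) (v : Node g), m ≤ M → Level m v → run ε v = k + 1 →
      ∃ w a j, v = arc ε w a k ∧ Level j w ∧ m = j + k ∧ run ε w = 1 ∧ lt ε w = some a ∧
        lt ε v = some ((nx ε)^[k] a) := by
  intro k
  induction k with
  | zero =>
    intro m v _ hv hr
    have hne : v ≠ root := by rintro rfl; simp [run] at hr
    obtain ⟨a, ha⟩ := exists_lt_of_ne_root hne ε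
    exact ⟨v, a, m, rfl, hv, rfl, hr, ha, ha⟩
  | succ k ih =>
    intro m v hm hv hr
    cases v with
    | root => simp [run] at hr
    | two v s w t => simp [run] at hr
    | one v s =>
      rw [run] at hr
      split_ifs at hr with hc
      · obtain ⟨j, rfl, hj, -, -⟩ := (good m hm _ hv).par_level ε s rfl
        obtain ⟨w, a, i, rfl, hi, hji, hw, ha, hva⟩ := ih j v (by omega) hj (by omega)
        obtain ⟨c, hc1, rfl⟩ := cont_iff.1 hc
        rw [hva] at hc1
        obtain rfl := Option.some_injective _ hc1
        refine ⟨w, a, i, ?_, hi, by omega, hw, ha, ?_⟩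
        · rw [arc, Function.iterate_succ_apply' (nx ε)]
        · rw [lt, Function.iterate_succ_apply' (nx ε)]
      · omega

/-- Going up along a stretch. -/
theorem arc_up {M : ℕ} (good : ∀ m ≤ M, ∀ v : Node g, Level m v → Good m v) {j : ℕ}
    {w : Node g} {a : SurfaceLetter g} (hw : Level j w) (hr : run ε w = 1)
    (ha : lt ε w = some a) :
    ∀ i, i + 2 ≤ 2 * g → j + i ≤ M →
      Level (j + i) (arc ε w a i) ∧ run ε (arc ε w a i) = i + 1 ∧
        lt ε (arc ε w a i) = some ((nx ε)^[i] a) := by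
  intro i
  induction i with
  | zero => exact fun _ _ => ⟨hw, hr, ha⟩
  | succ i ih =>
    intro hi hM
    obtain ⟨h1, h2, h3⟩ := ih (by omega) (by omega)
    have hc : Cont ε (arc ε w a i) ((nx ε)^[i + 1] a) :=
      cont_iff.2 ⟨_, h3, Function.iterate_succ_apply' _ _ _⟩
    have hG := good _ (by omega) _ h1
    have h4 : push (arc ε w a i) ((nx ε)^[i + 1] a) = arc ε w a (i + 1) := by
      rw [arc]
      apply push_of_not_full
      intro δ
      rcases Bool.eq_or_eq_not δ ε with rfl | rfl
      · rintro ⟨-, h⟩; omega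
      · exact hG.not_full_not hc
    refine ⟨?_, ?_, rfl⟩
    · rw [← h4]
      exact Level.step h1 (hG.not_isBack hc)
    · rw [arc, run, if_pos hc, h2]

/-- The structure of a vertex `v` below the top of a polygon: the bottom `b` of the polygon, the
first vertices `push b a` and `push b (rot (!ε) a)` of its two sides, and the top itself. -/
theorem exists_bottom {M : ℕ} (good : ∀ m ≤ M, ∀ v : Node g, Level m v → Good m v)
    (hv : Level M v) (hf : Full ε v s) :
    ∃ b a j, M = j + (2 * g - 1) ∧ Level j b ∧ ¬ IsBack b a ∧ ¬ IsBack b (rot (!ε) a) ∧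
      v = arc ε (push b a) a (2 * g - 2) ∧ (par ε)^[2 * g - 1] v = b ∧
      s = (nx ε)^[2 * g - 1] a ∧
      push v s = mkTwo ε (arc (!ε) (push b (rot (!ε) a)) (rot (!ε) a) (2 * g - 2))
        (bar (nx ε s)) v s := by
  have hg := hg.out
  obtain ⟨w, a, j, rfl, hj, hMj, hrw, haw, hav⟩ :=
    exists_eq_arc good ε (2 * g - 2) M v le_rfl hv (by have := hf.2; omega)
  have hwG := good j (by omega) w hj
  obtain ⟨i, rfl, hi, hb, hba⟩ := hwG.par_level ε a haw
  have hbG := good i (by omega) _ hi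
  -- the stretch begins at `w`, so its first edge does not continue a stretch ending at `par ε w`
  have hnc : ¬ Cont ε (par ε w) a := by
    intro hc
    by_cases hfu : Full ε (par ε w) a
    · have h1 := haw
      rw [← hba, push_of_full hfu (hbG.not_full_not hfu.1), lt_mkTwo] at h1
      have h2 : nx ε a = bar a := bar_eq_iff.1 (Option.some_injective _ h1)
      exact rot_ne ε _ h2
    · have h1 : push (par ε w) a = one (par ε w) a := by
        apply push_of_not_full
        intro δ
        rcases Bool.eq_or_eq_not δ ε with rfl | rfl
        · exact hfu
        · exact hbG.not_full_not hc
      rw [hba] at h1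
      rw [h1, run, if_pos hc] at hrw
      obtain ⟨x, hx, -⟩ := cont_iff.1 hc
      have := run_pos (ε := ε) (ne_root_of_lt hx)
      omega
  have hs : s = (nx ε)^[2 * g - 1] a := by
    obtain ⟨c, hc, rfl⟩ := cont_iff.1 hf.1
    rw [hav] at hc
    obtain rfl := Option.some_injective _ hc
    rw [← Function.iterate_succ_apply' (nx ε)]
    congr 1; omega
  have hpar : (par ε)^[2 * g - 1] (arc ε w a (2 * g - 2)) = par ε w := by
    rw [show 2 * g - 1 = (2 * g - 2) + 1 by omega, Function.iterate_succ_apply', par_iterate_arc]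
  refine ⟨par ε w, a, i, by omega, hi, hb, hbG.not_isBack_rot hb hnc, by rw [hba], hpar, hs, ?_⟩
  have hr : bar ((nx ε)^[2 * g] s) = rot (!ε) a := by
    rw [hs, ← Function.iterate_add_apply, ← nx_not_iterate_rot ε a (i := 0) (by omega)]
    rfl
  rw [push_of_full hf ((good M le_rfl _ hv).not_full_not hf.1), hr, hpar]

/-- Every vertex obtained from the root by going upwards has the expected local structure. In
particular, the top of a polygon is reached from both of its sides. -/
theorem Level.good : ∀ {m : ℕ} {v : Node g}, Level m v → Good m v := by
  have hg2 := hg.out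
  intro m
  induction m using Nat.strong_induction_on with
  | _ m IH =>
  intro v hv
  cases hv with
  | base =>
    refine ⟨fun ε a h => by simp [lt] at h, fun ε => ?_, ⟨true, by simp [run]⟩,
      fun ε a c h => by simp [lt] at h, rfl⟩
    rw [run]; omega
  | @step M u s hu hs =>
  have good : ∀ m ≤ M, ∀ v : Node g, Level m v → Good m v :=
    fun m hm v hv => IH m (by omega) hv
  have hG := good M le_rfl u hu
  by_cases hf : ∃ ε, Full ε u s
  · -- The edge `s` ends at the top of a polygon with bottom `b`; `r` is the first edge and `q` the
    -- last vertex of the other side.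
    obtain ⟨ε, hf⟩ := hf
    obtain ⟨b, a, j, hM, hb, hba, hbr, hua, hpar, hsa, hpush⟩ := exists_bottom good hu hf
    have hbG := good j (by omega) b hb
    set r := rot (!ε) a with hr
    have hra : rot (!!ε) r = a := by rw [hr, rot_not_rot]
    obtain ⟨hr1, hr2, hr3⟩ := hbG.push_of_bottom (ε := !ε) (s := r) (by rwa [hra])
    obtain ⟨q, hq⟩ : ∃ q, q = arc (!ε) (push b r) r (2 * g - 2) := ⟨_, rfl⟩
    obtain ⟨hq1, hq2, hq3⟩ := arc_up good (Level.step hb hbr) hr1 hr2 (2 * g - 2) (by omega)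
      (by omega)
    rw [← hq] at hq1 hq2 hq3 hpush
    have hqM : j + 1 + (2 * g - 2) = M := by omega
    rw [hqM] at hq1
    have hqG := good M le_rfl q hq1
    have ht : bar (nx ε s) = (nx (!ε))^[2 * g - 1] r := by
      rw [hr, nx_not_iterate_rot ε a (j := 2 * g) (by omega), hsa,
        ← Function.iterate_succ_apply' (nx ε)]
      congr 2; omega
    have hcq : Cont (!ε) q (bar (nx ε s)) := by
      refine cont_iff.2 ⟨_, hq3, ?_⟩
      rw [ht, ← Function.iterate_succ_apply' (nx (!ε))]
      congr 1; omega
    have hfq : Full (!ε) q (bar (nx ε s)) := ⟨hcq, by omega⟩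
    -- computed from the other side, the top is the same term
    have hpq : push q (bar (nx ε s)) = push u s := by
      rw [push_of_full hfq (hqG.not_full_not hcq), hpush]
      have e1 : (par (!ε))^[2 * g - 1] q = b := by
        rw [show 2 * g - 1 = (2 * g - 2) + 1 by omega, Function.iterate_succ_apply', hq,
          par_iterate_arc, hr3]
      have e2 : bar ((nx (!ε))^[2 * g] (bar (nx ε s))) = a := by
        rw [ht, ← Function.iterate_add_apply, ← nx_not_iterate_rot (!ε) r (i := 0) (by omega)]
        exact hra
      rw [e1, e2, nx_not_bar_nx, bar_bar, Bool.not_not, ← hua, mkTwo_not]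
    rw [hpush] at hpq ⊢
    refine ⟨?_, fun δ => by rw [run_mkTwo]; omega, ⟨true, by rw [run_mkTwo]⟩, ?_, ?_⟩
    · intro δ x hx
      refine ⟨M, rfl, ?_⟩
      rcases Bool.eq_or_eq_not δ ε with rfl | rfl
      · rw [lt_mkTwo] at hx
        obtain rfl := Option.some_injective _ hx
        rw [par_mkTwo]
        exact ⟨hq1, hqG.not_isBack hcq, hpq⟩
      · rw [lt_not_mkTwo] at hx
        obtain rfl := Option.some_injective _ hx
        rw [par_not_mkTwo]
        exact ⟨hu, hs, hpush⟩
    · intro δ x y hx hy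
      right
      rcases Bool.eq_or_eq_not δ ε with rfl | rfl
      · rw [lt_mkTwo] at hx
        rw [lt_not_mkTwo] at hy
        rw [← Option.some_injective _ hx, ← Option.some_injective _ hy, bar_bar]
        rfl
      · rw [lt_not_mkTwo] at hx
        rw [Bool.not_not, lt_mkTwo] at hy
        rw [← Option.some_injective _ hx, ← Option.some_injective _ hy, bar_bar]
        exact rot_not_nx ε s
    · cases ε
      · exact congrArg (· + 1) hG.depth_eq
      · exact congrArg (· + 1) hqG.depth_eq
  · push Not at hf
    rw [push_of_not_full hf]
    refine ⟨?_, ?_, ?_, ?_, congrArg (· + 1) hG.depth_eq⟩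
    · intro δ x hx
      obtain rfl := Option.some_injective _ hx
      exact ⟨M, rfl, hu, hs, push_of_not_full hf⟩
    · intro δ
      rw [run]
      split_ifs with hc
      · have h1 := hG.run_lt δ
        have h2 : run δ u + 1 ≠ 2 * g := fun h => hf δ ⟨hc, h⟩
        omega
      · omega
    · by_cases hc : Cont true u s
      · exact ⟨false, by rw [run, if_neg (show ¬ Cont false u s from hG.not_cont_not hc)]⟩
      · exact ⟨true, by rw [run, if_neg hc]⟩
    · intro δ x y hx hy
      left
      rw [← Option.some_injective _ hx, ← Option.some_injective _ hy]
      exact ⟨rfl, rfl⟩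

end local_structure

end Node

end SurfaceTiling

namespace SurfaceTiling

variable {g : ℕ}

/-! ### The action of the surface group on the tiling -/

namespace Node

variable [hg : Fact (2 ≤ g)]

/-- The edge `s` is one of the two outer incoming edges of its upper end point. -/
theorem exists_lt_push {m : ℕ} {v : Node g} (hv : Level m v) (s : SurfaceLetter g) :
    ∃ ε, lt ε (push v s) = some s ∧ par ε (push v s) = v := by
  by_cases h : ∃ ε, Full ε v s
  · obtain ⟨ε, h⟩ := h
    refine ⟨!ε, ?_⟩
    rw [push_of_full h (hv.good.not_full_not h.1)]
    simp
  · push Not at h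
    rw [push_of_not_full h]
    exact ⟨true, rfl, rfl⟩

open Classical in
/-- The neighbour of `v` along the edge labelled by `s`. -/
noncomputable def move (v : Node g) (s : SurfaceLetter g) : Node g :=
  if lt true v = some (bar s) then par true v
  else if lt false v = some (bar s) then par false v
  else push v s

omit hg in
theorem move_of_not_isBack {v : Node g} {s : SurfaceLetter g} (h : ¬ IsBack v s) :
    move v s = push v s := by
  rw [move, if_neg fun h' => h ⟨_, h'⟩, if_neg fun h' => h ⟨_, h'⟩]

theorem move_of_lt {m : ℕ} {v : Node g} (hv : Level m v) {ε : Bool} {s : SurfaceLetter g}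
    (h : lt ε v = some (bar s)) : move v s = par ε v := by
  have key : lt (!ε) v = some (bar s) → par (!ε) v = par ε v := by
    intro h'
    rcases hv.good.back_adj ε _ _ h h' with ⟨h1, -⟩ | h1
    · rw [h1]; rfl
    · exact absurd h1 (rot_ne ε _)
  rw [move]
  cases ε
  · split_ifs with h1
    · exact key h1
    · rfl
  · rw [if_pos h]

theorem level_move {m : ℕ} {v : Node g} (hv : Level m v) (s : SurfaceLetter g) :
    ∃ k, Level k (move v s) := by
  by_cases h : IsBack v s
  · obtain ⟨ε, h⟩ := h
    rw [move_of_lt hv h]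
    obtain ⟨k, -, hk, -⟩ := hv.good.par_level ε _ h
    exact ⟨k, hk⟩
  · rw [move_of_not_isBack h]
    exact ⟨_, Level.step hv h⟩

theorem move_move_bar {m : ℕ} {v : Node g} (hv : Level m v) (s : SurfaceLetter g) :
    move (move v s) (bar s) = v := by
  by_cases h : IsBack v s
  · obtain ⟨ε, h⟩ := h
    rw [move_of_lt hv h]
    obtain ⟨k, -, hk, hb, hp⟩ := hv.good.par_level ε _ h
    rw [move_of_not_isBack hb, hp]
  · rw [move_of_not_isBack h]
    obtain ⟨ε, h1, h2⟩ := exists_lt_push hv s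
    rw [move_of_lt (Level.step hv h) (ε := ε) (by rwa [bar_bar]), h2]

end Node

open Node

/-- The vertices of the tiling. -/
def Vertex (g : ℕ) : Type := {v : Node g // ∃ m, Level m v}

namespace Vertex

variable [hg : Fact (2 ≤ g)]

/-- The neighbour along the edge labelled by `s`. -/
noncomputable def step (v : Vertex g) (s : SurfaceLetter g) : Vertex g :=
  ⟨move v.1 s, level_move v.2.choose_spec s⟩

@[simp] theorem step_step_bar (v : Vertex g) (s : SurfaceLetter g) : (v.step s).step (bar s) = v :=
  Subtype.ext (move_move_bar v.2.choose_spec s)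

@[simp] theorem step_bar_step (v : Vertex g) (s : SurfaceLetter g) : (v.step (bar s)).step s = v := by
  simpa using step_step_bar v (bar s)

/-- The vertex reached after `k` steps along the polygon on side `ε` of the edge `s` from `v`. -/
noncomputable def travel (ε : Bool) (v : Vertex g) (s : SurfaceLetter g) : ℕ → Vertex g
  | 0 => v
  | k + 1 => (travel ε v s k).step ((nx ε)^[k] s)

theorem travel_add (ε : Bool) (v : Vertex g) (s : SurfaceLetter g) (j k : ℕ) :
    travel ε v s (j + k) = travel ε (travel ε v s j) ((nx ε)^[j] s) k := by
  induction k with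
  | zero => rfl
  | succ k ih =>
    rw [← add_assoc, travel, travel, ih, ← Function.iterate_add_apply, add_comm j k]

theorem level_depth (v : Vertex g) : Level (depth v.1) v.1 := by
  obtain ⟨m, hm⟩ := v.2
  rwa [hm.good.depth_eq]

theorem depth_step_of_not_isBack {v : Vertex g} {s : SurfaceLetter g} (h : ¬ IsBack v.1 s) :
    depth (v.step s).1 = depth v.1 + 1 := by
  have : (v.step s).1 = push v.1 s := move_of_not_isBack h
  rw [this]
  exact (Level.step v.level_depth h).good.depth_eq

theorem depth_step_of_isBack {v : Vertex g} {s : SurfaceLetter g} (h : IsBack v.1 s) :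
    depth (v.step s).1 + 1 = depth v.1 := by
  obtain ⟨ε, h⟩ := h
  have : (v.step s).1 = par ε v.1 := move_of_lt v.level_depth h
  rw [this]
  obtain ⟨k, h1, h2, -⟩ := v.level_depth.good.par_level ε _ h
  rw [h1, h2.good.depth_eq]

section bottom

variable {ε : Bool} {b : Vertex g} {s : SurfaceLetter g}

/-- The sides of a polygon, seen from its bottom. -/
theorem level_arc_of_bottom (hs : ¬ IsBack b.1 s) (hr : ¬ IsBack b.1 (rot (!ε) s)) {i : ℕ}
    (hi : i + 2 ≤ 2 * g) :
    Level (depth b.1 + 1 + i) (arc ε (push b.1 s) s i) ∧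
      run ε (arc ε (push b.1 s) s i) = i + 1 ∧
      lt ε (arc ε (push b.1 s) s i) = some ((nx ε)^[i] s) ∧
      Cont ε (arc ε (push b.1 s) s i) ((nx ε)^[i + 1] s) := by
  obtain ⟨h1, h2, -⟩ := b.level_depth.good.push_of_bottom hr
  obtain ⟨h3, h4, h5⟩ := arc_up (M := depth b.1 + 1 + i) (fun _ _ _ h => h.good)
    (Level.step b.level_depth hs) h1 h2 i hi le_rfl
  exact ⟨h3, h4, h5, cont_iff.2 ⟨_, h5, Function.iterate_succ_apply' _ _ _⟩⟩

theorem travel_bottom (hs : ¬ IsBack b.1 s) (hr : ¬ IsBack b.1 (rot (!ε) s)) :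
    ∀ i, i + 2 ≤ 2 * g → (travel ε b s (i + 1)).1 = arc ε (push b.1 s) s i := by
  intro i
  induction i with
  | zero => exact fun _ => move_of_not_isBack hs
  | succ i ih =>
    intro hi
    obtain ⟨h1, h2, h3, h4⟩ := level_arc_of_bottom hs hr (i := i) (by omega)
    have h5 : (travel ε b s (i + 1 + 1)).1 = move (travel ε b s (i + 1)).1 ((nx ε)^[i + 1] s) := rfl
    rw [h5, ih (by omega), move_of_not_isBack (h1.good.not_isBack h4), arc]
    apply push_of_not_full
    intro δ
    rcases Bool.eq_or_eq_not δ ε with rfl | rfl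
    · rintro ⟨-, h⟩; omega
    · exact h1.good.not_full_not h4

/-- The top of a polygon, seen from its bottom. -/
theorem travel_top (hs : ¬ IsBack b.1 s) (hr : ¬ IsBack b.1 (rot (!ε) s)) :
    (travel ε b s (2 * g)).1 =
      mkTwo ε (arc (!ε) (push b.1 (rot (!ε) s)) (rot (!ε) s) (2 * g - 2))
        ((nx (!ε))^[2 * g - 1] (rot (!ε) s))
        (arc ε (push b.1 s) s (2 * g - 2)) ((nx ε)^[2 * g - 1] s) := by
  have hg := hg.out
  obtain ⟨h1, h2, h3, h4⟩ := level_arc_of_bottom hs hr (i := 2 * g - 2) (by omega)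
  have e : 2 * g - 2 + 1 = 2 * g - 1 := by omega
  rw [e] at h4 h2
  have hf : Full ε (arc ε (push b.1 s) s (2 * g - 2)) ((nx ε)^[2 * g - 1] s) := ⟨h4, by omega⟩
  have h5 : (travel ε b s (2 * g)).1 =
      move (travel ε b s (2 * g - 1)).1 ((nx ε)^[2 * g - 1] s) := by
    conv_lhs => rw [show 2 * g = 2 * g - 1 + 1 by omega]
    rfl
  have h6 := travel_bottom hs hr (2 * g - 2) (by omega)
  rw [e] at h6
  rw [h5, h6, move_of_not_isBack (h1.good.not_isBack h4)]
  obtain ⟨b', a, j, -, -, -, -, -, hb', ha, hp⟩ := exists_bottom (fun _ _ _ h => h.good) h1 hf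
  have hb : (par ε)^[2 * g - 1] (arc ε (push b.1 s) s (2 * g - 2)) = b.1 := by
    rw [← e, Function.iterate_succ_apply', par_iterate_arc]
    exact (b.level_depth.good.push_of_bottom hr).2.2
  obtain rfl := (nx_injective ε).iterate _ ha
  rw [hp, ← hb', hb]
  congr 1
  rw [nx_not_iterate_rot ε s (j := 2 * g) (by omega), ← Function.iterate_succ_apply' (nx ε)]
  congr 2; omega

theorem travel_top_eq (hs : ¬ IsBack b.1 s) (hr : ¬ IsBack b.1 (rot (!ε) s)) :
    travel ε b s (2 * g) = travel (!ε) b (rot (!ε) s) (2 * g) := by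
  apply Subtype.ext
  rw [travel_top hs hr, travel_top hr (by simpa using hs)]
  simp [mkTwo_not]

/-- Descending along the second side of a polygon. -/
theorem travel_descend (hs : ¬ IsBack b.1 s) (hr : ¬ IsBack b.1 (rot (!ε) s)) (i : ℕ)
    (hi : i ≤ 2 * g) :
    travel ε b s (2 * g + i) = travel (!ε) b (rot (!ε) s) (2 * g - i) := by
  induction i with
  | zero => exact travel_top_eq hs hr
  | succ i ih =>
    obtain ⟨k, hk⟩ : ∃ k, 2 * g = k + (i + 1) := ⟨2 * g - (i + 1), by omega⟩
    rw [← add_assoc, travel, ih (by omega), show 2 * g - i = k + 1 by omega, travel,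
      show 2 * g - (i + 1) = k by omega, nx_not_iterate_rot ε s (j := 2 * g + i) (by omega)]
    exact step_bar_step _ _

end bottom

/-- The boundary of every polygon is closed. From the bottom, both sides lead to the same top; any
other vertex of the polygon has a neighbour on it that is closer to the root. -/
theorem travel_period (ε : Bool) : ∀ (m : ℕ) (v : Vertex g) (s : SurfaceLetter g),
    depth v.1 = m → travel ε v s (4 * g) = v := by
  intro m
  induction m with
  | zero =>
    intro v s hv
    have h : ∀ t, ¬ IsBack v.1 t := fun t ht => by
      have := depth_step_of_isBack ht
      omega
    rw [show 4 * g = 2 * g + 2 * g by ring, travel_descend (h _) (h _) _ le_rfl, Nat.sub_self]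
    rfl
  | succ m ih =>
    intro v s hv
    by_cases hs : IsBack v.1 s
    · have h1 := ih (v.step s) (nx ε s) (by have := depth_step_of_isBack hs; omega)
      have h2 := travel_add ε v s 1 (4 * g)
      change _ = travel ε (v.step s) (nx ε s) (4 * g) at h2
      rw [h1, add_comm, travel, nx_iterate_period] at h2
      have h3 := congrArg (fun w => step w (bar s)) h2
      simpa using h3
    · by_cases hr : IsBack v.1 (rot (!ε) s)
      · have h1 := ih (v.step (rot (!ε) s)) (bar (rot (!ε) s))
          (by have := depth_step_of_isBack hr; omega)
        have h2 := travel_add ε (v.step (rot (!ε) s)) (bar (rot (!ε) s)) 1 (4 * g)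
        have h3 : nx ε (bar (rot (!ε) s)) = s := by simp [nx]
        change _ = travel ε ((v.step (rot (!ε) s)).step (bar (rot (!ε) s)))
          (nx ε (bar (rot (!ε) s))) (4 * g) at h2
        rw [step_step_bar, h3, add_comm, travel, nx_iterate_period, h1, step_step_bar] at h2
        exact h2.symm
      · rw [show 4 * g = 2 * g + 2 * g by ring, travel_descend hs hr _ le_rfl, Nat.sub_self]
        rfl

/-- The end point of the path from `v` with label `c`. -/
noncomputable def walk (v : Vertex g) (c : List (SurfaceLetter g)) : Vertex g := c.foldl step v

theorem walk_iterate (ε : Bool) (v : Vertex g) (s : SurfaceLetter g) (k : ℕ) :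
    walk v (List.iterate (nx ε) s k) = travel ε v s k := by
  induction k with
  | zero => rfl
  | succ k ih =>
    have : List.iterate (nx ε) s (k + 1) = List.iterate (nx ε) s k ++ [(nx ε)^[k] s] :=
      List.iterate_add _ _ _ _
    rw [this, travel, ← ih, walk, List.foldl_append]
    rfl

/-- The permutation of the vertices that moves each of them along the edge labelled by `s`. -/
noncomputable def stepPerm (s : SurfaceLetter g) : Equiv.Perm (Vertex g) where
  toFun v := v.step s
  invFun v := v.step (bar s)
  left_inv v := step_step_bar v s
  right_inv v := step_bar_step v s

end Vertex

theorem relatorWord_eq_iterate (hg : 0 < g) :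
    relatorWord g = List.iterate (nx true) (Sum.inl ⟨0, hg⟩, true) (4 * g) := by
  have h4 : ∀ i : Fin g, List.iterate (nx true) ((Sum.inl i : Fin g ⊕ Fin g), true) 4 =
      [(Sum.inl i, true), (Sum.inr i, true), (Sum.inl i, false), (Sum.inr i, false)] := by
    intro i
    simp [List.iterate, nx, rot, bar]
  have hit : ∀ k (hk : k < g), (nx true)^[4 * k] ((Sum.inl ⟨0, hg⟩ : Fin g ⊕ Fin g), true) =
      (Sum.inl ⟨k, hk⟩, true) := by
    intro k
    induction k with
    | zero => intro _; rfl
    | succ k ih =>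
      intro hk
      rw [show 4 * (k + 1) = 4 + 4 * k by ring, Function.iterate_add_apply, ih (by omega)]
      simp only [Function.iterate_succ, Function.comp, Function.iterate_zero, id, nx, rot, bar,
        Bool.not_true, Bool.not_false]
      obtain _ | m := g
      · omega
      rw [finRotate_of_lt (by omega)]
  have key : ∀ k ≤ g, ((List.ofFn fun i : Fin g =>
      [((Sum.inl i : Fin g ⊕ Fin g), true), (Sum.inr i, true),
        (Sum.inl i, false), (Sum.inr i, false)]).take k).flatten =
      List.iterate (nx true) (Sum.inl ⟨0, hg⟩, true) (4 * k) := by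
    intro k
    induction k with
    | zero => intro _; rfl
    | succ k ih =>
      intro hk
      rw [List.take_add_one, List.getElem?_eq_getElem (by simpa using hk), Option.toList_some,
        List.flatten_append, ih (by omega), show 4 * (k + 1) = 4 * k + 4 by ring,
        List.iterate_add, hit k (by omega), h4, List.getElem_ofFn]
      simp
  have := key g le_rfl
  rwa [List.take_of_length_le (by simp)] at this

/-- Every letter occurs in the basic relation. -/
theorem exists_nx_iterate (s t : SurfaceLetter g) : ∃ j, t = (nx true)^[j] s := by
  have hg : 0 < g := by
    obtain ⟨i | i, -⟩ := s <;> exact Nat.lt_of_le_of_lt (Nat.zero_le _) i.2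
  have : NeZero (4 * g) := ⟨by omega⟩
  have h : ∀ k : ℕ, faceRank ((nx true)^[k] s) = faceRank s + k := by
    intro k
    induction k with
    | zero => simp
    | succ k ih => rw [Function.iterate_succ_apply', faceRank_nx_true, ih]; push_cast; ring
  refine ⟨(faceRank t - faceRank s).val, faceRank_injective ?_⟩
  rw [h, ZMod.natCast_zmod_val]
  ring

/-! ### Words and group elements -/

theorem wordVal_nil : wordVal ([] : List (SurfaceLetter g)) = 1 := by
  simp [wordVal, ← FreeGroup.one_eq_mk]

theorem wordVal_append (c d : List (SurfaceLetter g)) :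
    wordVal (c ++ d) = wordVal c * wordVal d := by
  simp [wordVal, ← FreeGroup.mul_mk]

theorem wordVal_bar (s : SurfaceLetter g) : wordVal [bar s] = (wordVal [s])⁻¹ := by
  rw [wordVal, wordVal, ← map_inv, FreeGroup.inv_mk]
  rfl

/-- The group element reached after `k` steps along the polygon on side `ε` of the edge `s`. -/
def sideVal (ε : Bool) (s : SurfaceLetter g) (k : ℕ) : SurfaceGroup g :=
  wordVal (List.iterate (nx ε) s k)

theorem sideVal_add (ε : Bool) (s : SurfaceLetter g) (j k : ℕ) :
    sideVal ε s (j + k) = sideVal ε s j * sideVal ε ((nx ε)^[j] s) k := by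
  rw [sideVal, List.iterate_add, wordVal_append]
  rfl

theorem sideVal_succ (ε : Bool) (s : SurfaceLetter g) (k : ℕ) :
    sideVal ε s (k + 1) = sideVal ε s k * wordVal [(nx ε)^[k] s] :=
  sideVal_add ε s k 1

theorem sideVal_zero (ε : Bool) (s : SurfaceLetter g) : sideVal ε s 0 = 1 := wordVal_nil

theorem sideVal_true_period (s : SurfaceLetter g) : sideVal true s (4 * g) = 1 := by
  have hg : 0 < g := by
    obtain ⟨i | i, -⟩ := s <;> exact Nat.lt_of_le_of_lt (Nat.zero_le _) i.2
  obtain ⟨j, rfl⟩ := exists_nx_iterate ((Sum.inl ⟨0, hg⟩ : Fin g ⊕ Fin g), true) s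
  have h0 : sideVal true ((Sum.inl ⟨0, hg⟩ : Fin g ⊕ Fin g), true) (4 * g) = 1 := by
    rw [sideVal, ← relatorWord_eq_iterate hg, wordVal, mk_relatorWord]
    exact (PresentedGroup.one_of_mem rfl)
  have h1 := sideVal_add true ((Sum.inl ⟨0, hg⟩ : Fin g ⊕ Fin g), true) j (4 * g)
  rw [add_comm, sideVal_add, h0, nx_iterate_period, one_mul] at h1
  exact mul_left_cancel (a := sideVal true _ j) (by rw [← h1, mul_one])

theorem sideVal_descend {ε : Bool} {s : SurfaceLetter g} (h : sideVal ε s (4 * g) = 1) (i : ℕ)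
    (hi : i ≤ 4 * g) : sideVal ε s (4 * g - i) = sideVal (!ε) (rot (!ε) s) i := by
  induction i with
  | zero => rw [Nat.sub_zero, h, sideVal_zero]
  | succ i ih =>
    have h1 := ih (by omega)
    rw [show 4 * g - i = 4 * g - (i + 1) + 1 by omega, sideVal_succ] at h1
    rw [sideVal_succ, ← h1, nx_not_iterate_rot ε s (j := 4 * g - (i + 1)) (by omega), wordVal_bar,
      mul_inv_cancel_right]

theorem sideVal_period (ε : Bool) (s : SurfaceLetter g) : sideVal ε s (4 * g) = 1 := by
  cases ε
  · have h := sideVal_descend (sideVal_true_period (rot true s)) (4 * g) le_rfl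
    have h2 : rot false (rot true s) = s := rot_not_rot true s
    rw [Nat.sub_self, sideVal_zero, Bool.not_true, h2] at h
    exact h.symm
  · exact sideVal_true_period s

/-- The two halves of the boundary of a polygon have the same end point. -/
theorem sideVal_half (ε : Bool) (s : SurfaceLetter g) :
    sideVal ε s (2 * g) = sideVal (!ε) (rot (!ε) s) (2 * g) := by
  rw [← sideVal_descend (sideVal_period ε s) (2 * g) (by omega)]
  congr 1; omega

end SurfaceTiling

namespace SurfaceTiling

variable {g : ℕ}

open Node Vertex

/-! ### Group elements as vertices of the tiling -/

section

variable [hg : Fact (2 ≤ g)]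

theorem prod_stepPerm_inv (c : List (SurfaceLetter g)) (v : Vertex g) :
    ((c.map fun s => stepPerm (bar s)).prod)⁻¹ v = walk v c := by
  induction c generalizing v with
  | nil => rfl
  | cons s c ih =>
    rw [List.map_cons, List.prod_cons, mul_inv_rev, Equiv.Perm.mul_apply, ih]
    have : (stepPerm (bar s))⁻¹ v = v.step s := by
      rw [Equiv.Perm.inv_eq_iff_eq]
      exact (step_step_bar v s).symm
    rw [this]
    rfl

/-- The action of the free group on the vertices for which `x⁻¹` moves a vertex along the path
labelled by `x`. -/
noncomputable def freeAct : FreeGroup (Fin g ⊕ Fin g) →* Equiv.Perm (Vertex g) :=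
  FreeGroup.lift fun i => stepPerm (i, false)

theorem freeAct_mk (c : List (SurfaceLetter g)) :
    freeAct (FreeGroup.mk c) = (c.map fun s => stepPerm (bar s)).prod := by
  rw [freeAct, FreeGroup.lift_mk]
  congr 1
  apply List.map_congr_left
  rintro ⟨i, b⟩ -
  cases b
  · ext v
    rfl
  · rfl

/-- The action of the surface group on the vertices of the tiling. -/
noncomputable def act : SurfaceGroup g →* Equiv.Perm (Vertex g) :=
  PresentedGroup.toGroup (f := fun i => stepPerm (i, false)) (rels := {surfaceRelator g}) (by
    rintro r rfl
    change freeAct (surfaceRelator g) = 1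
    rw [← mk_relatorWord, freeAct_mk, ← inv_eq_one]
    ext v
    rw [prod_stepPerm_inv, relatorWord_eq_iterate (by have := hg.out; omega), walk_iterate,
      travel_period true _ v _ rfl]
    rfl)

theorem act_wordVal (c : List (SurfaceLetter g)) :
    act (wordVal c) = (c.map fun s => stepPerm (bar s)).prod := by
  rw [← freeAct_mk]
  rfl

/-- The root, as a vertex of the tiling. -/
def origin : Vertex g := ⟨root, 0, Level.base⟩

/-- The vertex of the tiling that corresponds to an element of the surface group. -/
noncomputable def vertex (x : SurfaceGroup g) : Vertex g := act x⁻¹ origin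

/-- The combinatorial vertex that corresponds to an element of the surface group. -/
noncomputable def node (x : SurfaceGroup g) : Node g := (vertex x).1

theorem vertex_mul_wordVal (x : SurfaceGroup g) (c : List (SurfaceLetter g)) :
    vertex (x * wordVal c) = walk (vertex x) c := by
  rw [vertex, mul_inv_rev, map_mul, Equiv.Perm.mul_apply, map_inv, act_wordVal, prod_stepPerm_inv]
  rfl

theorem vertex_mul (x : SurfaceGroup g) (s : SurfaceLetter g) :
    vertex (x * wordVal [s]) = (vertex x).step s :=
  vertex_mul_wordVal x [s]

theorem vertex_mul_sideVal (ε : Bool) (x : SurfaceGroup g) (s : SurfaceLetter g) (k : ℕ) :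
    vertex (x * sideVal ε s k) = travel ε (vertex x) s k := by
  rw [sideVal, vertex_mul_wordVal, walk_iterate]

theorem node_mul (x : SurfaceGroup g) (s : SurfaceLetter g) :
    node (x * wordVal [s]) = move (node x) s :=
  congrArg Subtype.val (vertex_mul x s)

theorem node_one : node (1 : SurfaceGroup g) = root := by
  rw [node, vertex, inv_one, map_one]
  rfl

theorem level_node (x : SurfaceGroup g) : Level (depth (node x)) (node x) :=
  (vertex x).level_depth

/-- The group element represented by a combinatorial vertex. For a vertex with two predecessors
the left one is used; by `val_push` the right one gives the same element. -/
def val : Node g → SurfaceGroup g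
  | root => 1
  | one v s => val v * wordVal [s]
  | two v s _ _ => val v * wordVal [s]

omit hg in
theorem val_arc (ε : Bool) (w : Node g) (a : SurfaceLetter g) (k : ℕ) :
    wordVal [a] * (val w)⁻¹ * val (arc ε w a k) = sideVal ε a (k + 1) := by
  induction k with
  | zero => simp [arc, sideVal, List.iterate]
  | succ k ih => rw [sideVal_succ, ← ih, arc, val, mul_assoc, mul_assoc, mul_assoc]

theorem val_push : ∀ (m : ℕ) (v : Node g) (s : SurfaceLetter g), Level m v →
    val (push v s) = val v * wordVal [s] := by
  intro m
  induction m using Nat.strong_induction_on with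
  | _ m IH =>
  intro v s hv
  have hg2 := hg.out
  by_cases h : ∃ ε, Full ε v s
  · obtain ⟨ε, h⟩ := h
    obtain ⟨b, a, j, hj, hb, -, -, hv', -, hs, hp⟩ := exists_bottom (fun _ _ _ h => h.good) hv h
    cases ε
    · rw [hp]; rfl
    -- if `v` is the right predecessor of the top, the relation carries one side to the other
    · have e : 2 * g - 2 + 1 = 2 * g - 1 := by omega
      have e2 : 2 * g - 1 + 1 = 2 * g := by omega
      have h1 := val_arc true (push b a) a (2 * g - 2)
      have h2 := val_arc false (push b (rot false a)) (rot false a) (2 * g - 2)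
      rw [IH j (by omega) b _ hb, mul_inv_rev, mul_inv_cancel_left, e] at h1 h2
      rw [← hv'] at h1
      have h3 := sideVal_half true a
      rw [← e2, sideVal_succ, sideVal_succ, ← h1, Bool.not_true, ← h2, ← hs, mul_assoc, mul_assoc,
        mul_right_inj] at h3
      rw [hp, h3]
      have h4 : bar (nx true s) = (nx false)^[2 * g - 1] (rot false a) := by
        have := nx_not_iterate_rot true a (i := 2 * g - 1) (j := 2 * g) (by omega)
        rw [Bool.not_true] at this
        rw [this, hs, ← Function.iterate_succ_apply' (nx true)]
        congr 2
      rw [h4]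
      rfl
  · push Not at h
    rw [push_of_not_full h]
    rfl

theorem val_move {m : ℕ} {v : Node g} (hv : Level m v) (s : SurfaceLetter g) :
    val (move v s) = val v * wordVal [s] := by
  by_cases h : IsBack v s
  · obtain ⟨ε, h⟩ := h
    obtain ⟨k, -, hk, -, hp⟩ := hv.good.par_level ε _ h
    have := val_push k _ (bar s) hk
    rw [hp, wordVal_bar] at this
    rw [move_of_lt hv h, this, inv_mul_cancel_right]
  · rw [move_of_not_isBack h, val_push m v s hv]

omit hg in
theorem exists_wordVal (x : SurfaceGroup g) : ∃ c, wordVal c = x := by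
  obtain ⟨y, rfl⟩ := PresentedGroup.mk_surjective _ x
  obtain ⟨c, rfl⟩ := Quot.exists_rep y
  exact ⟨c, rfl⟩

/-- Distinct group elements are distinct vertices, since the element can be recovered. -/
theorem val_node (x : SurfaceGroup g) : val (node x) = x := by
  obtain ⟨c, rfl⟩ := exists_wordVal x
  induction c using List.reverseRecOn with
  | nil => rw [wordVal_nil, node_one]; rfl
  | append_singleton c s ih => rw [wordVal_append, node_mul, val_move (level_node _), ih]

theorem node_injective : Function.Injective (node (g := g)) :=
  Function.LeftInverse.injective val_node

theorem wordVal_singleton_injective {s t : SurfaceLetter g} (h : wordVal [s] = wordVal [t]) :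
    s = t := by
  have h1 := node_mul 1 s
  rw [h, node_mul, node_one] at h1
  have h2 : ∀ t : SurfaceLetter g, move root t = one root t := by
    intro t
    rw [move_of_not_isBack (by simp [IsBack, lt]), push_of_not_full]
    rintro ε ⟨h, -⟩
    simp [Node.Cont, lt] at h
  rw [h2, h2] at h1
  injection h1 with _ h3
  exact h3.symm

theorem depth_mul_le (x : SurfaceGroup g) (s : SurfaceLetter g) :
    depth (node (x * wordVal [s])) ≤ depth (node x) + 1 := by
  rw [node, vertex_mul, node]
  by_cases h : IsBack (vertex x).1 s
  · have := depth_step_of_isBack h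
    omega
  · rw [depth_step_of_not_isBack h]

theorem depth_wordVal_le (c : List (SurfaceLetter g)) : depth (node (wordVal c)) ≤ c.length := by
  induction c using List.reverseRecOn with
  | nil => rw [wordVal_nil, node_one]; rfl
  | append_singleton c s ih =>
    rw [wordVal_append, List.length_append]
    exact (depth_mul_le _ s).trans (by simpa using ih)

omit hg in
theorem exists_word_of_val (v : Node g) : ∃ c, wordVal c = val v ∧ c.length = depth v := by
  induction v with
  | root => exact ⟨[], wordVal_nil, rfl⟩
  | one v s ih =>
    obtain ⟨c, h1, h2⟩ := ih
    exact ⟨c ++ [s], by rw [wordVal_append, h1]; rfl, by simp [h2, depth]⟩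
  | two v s w t ih _ =>
    obtain ⟨c, h1, h2⟩ := ih
    exact ⟨c ++ [s], by rw [wordVal_append, h1]; rfl, by simp [h2, depth]⟩

/-- The word length is the distance to the root of the tiling. -/
theorem wordLength_eq_depth (x : SurfaceGroup g) :
    wordLength (surfaceGens g) x = depth (node x) := by
  apply le_antisymm
  · obtain ⟨c, h1, h2⟩ := exists_word_of_val (node x)
    rw [val_node] at h1
    refine Nat.sInf_le ⟨c.map fun s => wordVal [s], ?_, by simpa using h2, ?_⟩
    · intro s hs
      obtain ⟨t, -, rfl⟩ := List.mem_map.1 hs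
      exact ⟨t, rfl⟩
    · rw [← h1]
      clear h1 h2
      induction c with
      | nil => exact wordVal_nil.symm
      | cons s c ih =>
        rw [List.map_cons, List.prod_cons, ih, ← wordVal_append]
        rfl
  · obtain ⟨c, h1, -⟩ := exists_word_of_val (node x)
    rw [val_node] at h1
    refine le_csInf ⟨c.length, c.map fun s => wordVal [s], ?_, by simp, ?_⟩ ?_
    · intro s hs
      obtain ⟨t, -, rfl⟩ := List.mem_map.1 hs
      exact ⟨t, rfl⟩
    · rw [← h1]
      clear h1
      induction c with
      | nil => exact wordVal_nil.symm
      | cons s c ih =>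
        rw [List.map_cons, List.prod_cons, ih, ← wordVal_append]
        rfl
    · rintro n ⟨l, hl, rfl, rfl⟩
      have : ∃ c : List (SurfaceLetter g), wordVal c = l.prod ∧ c.length = l.length := by
        clear h1
        induction l with
        | nil => exact ⟨[], wordVal_nil, rfl⟩
        | cons y l ih =>
          obtain ⟨d, h1, h2⟩ := ih fun s hs => hl s (List.mem_cons_of_mem _ hs)
          obtain ⟨t, rfl⟩ := hl y List.mem_cons_self
          exact ⟨t :: d, by rw [List.prod_cons, ← h1, ← wordVal_append]; rfl, by simp [h2]⟩
      obtain ⟨d, h2, h3⟩ := this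
      rw [← h2, ← h3]
      exact depth_wordVal_le d

theorem surfaceLength_eq_depth (x : SurfaceGroup g) : surfaceLength x = depth (node x) :=
  wordLength_eq_depth x

theorem depth_node_mul {x : SurfaceGroup g} {s : SurfaceLetter g} (h : ¬ IsBack (node x) s) :
    depth (node (x * wordVal [s])) = depth (node x) + 1 := by
  rw [node, vertex_mul]
  exact depth_step_of_not_isBack h

theorem depth_node_mul_back {x : SurfaceGroup g} {s : SurfaceLetter g} (h : IsBack (node x) s) :
    depth (node (x * wordVal [s])) + 1 = depth (node x) := by
  rw [node, vertex_mul]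
  exact depth_step_of_isBack h

theorem node_mul_push {x : SurfaceGroup g} {s : SurfaceLetter g} (h : ¬ IsBack (node x) s) :
    node (x * wordVal [s]) = push (node x) s := by
  rw [node_mul, move_of_not_isBack h]

theorem mem_successors_iff {x y : SurfaceGroup g} :
    y ∈ successors (surfaceGens g) x ↔ ∃ s, ¬ IsBack (node x) s ∧ y = x * wordVal [s] := by
  constructor
  · rintro ⟨⟨-, ⟨s, rfl⟩, rfl⟩, h⟩
    refine ⟨s, fun hb => ?_, rfl⟩
    rw [wordLength_eq_depth, wordLength_eq_depth] at h
    have := depth_node_mul_back hb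
    omega
  · rintro ⟨s, hs, rfl⟩
    refine ⟨⟨_, ⟨s, rfl⟩, rfl⟩, ?_⟩
    rw [wordLength_eq_depth, wordLength_eq_depth, depth_node_mul hs]

theorem node_eq_root_iff {x : SurfaceGroup g} : node x = root ↔ x = 1 := by
  rw [← node_one, node_injective.eq_iff]

/-- The predecessors of `x`, seen in the group. -/
theorem node_mul_bar {x : SurfaceGroup g} {ε : Bool} {a : SurfaceLetter g}
    (h : lt ε (node x) = some a) : node (x * wordVal [bar a]) = par ε (node x) := by
  rw [node_mul, move_of_lt (level_node x) (by rwa [bar_bar])]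

/-! ### Geodesic words -/

theorem isGeodesicWord_append_singleton {c : List (SurfaceLetter g)} {s : SurfaceLetter g}
    {x : SurfaceGroup g} : IsGeodesicWord (c ++ [s]) x ↔
      IsBack (node x) (bar s) ∧ IsGeodesicWord c (x * wordVal [bar s]) := by
  have e : wordVal (c ++ [s]) = x ↔ wordVal c = x * wordVal [bar s] := by
    rw [wordVal_append, wordVal_bar, eq_mul_inv_iff_mul_eq]
  rw [IsGeodesicWord, IsGeodesicWord, e, surfaceLength_eq_depth, surfaceLength_eq_depth,
    List.length_append, List.length_singleton]
  constructor
  · rintro ⟨h1, h2⟩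
    have hb : IsBack (node x) (bar s) := by
      by_contra hb
      have h3 := depth_node_mul hb
      have h4 := depth_wordVal_le c
      rw [h1] at h4
      omega
    exact ⟨hb, h1, by have := depth_node_mul_back hb; omega⟩
  · rintro ⟨hb, h1, h2⟩
    exact ⟨h1, by have := depth_node_mul_back hb; omega⟩

theorem exists_isGeodesicWord (x : SurfaceGroup g) : ∃ c, IsGeodesicWord c x := by
  obtain ⟨c, h1, h2⟩ := exists_word_of_val (node x)
  rw [val_node] at h1
  exact ⟨c, h1, by rw [surfaceLength_eq_depth, h2]⟩

end

end SurfaceTiling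

namespace SurfaceTiling

variable {g : ℕ}

open Node Vertex

/-! ### Fundamental relators and Cannon types -/

theorem iterate_rotate {α : Type*} (f : α → α) {m : ℕ} (hf : ∀ a, f^[m] a = a) (a : α) (n : ℕ) :
    (List.iterate f a m).rotate n = List.iterate f (f^[n] a) m := by
  induction n generalizing a with
  | zero => simp
  | succ n ih =>
    rw [add_comm, ← List.rotate_rotate, add_comm, Function.iterate_succ_apply, ← ih]
    congr 1
    obtain _ | m := m
    · rfl
    · rw [List.iterate, List.rotate_cons_succ, List.rotate_zero, List.iterate_add,
        ← Function.iterate_succ_apply, hf]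
      rfl

theorem invRev_iterate (s : SurfaceLetter g) :
    FreeGroup.invRev (List.iterate (nx true) s (4 * g)) =
      List.iterate (nx false) (rot false s) (4 * g) := by
  apply List.ext_getElem
  · simp
  · intro i h1 h2
    have hi : i < 4 * g := by simpa using h2
    have h3 := nx_not_iterate_rot true s (i := i) (j := 4 * g - 1 - i) (by omega)
    rw [Bool.not_true] at h3
    rw [List.getElem_iterate, h3]
    simp [FreeGroup.invRev, bar]

/-- Fundamental relators are the boundaries of polygons, read in either direction from any
vertex. -/
theorem isFundamentalRelator_iff (hg : 0 < g) {r : List (SurfaceLetter g)} :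
    IsFundamentalRelator r ↔ ∃ ε s, r = List.iterate (nx ε) s (4 * g) := by
  rw [IsFundamentalRelator, relatorWord_eq_iterate hg, invRev_iterate]
  constructor
  · rintro (h | h)
    · obtain ⟨n, rfl⟩ := h.symm
      exact ⟨true, _, iterate_rotate _ (nx_iterate_period true) _ n⟩
    · obtain ⟨n, rfl⟩ := h.symm
      exact ⟨false, _, iterate_rotate _ (nx_iterate_period false) _ n⟩
  · rintro ⟨ε, s, rfl⟩
    cases ε
    · right
      have h : ∃ j, s = (nx false)^[j] (rot false ((Sum.inl ⟨0, hg⟩ : Fin g ⊕ Fin g), true)) := by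
        obtain ⟨j, hj⟩ := exists_nx_iterate (bar s)
          (bar (rot false ((Sum.inl ⟨0, hg⟩ : Fin g ⊕ Fin g), true)))
        refine ⟨j, bar_injective ?_⟩
        have h2 := nx_iterate_bar_nx_iterate false j (bar ((nx true)^[j] (bar s)))
        rw [bar_bar, ← hj, bar_bar] at h2
        have h3 := nx_iterate_bar_nx_iterate false j (bar s)
        rw [Bool.not_false, ← hj, bar_bar, bar_bar] at h3
        rw [← h3]
      obtain ⟨j, rfl⟩ := h
      exact List.IsRotated.symm ⟨j, iterate_rotate _ (nx_iterate_period false) _ j⟩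
    · left
      obtain ⟨j, rfl⟩ := exists_nx_iterate ((Sum.inl ⟨0, hg⟩ : Fin g ⊕ Fin g), true) s
      exact List.IsRotated.symm ⟨j, iterate_rotate _ (nx_iterate_period true) _ j⟩

namespace Node

/-- The Cannon type, read off from the combinatorial vertex. -/
noncomputable def ctype : Node g → ℕ
  | root => 0
  | one v s => max (run true (one v s)) (run false (one v s))
  | two _ _ _ _ => 2 * g

theorem ctype_mkTwo (ε : Bool) (v w : Node g) (s t : SurfaceLetter g) :
    ctype (mkTwo ε v s w t) = 2 * g := by
  cases ε <;> rfl

variable [hg : Fact (2 ≤ g)]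

omit hg in
/-- A vertex with two predecessors is the top of a polygon. -/
theorem Level.two_inv {m : ℕ} {v w : Node g} {s t : SurfaceLetter g}
    (h : Level m (two v s w t)) : ∃ ε u a k, Level k u ∧ ¬ IsBack u a ∧ Full ε u a ∧
      two v s w t = push u a ∧ m = k + 1 := by
  generalize hx : two v s w t = x at h
  cases h with
  | base => cases hx
  | @step k u a hu ha =>
    by_cases hf : ∃ ε, Full ε u a
    · obtain ⟨ε, hf⟩ := hf
      exact ⟨ε, u, a, k, hu, ha, hf, rfl, rfl⟩
    · push Not at hf
      rw [push_of_not_full hf] at hx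
      cases hx

theorem push_cases {m : ℕ} {v : Node g} (hv : Level m v) (s : SurfaceLetter g) :
    (∃ ε w t, Full ε v s ∧ push v s = mkTwo ε w t v s ∧ t = bar (nx ε s)) ∨
      ((∀ ε, ¬ Full ε v s) ∧ push v s = one v s) := by
  by_cases hf : ∃ ε, Full ε v s
  · obtain ⟨ε, hf⟩ := hf
    left
    exact ⟨ε, _, _, hf, push_of_full hf (hv.good.not_full_not hf.1), rfl⟩
  · push Not at hf
    exact Or.inr ⟨hf, push_of_not_full hf⟩

theorem run_le_ctype {m : ℕ} {v : Node g} (hv : Level m v) (ε : Bool) : run ε v ≤ ctype v := by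
  cases v with
  | root => exact Nat.zero_le _
  | one v s => cases ε; exacts [le_max_right _ _, le_max_left _ _]
  | two v s w t => exact (hv.good.run_lt ε).le

theorem ctype_le {m : ℕ} {v : Node g} (hv : Level m v) : ctype v ≤ 2 * g := by
  cases v with
  | root => exact Nat.zero_le _
  | one v s => exact max_le (hv.good.run_lt _).le (hv.good.run_lt _).le
  | two v s w t => exact le_rfl

end Node

section

variable [hg : Fact (2 ≤ g)]

/-- If the final `k + 1` letters of a geodesic follow the polygon on side `ε`, then either this
polygon lies outside the incoming edges, or its top is the end point of the geodesic. -/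
theorem run_of_isGeodesicWord (ε : Bool) (s : SurfaceLetter g) (k : ℕ) :
    ∀ (x : SurfaceGroup g) (c : List (SurfaceLetter g)),
      IsGeodesicWord (c ++ List.iterate (nx ε) s (k + 1)) x →
      (lt ε (node x) = some ((nx ε)^[k] s) ∧ k + 1 ≤ run ε (node x)) ∨
        (lt (!ε) (node x) = some ((nx ε)^[k] s) ∧ lt ε (node x) ≠ some ((nx ε)^[k] s) ∧
          ctype (node x) = 2 * g ∧ k + 1 ≤ 2 * g) := by
  have hg2 := hg.out
  induction k with
  | zero =>
    intro x c h
    obtain ⟨⟨δ, hb⟩, -⟩ := isGeodesicWord_append_singleton.1 h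
    rw [bar_bar] at hb
    by_cases hε : lt ε (node x) = some s
    · exact Or.inl ⟨hε, run_pos (ne_root_of_lt hε)⟩
    · right
      rcases Bool.eq_or_eq_not δ ε with rfl | rfl
      · exact absurd hb hε
      · refine ⟨hb, hε, ?_, by omega⟩
        cases hx : node x with
        | root => rw [hx] at hb; simp [lt] at hb
        | one v a => rw [hx] at hb hε; exact absurd hb hε
        | two v a w b => rfl
  | succ k ih =>
    intro x c h
    have e : List.iterate (nx ε) s (k + 1 + 1) =
      List.iterate (nx ε) s (k + 1) ++ [(nx ε)^[k + 1] s] := List.iterate_add _ _ _ _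
    rw [e, ← List.append_assoc] at h
    obtain ⟨⟨δ, hb⟩, h2⟩ := isGeodesicWord_append_singleton.1 h
    rw [bar_bar] at hb
    obtain ⟨j, hj, hl, hnb, hp⟩ := (level_node x).good.par_level δ _ hb
    rw [← node_mul_bar hb] at hl hnb hp
    set y := x * wordVal [bar ((nx ε)^[k + 1] s)]
    rw [Function.iterate_succ_apply' (nx ε)] at hb hnb hp ⊢
    set a := (nx ε)^[k] s
    rcases ih _ _ h2 with ⟨h3, h4⟩ | ⟨h3, h4, -⟩
    · have hc : Node.Cont ε (node y) (nx ε a) := cont_iff.2 ⟨_, h3, rfl⟩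
      rcases push_cases hl (nx ε a) with ⟨δ', w, t, hf, hpu, rfl⟩ | ⟨hf, hpu⟩
      · have hδ : δ' = ε := by
          rcases Bool.eq_or_eq_not δ' ε with rfl | rfl
          · rfl
          · exact absurd hf (hl.good.not_full_not hc)
        subst hδ
        right
        rw [← hp, hpu, lt_not_mkTwo, lt_mkTwo, ctype_mkTwo]
        refine ⟨rfl, fun h => ?_, rfl, ?_⟩
        · have := Option.some_injective _ h
          rw [bar_eq_iff] at this
          exact rot_ne _ _ this
        · have := hf.2
          omega
      · left
        rw [← hp, hpu, run, if_pos hc]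
        exact ⟨rfl, by omega⟩
    · -- at a vertex with two predecessors the letter after the top of the polygon goes down
      obtain ⟨a', ha'⟩ := exists_lt_of_ne_root (ne_root_of_lt h3) ε
      rcases hl.good.back_adj ε _ _ ha' h3 with ⟨-, h5⟩ | h5
      · exact absurd (h5 ▸ ha') h4
      · exact absurd ⟨ε, by rw [nx, h5, bar_bar, ha']⟩ hnb

/-- Geodesics to `x` following the polygon outside the incoming edge on side `ε`. -/
theorem exists_isGeodesicWord_run (ε : Bool) (k : ℕ) : ∀ (x : SurfaceGroup g),
    run ε (node x) = k + 1 → ∃ c s, IsGeodesicWord (c ++ List.iterate (nx ε) s (k + 1)) x ∧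
      lt ε (node x) = some ((nx ε)^[k] s) := by
  have key : ∀ (x : SurfaceGroup g) a d, lt ε (node x) = some a →
      IsGeodesicWord d (x * wordVal [bar a]) → IsGeodesicWord (d ++ [a]) x := fun x a d h hd =>
    isGeodesicWord_append_singleton.2 ⟨⟨ε, by rwa [bar_bar]⟩, hd⟩
  induction k with
  | zero =>
    intro x h
    have hne : node x ≠ root := by intro h'; rw [h'] at h; simp [run] at h
    obtain ⟨a, ha⟩ := exists_lt_of_ne_root hne ε
    obtain ⟨d, hd⟩ := exists_isGeodesicWord (x * wordVal [bar a])
    exact ⟨d, a, key x a d ha hd, ha⟩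
  | succ k ih =>
    intro x h
    cases hx : node x with
    | root => rw [hx] at h; simp [run] at h
    | two v a w b => rw [hx] at h; simp [run] at h
    | one v a =>
      have ha : lt ε (node x) = some a := by rw [hx]; rfl
      have hy := node_mul_bar ha
      rw [hx] at h hy
      rw [run] at h
      split_ifs at h with hc
      · change node _ = v at hy
        obtain ⟨c, s, h1, h2⟩ := ih (x * wordVal [bar a]) (by rw [hy]; omega)
        rw [hy] at h2
        obtain ⟨a', h3, rfl⟩ := cont_iff.1 hc
        rw [h2] at h3
        obtain rfl := Option.some_injective _ h3
        rw [← Function.iterate_succ_apply' (nx ε)] at ha h1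
        refine ⟨c, s, ?_, by rw [lt, ← Function.iterate_succ_apply' (nx ε)]⟩
        have := key x _ _ ha h1
        rw [List.append_assoc] at this
        rwa [List.iterate_add]
      · omega

/-- Cannon's type of a group element in terms of the tiling. -/
theorem cannonType_eq (x : SurfaceGroup g) : cannonType x = ctype (node x) := by
  have hg2 := hg.out
  apply le_antisymm
  · apply csSup_le
    · obtain ⟨c, hc⟩ := exists_isGeodesicWord x
      exact ⟨0, c, relatorWord g, [], hc, Or.inl (List.IsRotated.refl _), List.nil_suffix,
        List.nil_suffix, rfl⟩
    · rintro n ⟨c, r, u, hc, hr, ⟨d, rfl⟩, hur, rfl⟩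
      obtain ⟨ε, s, rfl⟩ := (isFundamentalRelator_iff (by omega)).1 hr
      cases hk : u.length with
      | zero => exact Nat.zero_le _
      | succ k =>
        have hle : k + 1 ≤ 4 * g := by simpa [hk] using hur.length_le
        have hu : u = List.iterate (nx ε) ((nx ε)^[4 * g - (k + 1)] s) (k + 1) := by
          have e : List.iterate (nx ε) s (4 * g) = List.iterate (nx ε) s (4 * g - (k + 1)) ++
              List.iterate (nx ε) ((nx ε)^[4 * g - (k + 1)] s) (k + 1) := by
            rw [← List.iterate_add]
            congr 1; omega
          rw [e] at hur
          exact (List.suffix_of_suffix_length_le hur (List.suffix_append _ _)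
            (by simp [hk])).eq_of_length (by simp [hk])
        rw [hu] at hc
        rcases run_of_isGeodesicWord ε _ k x d hc with ⟨-, h⟩ | ⟨-, -, h1, h2⟩
        · exact h.trans (run_le_ctype (level_node x) ε)
        · omega
  · have hbdd : ∀ {c : List (SurfaceLetter g)} {ε s k}, k ≤ 4 * g →
        IsGeodesicWord (c ++ List.iterate (nx ε) s k) x → k ≤ cannonType x := by
      intro c ε s k hk hc
      apply le_csSup
      · refine ⟨4 * g, ?_⟩
        rintro n ⟨c, r, u, -, hr, -, hu, rfl⟩
        obtain ⟨ε, s, rfl⟩ := (isFundamentalRelator_iff (by omega)).1 hr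
        simpa using hu.length_le
      · refine ⟨_, _, _, hc, (isFundamentalRelator_iff (by omega)).2 ⟨ε, (nx ε)^[k] s, rfl⟩,
          List.suffix_append _ _, ?_, by simp⟩
        have e := List.iterate_add (nx ε) ((nx ε)^[k] s) (4 * g - k) k
        rw [← Function.iterate_add_apply, Nat.sub_add_cancel hk, nx_iterate_period] at e
        rw [e]
        exact List.suffix_append _ _
    have hrun : ∀ ε, run ε (node x) ≤ cannonType x := by
      intro ε
      cases h : run ε (node x) with
      | zero => exact Nat.zero_le _
      | succ k =>
        obtain ⟨c, s, hc, -⟩ := exists_isGeodesicWord_run ε k x h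
        have := (level_node x).good.run_lt ε
        exact hbdd (by omega) hc
    cases hx : node x with
    | root => exact Nat.zero_le _
    | one v s => rw [ctype, ← hx]; exact max_le (hrun _) (hrun _)
    | two v s w t =>
      have hl := level_node x
      rw [hx] at hl
      obtain ⟨ε, u, a, k, hu, hua, hf, hp, -⟩ := hl.two_inv
      rw [← hx] at hp
      obtain ⟨δ, h1, h2⟩ := exists_lt_push hu a
      rw [← hp] at h1 h2
      have hy := node_mul_bar h1
      rw [h2] at hy
      obtain ⟨j, hj⟩ : ∃ j, 2 * g = j + 1 + 1 := ⟨2 * g - 2, by omega⟩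
      obtain ⟨c, s', hc, h3⟩ := exists_isGeodesicWord_run ε j (x * wordVal [bar a])
        (by rw [hy]; have := hf.2; omega)
      rw [hy] at h3
      obtain ⟨a', h4, rfl⟩ := cont_iff.1 hf.1
      rw [h3] at h4
      obtain rfl := Option.some_injective _ h4
      have h5 := isGeodesicWord_append_singleton.2 ⟨⟨δ, by rwa [bar_bar]⟩, hc⟩
      rw [← Function.iterate_succ_apply' (nx ε), List.append_assoc] at h5
      rw [ctype]
      refine hbdd (c := c) (ε := ε) (s := s') (by omega) ?_
      rw [hj, List.iterate_add]
      exact h5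

/-! ### Polygons and modified types -/

/-- The first letters of the two sides of the polygon on the left of the edge `s`. -/
def sideStart (ε : Bool) (s : SurfaceLetter g) : SurfaceLetter g := cond ε s (rot false s)

omit hg in
theorem rot_not_sideStart (ε : Bool) (s : SurfaceLetter g) :
    rot (!ε) (sideStart ε s) = sideStart (!ε) s := by
  cases ε
  · exact rot_rot_not true s
  · rfl

/-- The vertices of the polygon with bottom `b` on the left of the edge `s` from `b`. -/
def polygonAt (b : SurfaceGroup g) (s : SurfaceLetter g) : Set (SurfaceGroup g) :=
  {v | ∃ ε i, i ≤ 2 * g ∧ v = b * sideVal ε (sideStart ε s) i}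

omit hg in
theorem sideVal_add_period (ε : Bool) (s : SurfaceLetter g) (i k : ℕ) :
    sideVal ε s (4 * g * k + i) = sideVal ε s i := by
  induction k with
  | zero => simp
  | succ k ih =>
    rw [show 4 * g * (k + 1) + i = 4 * g + (4 * g * k + i) by ring, sideVal_add, sideVal_period,
      one_mul, nx_iterate_period, ih]

omit hg in
theorem polygonAt_eq (hg : 0 < g) (b : SurfaceGroup g) (s : SurfaceLetter g) :
    polygonAt b s = Set.range fun i => b * sideVal true s i := by
  ext v
  constructor
  · rintro ⟨ε, i, hi, rfl⟩
    cases ε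
    · refine ⟨4 * g - i, ?_⟩
      have := sideVal_descend (sideVal_period true s) i (by omega)
      exact congrArg (b * ·) this
    · exact ⟨i, rfl⟩
  · rintro ⟨i, rfl⟩
    have h1 : sideVal true s i = sideVal true s (i % (4 * g)) := by
      conv_lhs => rw [← Nat.div_add_mod i (4 * g), sideVal_add_period]
    have h2 : i % (4 * g) < 4 * g := Nat.mod_lt _ (by omega)
    by_cases h3 : i % (4 * g) ≤ 2 * g
    · exact ⟨true, _, h3, by simp only [h1]; rfl⟩
    · refine ⟨false, 4 * g - i % (4 * g), by omega, ?_⟩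
      have := sideVal_descend (sideVal_period true s) (4 * g - i % (4 * g)) (by omega)
      rw [show 4 * g - (4 * g - i % (4 * g)) = i % (4 * g) by omega] at this
      simp only [h1, this]
      rfl

omit hg in
theorem range_sideVal_shift (hg : 0 < g) (b : SurfaceGroup g) (s : SurfaceLetter g) (j : ℕ) :
    (Set.range fun i => b * sideVal true s j * sideVal true ((nx true)^[j] s) i) =
      Set.range fun i => b * sideVal true s i := by
  ext v
  constructor
  · rintro ⟨i, rfl⟩
    exact ⟨j + i, by simp only [sideVal_add, mul_assoc]⟩
  · rintro ⟨i, rfl⟩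
    refine ⟨4 * g * j - j + i, ?_⟩
    have : j ≤ 4 * g * j := Nat.le_mul_of_pos_left j (by omega)
    change b * sideVal true s j * sideVal true _ _ = b * sideVal true s i
    rw [mul_assoc b, ← sideVal_add, show j + (4 * g * j - j + i) = 4 * g * j + i by omega, sideVal_add_period]

omit hg in
theorem setOf_prefix_relatorWord (hg : 0 < g) (p : SurfaceGroup g) :
    {v | ∃ u, u <+: relatorWord g ∧ v = p * wordVal u} =
      Set.range fun i => p * sideVal true (Sum.inl ⟨0, hg⟩, true) i := by
  ext v
  rw [relatorWord_eq_iterate hg]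
  constructor
  · rintro ⟨u, hu, rfl⟩
    refine ⟨u.length, ?_⟩
    rw [List.prefix_iff_eq_take, List.take_iterate] at hu
    have hl := congrArg List.length hu
    rw [List.length_iterate] at hl
    rw [← hl] at hu
    simp only [sideVal]
    rw [← hu]
  · rintro ⟨i, rfl⟩
    refine ⟨List.iterate (nx true) (Sum.inl ⟨0, hg⟩, true) (i % (4 * g)), ?_, ?_⟩
    · rw [List.prefix_iff_eq_take, List.take_iterate, List.length_iterate,
        min_eq_left (Nat.mod_lt _ (by omega)).le]
    · conv_lhs => rw [← Nat.div_add_mod i (4 * g)]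
      simp only [sideVal_add_period]
      rfl

/-- Every polygon of the Cayley graph has a bottom. -/
theorem exists_eq_polygonAt {P : Set (SurfaceGroup g)} (hP : IsPolygon P) :
    ∃ b s, P = polygonAt b s ∧ ∀ ε, ¬ IsBack (node b) (sideStart ε s) := by
  have hg2 := hg.out
  obtain ⟨p, rfl⟩ := hP
  rw [setOf_prefix_relatorWord (by omega)]
  set s₀ : SurfaceLetter g := (Sum.inl ⟨0, by omega⟩, true)
  obtain ⟨j, hj⟩ : ∃ j, ∀ i, depth (node (p * sideVal true s₀ j)) ≤
      depth (node (p * sideVal true s₀ i)) := by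
    have hne : (Set.range fun i => depth (node (p * sideVal true s₀ i))).Nonempty :=
      Set.range_nonempty _
    obtain ⟨j, hj⟩ := Nat.sInf_mem hne
    exact ⟨j, fun i => hj.le.trans (Nat.sInf_le ⟨i, rfl⟩)⟩
  refine ⟨p * sideVal true s₀ j, (nx true)^[j] s₀, ?_, ?_⟩
  · rw [polygonAt_eq (by omega), range_sideVal_shift (by omega)]
  · rintro (_ | _) hb
    · have h1 := depth_node_mul_back hb
      have h2 : sideStart false ((nx true)^[j] s₀) =
          bar ((nx true)^[4 * g - 1] ((nx true)^[j] s₀)) :=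
        nx_not_iterate_rot true _ (i := 0) (by omega)
      have h3 : wordVal [sideStart false ((nx true)^[j] s₀)] =
          sideVal true ((nx true)^[j] s₀) (4 * g - 1) := by
        have h4 := sideVal_period true ((nx true)^[j] s₀)
        rw [show 4 * g = 4 * g - 1 + 1 by omega, sideVal_succ] at h4
        rw [h2, wordVal_bar]
        exact (eq_inv_of_mul_eq_one_left h4).symm
      rw [h3, mul_assoc, ← sideVal_add] at h1
      have := hj (j + (4 * g - 1))
      omega
    · have h1 := depth_node_mul_back hb
      have h3 : wordVal [sideStart true ((nx true)^[j] s₀)] =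
          sideVal true ((nx true)^[j] s₀) 1 := rfl
      rw [h3, mul_assoc, ← sideVal_add] at h1
      have := hj (j + 1)
      omega

theorem isPolygon_polygonAt (b : SurfaceGroup g) (s : SurfaceLetter g) :
    IsPolygon (polygonAt b s) := by
  have hg2 := hg.out
  obtain ⟨j, rfl⟩ := exists_nx_iterate ((Sum.inl ⟨0, by omega⟩ : Fin g ⊕ Fin g), true) s
  refine ⟨b * (sideVal true (Sum.inl ⟨0, by omega⟩, true) j)⁻¹, ?_⟩
  rw [setOf_prefix_relatorWord (by omega), polygonAt_eq (by omega),
    ← range_sideVal_shift (by omega) (b * _) _ j, inv_mul_cancel_right]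

section bottom

variable {b : SurfaceGroup g} {s : SurfaceLetter g}
  (hs : ∀ ε, ¬ IsBack (node b) (sideStart ε s))

include hs

theorem node_side (ε : Bool) {i : ℕ} (hi : i + 2 ≤ 2 * g) :
    node (b * sideVal ε (sideStart ε s) (i + 1)) =
      arc ε (push (node b) (sideStart ε s)) (sideStart ε s) i := by
  rw [node, vertex_mul_sideVal]
  exact travel_bottom (hs ε) (by rw [rot_not_sideStart]; exact hs _) i hi

theorem depth_side (ε : Bool) {i : ℕ} (hi : i ≤ 2 * g) :
    depth (node (b * sideVal ε (sideStart ε s) i)) = depth (node b) + i := by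
  have hg2 := hg.out
  have hr : ¬ IsBack (node b) (rot (!ε) (sideStart ε s)) := by
    rw [rot_not_sideStart]; exact hs _
  have key : ∀ i, i + 2 ≤ 2 * g →
      depth (arc ε (push (node b) (sideStart ε s)) (sideStart ε s) i) =
        depth (node b) + 1 + i := fun i hi =>
    (level_arc_of_bottom (b := vertex b) (hs ε) hr hi).1.good.depth_eq
  obtain _ | i := i
  · rw [sideVal_zero, mul_one]; rfl
  by_cases h2 : i + 2 ≤ 2 * g
  · rw [node_side hs ε h2, key i h2]
    ring
  · have hi' : i + 1 = 2 * g := by omega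
    have h3 := travel_top (b := vertex b) (hs ε) hr
    rw [← vertex_mul_sideVal] at h3
    rw [hi', node, h3]
    have h4 := key (2 * g - 2) (by omega)
    have hr' : ¬ IsBack (node b) (rot (!!ε) (sideStart (!ε) s)) := by
      rw [rot_not_sideStart]; exact hs _
    have h5 := (level_arc_of_bottom (b := vertex b) (hs (!ε)) hr'
      (i := 2 * g - 2) (by omega)).1.good.depth_eq
    rw [rot_not_sideStart]
    cases ε
    · refine (congrArg (· + 1) h4).trans ?_
      omega
    · refine (congrArg (· + 1) h5).trans ?_
      change depth (node b) + 1 + _ + 1 = _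
      omega

omit hs in
theorem sideStart_val_ne : b * wordVal [sideStart true s] ≠ b * wordVal [sideStart false s] := by
  intro h
  have h1 := wordVal_singleton_injective (mul_left_cancel h)
  exact rot_ne false _ ((rot_not_sideStart true s).trans h1.symm)

/-- The two sides of a polygon are disjoint, apart from the bottom and the top. -/
theorem side_ne (ε : Bool) {i : ℕ} (h0 : 0 < i) (hi : i < 2 * g) :
    b * sideVal ε (sideStart ε s) i ≠ b * sideVal (!ε) (sideStart (!ε) s) i := by
  obtain ⟨i, rfl⟩ : ∃ k, i = k + 1 := ⟨i - 1, by omega⟩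
  intro h
  have hr : ∀ ε, ¬ IsBack (node b) (rot (!ε) (sideStart ε s)) := fun ε => by
    rw [rot_not_sideStart]; exact hs _
  have h1 : ∀ k, arc ε (push (node b) (sideStart ε s)) (sideStart ε s) k =
      arc (!ε) (push (node b) (sideStart (!ε) s)) (sideStart (!ε) s) k →
      push (node b) (sideStart ε s) = push (node b) (sideStart (!ε) s) := by
    intro k
    induction k with
    | zero => exact id
    | succ k ih =>
      intro h
      injection h with h2 _
      exact ih h2
  have h2 := congrArg node h
  rw [node_side hs _ (by omega), node_side hs _ (by omega)] at h2
  have h3 := h1 _ h2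
  rw [← node_mul_push (hs _), ← node_mul_push (hs _)] at h3
  have h4 := node_injective h3
  cases ε
  · exact sideStart_val_ne h4.symm
  · exact sideStart_val_ne h4

/-- Above the bottom, a vertex of a polygon has at most one successor on the polygon. -/
theorem successor_on_polygon (ε : Bool) {i : ℕ} (h0 : 0 < i) (hi : i ≤ 2 * g)
    {x : SurfaceGroup g}
    (hx : x ∈ successors (surfaceGens g) (b * sideVal ε (sideStart ε s) i))
    (hxP : x ∈ polygonAt b s) :
    x = b * sideVal ε (sideStart ε s) i * wordVal [(nx ε)^[i] (sideStart ε s)] := by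
  obtain ⟨δ, j, hj, rfl⟩ := hxP
  have hd := hx.2
  rw [wordLength_eq_depth, wordLength_eq_depth, depth_side hs _ hi, depth_side hs _ hj] at hd
  obtain rfl : j = i + 1 := by omega
  rcases Bool.eq_or_eq_not δ ε with rfl | rfl
  · rw [sideVal_succ, mul_assoc]
  · by_cases ht : i + 1 = 2 * g
    · have h1 := sideVal_half ε (sideStart ε s)
      rw [rot_not_sideStart] at h1
      rw [ht, ← h1, ← ht, sideVal_succ, mul_assoc]
    · exfalso
      obtain ⟨a, ha, hxa⟩ := mem_successors_iff.1 hx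
      obtain ⟨η, h1, h2⟩ := exists_lt_push (level_node _) a
      rw [← node_mul_push ha, ← hxa, node_side hs (!ε) (by omega)] at h2
      obtain ⟨i, rfl⟩ : ∃ k, i = k + 1 := ⟨i - 1, by omega⟩
      rw [arc] at h2
      change arc _ _ _ _ = _ at h2
      rw [← node_side hs (!ε) (by omega)] at h2
      exact side_ne hs ε (Nat.succ_pos _) (by omega) (node_injective h2).symm

/-- A vertex with two successors on a polygon is its bottom. -/
theorem eq_bottom_of_successors {y x z : SurfaceGroup g} (hy : y ∈ polygonAt b s)
    (hxP : x ∈ polygonAt b s) (hzP : z ∈ polygonAt b s)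
    (hx : x ∈ successors (surfaceGens g) y) (hz : z ∈ successors (surfaceGens g) y)
    (hne : x ≠ z) :
    y = b ∧ ∃ ε, x = b * wordVal [sideStart ε s] ∧ z = b * wordVal [sideStart (!ε) s] := by
  obtain ⟨ε, i, hi, rfl⟩ := hy
  obtain _ | i := i
  · rw [sideVal_zero, mul_one] at hx hz ⊢
    refine ⟨rfl, ?_⟩
    have key : ∀ x ∈ polygonAt b s, x ∈ successors (surfaceGens g) b →
        ∃ ε, x = b * wordVal [sideStart ε s] := by
      rintro x ⟨δ, j, hj, rfl⟩ hx
      have hd := hx.2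
      rw [wordLength_eq_depth, wordLength_eq_depth, depth_side hs _ hj] at hd
      obtain rfl : j = 1 := by omega
      exact ⟨δ, rfl⟩
    obtain ⟨δ, rfl⟩ := key x hxP hx
    obtain ⟨η, rfl⟩ := key z hzP hz
    rcases Bool.eq_or_eq_not η δ with rfl | rfl
    · exact absurd rfl hne
    · exact ⟨δ, rfl, rfl⟩
  · exact absurd ((successor_on_polygon hs ε i.succ_pos hi hx hxP).trans
      (successor_on_polygon hs ε i.succ_pos hi hz hzP).symm) hne

end bottom

namespace Node

/-- The vertex has modified type `1'`, and the polygon responsible for it is on side `ε`. -/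
def IsOne (ε : Bool) : Node g → Prop
  | one y s => run ε y + 1 = 2 * g ∧ (lt ε y).map (fun a => rot ε (nx ε a)) = some s
  | _ => False

/-- The vertex has modified type `2'`, and the polygon responsible for it is on side `ε`. -/
def IsTwo (ε : Bool) : Node g → Prop
  | one x s => IsOne ε x ∧ Cont ε x s
  | _ => False

open Classical in
/-- The modified type, read off from the combinatorial vertex. -/
noncomputable def mtype (v : Node g) : TypeSymbol :=
  if ∃ ε, IsOne ε v then .onePrime
  else if ∃ ε, IsTwo ε v then .twoPrime
  else .cannon (ctype v)

omit hg in
theorem isOne_one_iff {ε : Bool} {y : Node g} {s : SurfaceLetter g} :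
    IsOne ε (one y s) ↔ run ε y + 1 = 2 * g ∧ ∃ a, lt ε y = some a ∧ s = rot ε (nx ε a) := by
  simp [IsOne, eq_comm]

omit hg in
theorem exists_eq_one_of_run {m : ℕ} {v : Node g} {ε : Bool} (h : run ε v = m + 2) :
    ∃ u a, v = one u a := by
  cases v with
  | root => simp [run] at h
  | one u a => exact ⟨u, a, rfl⟩
  | two u a w c => simp [run] at h

omit hg in
theorem Good.run_not {m : ℕ} {v : Node g} (hv : Good m v) {ε : Bool} (h : 2 ≤ run ε v) :
    run (!ε) v = 1 := by
  obtain ⟨δ, hδ⟩ := hv.run_le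
  rcases Bool.eq_or_eq_not δ ε with rfl | rfl
  · omega
  · have hne : v ≠ root := by rintro rfl; simp [run] at h
    have := run_pos (ε := !ε) hne
    omega

/-- A vertex of modified type `1'` starts a new stretch on both sides. -/
theorem run_of_isOne {m : ℕ} {y : Node g} {s : SurfaceLetter g} (h : Level m y) {ε : Bool}
    (h1 : IsOne ε (one y s)) :
    (∃ u a, y = one u a) ∧ (∀ δ, ¬ Cont δ y s) ∧ ∀ δ, run δ (one y s) = 1 := by
  have hg2 := hg.out
  obtain ⟨hr, a, ha, rfl⟩ := isOne_one_iff.1 h1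
  obtain ⟨u, c, rfl⟩ := exists_eq_one_of_run (m := 2 * g - 3) (v := y) (ε := ε) (by omega)
  obtain rfl := Option.some_injective _ ha
  have hc : ∀ δ, ¬ Cont δ (one u c) (rot ε (nx ε c)) := by
    intro δ hδ
    obtain ⟨c', h2, h3⟩ := cont_iff.1 hδ
    obtain rfl := Option.some_injective _ h2
    rcases Bool.eq_or_eq_not δ ε with rfl | rfl
    · exact rot_ne _ _ h3
    · rw [nx, nx, eq_comm, rot_eq_iff, Bool.not_not] at h3
      exact rot_rot_rot_ne _ _ h3.symm
  exact ⟨⟨u, c, rfl⟩, hc, fun δ => by rw [run, if_neg (hc δ)]⟩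

end Node

/-- The polygon that makes a point of modified type `1'` has the predecessor of this point as its
bottom, because two successors of the predecessor lie on it. -/
theorem isOne_of_isOnePrimeOn {P : Set (SurfaceGroup g)} {x : SurfaceGroup g}
    (h : IsOnePrimeOn P x) : ∃ b s ε, P = polygonAt b s ∧
      (∀ ε, ¬ IsBack (node b) (sideStart ε s)) ∧ x = b * wordVal [sideStart ε s] ∧
      node x = one (node b) (sideStart ε s) ∧ IsOne ε (node x) := by
  have hg2 := hg.out
  obtain ⟨hP, y, z, hy, hz, hzt, hx, hxt, hyP, hzP, hxP⟩ := h
  obtain ⟨b, s, rfl, hs⟩ := exists_eq_polygonAt hP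
  have hne : x ≠ z := by
    rintro rfl
    omega
  obtain ⟨rfl, ε, rfl, rfl⟩ := eq_bottom_of_successors hs hyP hxP hzP hx hz hne
  refine ⟨y, s, ε, rfl, hs, rfl, ?_⟩
  rw [cannonType_eq, node_mul_push (hs _)] at hzt hxt
  have hl := level_node y
  have h1 : push (node y) (sideStart ε s) = one (node y) (sideStart ε s) := by
    rcases push_cases hl (sideStart ε s) with ⟨δ, w, t, hf, hpu, -⟩ | ⟨-, hpu⟩
    · rw [hpu, ctype_mkTwo] at hxt
      omega
    · exact hpu
  have h2 : Full ε (node y) (sideStart (!ε) s) := by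
    rcases push_cases hl (sideStart (!ε) s) with ⟨δ, w, t, hf, hpu, -⟩ | ⟨hf, hpu⟩
    · rcases Bool.eq_or_eq_not δ ε with rfl | rfl
      · exact hf
      · refine absurd hf.1 (not_cont_of_not_isBack ?_)
        rw [rot_not_sideStart]
        exact hs _
    · rw [hpu] at hzt
      have hl2 := Level.step hl (hs (!ε))
      rw [hpu] at hl2
      have h3 := hl2.good.run_lt true
      have h4 := hl2.good.run_lt false
      rw [ctype] at hzt
      omega
  rw [node_mul_push (hs _), h1]
  refine ⟨rfl, isOne_one_iff.2 ⟨h2.2, ?_⟩⟩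
  obtain ⟨a, ha, h3⟩ := cont_iff.1 h2.1
  refine ⟨a, ha, ?_⟩
  rw [← h3]
  have := rot_not_sideStart (!ε) s
  rw [Bool.not_not] at this
  exact this.symm

theorem isOnePrimeOn_of_isOne {x : SurfaceGroup g} {ε : Bool} (h : IsOne ε (node x)) :
    ∃ P, IsOnePrimeOn P x ∧ ∀ s, Node.Cont ε (node x) s → x * wordVal [s] ∈ P := by
  have hg2 := hg.out
  cases hx : node x with
  | root => rw [hx] at h; exact h.elim
  | two v s w t => rw [hx] at h; exact h.elim
  | one v s =>
  rw [hx] at h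
  have hxs : lt true (node x) = some s := by rw [hx]; rfl
  obtain ⟨m, -, hl, hb, hp⟩ := (level_node x).good.par_level true s hxs
  have hy := node_mul_bar hxs
  rw [hx] at hl hb hp hy
  change node _ = v at hy
  change Level m v at hl
  obtain ⟨⟨u, c, hv⟩, hnc, hr1⟩ := run_of_isOne hl h
  obtain ⟨hr, a, ha, hsa⟩ := isOne_one_iff.1 h
  obtain ⟨y, hyx⟩ : ∃ y, y = x * wordVal [bar s] := ⟨_, rfl⟩
  have hxy : x = y * wordVal [s] := by rw [hyx, wordVal_bar, inv_mul_cancel_right]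
  rw [← hyx] at hy
  have hfull : Full ε (node y) (nx ε a) := by
    rw [hy]
    exact ⟨cont_iff.2 ⟨a, ha, rfl⟩, hr⟩
  have hlb : ¬ IsBack (node y) (nx ε a) := (level_node y).good.not_isBack hfull.1
  have hsb : ¬ IsBack (node y) s := by rw [hy]; exact hb
  obtain ⟨s₀, h0, h1⟩ : ∃ s₀, sideStart ε s₀ = s ∧ sideStart (!ε) s₀ = nx ε a := by
    have h0 : ∃ s₀, sideStart ε s₀ = s := by
      cases ε
      · exact ⟨rot true s, rot_not_rot true s⟩
      · exact ⟨s, rfl⟩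
    obtain ⟨s₀, h0⟩ := h0
    refine ⟨s₀, h0, ?_⟩
    rw [← rot_not_sideStart, h0, hsa, rot_not_rot]
  have hs : ∀ δ, ¬ IsBack (node y) (sideStart δ s₀) := by
    intro δ
    rcases Bool.eq_or_eq_not δ ε with rfl | rfl
    · rwa [h0]
    · rwa [h1]
  have hmem : ∀ δ i, i ≤ 2 * g → y * sideVal δ (sideStart δ s₀) i ∈ polygonAt y s₀ :=
    fun δ i hi => ⟨δ, i, hi, rfl⟩
  refine ⟨polygonAt y s₀, ⟨isPolygon_polygonAt y s₀, y, y * wordVal [nx ε a], ?_, ?_, ?_, ?_, ?_,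
    ?_, ?_, ?_⟩, ?_⟩
  · have hly := level_node y
    rw [cannonType_eq, hy, hv, ctype, ← hv]
    rw [hy] at hly
    have h2 := hly.good.run_not (ε := ε) (by omega)
    cases ε
    · rw [Bool.not_false] at h2
      rw [h2]; omega
    · rw [Bool.not_true] at h2
      rw [h2]; omega
  · exact mem_successors_iff.2 ⟨_, hlb, rfl⟩
  · rw [cannonType_eq, node_mul_push hlb,
      push_of_full hfull ((level_node y).good.not_full_not hfull.1), ctype_mkTwo]
  · exact mem_successors_iff.2 ⟨_, hsb, hxy⟩
  · rw [cannonType_eq, hx, ctype, hr1, hr1, max_self]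
  · simpa [sideVal_zero] using hmem true 0 (by omega)
  · have := hmem (!ε) 1 (by omega)
    rwa [h1] at this
  · have := hmem ε 1 (by omega)
    rw [h0] at this
    rwa [hxy]
  · intro t ht
    obtain ⟨c', hc', rfl⟩ := cont_iff.1 ht
    obtain rfl := Option.some_injective _ hc'
    have := hmem ε 2 (by omega)
    rw [h0, sideVal_succ, ← mul_assoc] at this
    rw [hxy]
    exact this

/-- The modified type of a group element in terms of the tiling. -/
theorem modifiedType_eq (x : SurfaceGroup g) : modifiedType x = mtype (node x) := by
  have hg2 := hg.out
  have e1 : (∃ P, IsOnePrimeOn P x) ↔ ∃ ε, IsOne ε (node x) := by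
    constructor
    · rintro ⟨P, h⟩
      obtain ⟨-, -, ε, -, -, -, -, h⟩ := isOne_of_isOnePrimeOn h
      exact ⟨ε, h⟩
    · rintro ⟨ε, h⟩
      obtain ⟨P, h, -⟩ := isOnePrimeOn_of_isOne h
      exact ⟨P, h⟩
  have e2 : IsTwoPrime x ↔ ∃ ε, IsTwo ε (node x) := by
    constructor
    · rintro ⟨P, x₁, h, hx, hxt, hxP⟩
      obtain ⟨b, s, ε, rfl, hs, rfl, h1, h2⟩ := isOne_of_isOnePrimeOn h
      refine ⟨ε, ?_⟩
      have h3 := successor_on_polygon hs ε (i := 1) Nat.one_pos (by omega) hx hxP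
      have hc : Node.Cont ε (node (b * wordVal [sideStart ε s])) (nx ε (sideStart ε s)) :=
        cont_iff.2 ⟨sideStart ε s, by rw [h1]; rfl, rfl⟩
      have hnb := (level_node _).good.not_isBack hc
      have h4 : node x = push (node (b * wordVal [sideStart ε s])) (nx ε (sideStart ε s)) := by
        rw [← node_mul_push hnb, h3]
        rfl
      rcases push_cases (level_node _) (nx ε (sideStart ε s)) with
        ⟨δ, w, t, hf, hpu, -⟩ | ⟨hf, hpu⟩
      · rw [cannonType_eq, h4, hpu, ctype_mkTwo] at hxt
        omega
      · rw [h4, hpu]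
        exact ⟨h2, hc⟩
    · rintro ⟨ε, h⟩
      cases hx : node x with
      | root => rw [hx] at h; exact h.elim
      | two v s w t => rw [hx] at h; exact h.elim
      | one v s =>
      rw [hx] at h
      obtain ⟨h1, hc⟩ := h
      have hxs : lt true (node x) = some s := by rw [hx]; rfl
      obtain ⟨m, -, hl, hb, hp⟩ := (level_node x).good.par_level true s hxs
      have hy := node_mul_bar hxs
      rw [hx] at hl hb hp hy
      change node _ = v at hy
      change Level m v at hl
      change ¬ IsBack v s at hb
      obtain ⟨y, hyx⟩ : ∃ y, y = x * wordVal [bar s] := ⟨_, rfl⟩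
      have hxy : x = y * wordVal [s] := by rw [hyx, wordVal_bar, inv_mul_cancel_right]
      rw [← hyx] at hy
      subst hy
      obtain ⟨P, hP, hPc⟩ := isOnePrimeOn_of_isOne h1
      refine ⟨P, y, hP, mem_successors_iff.2 ⟨s, hb, hxy⟩, ?_, hxy ▸ hPc s hc⟩
      have hr : ∀ δ, run δ (node y) = 1 := by
        cases hy : node y with
        | root => rw [hy] at h1; exact h1.elim
        | two v s w t => rw [hy] at h1; exact h1.elim
        | one v a =>
          rw [hy] at h1 hl
          obtain ⟨k, -, hl', -⟩ := hl.good.par_level true a rfl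
          exact (run_of_isOne (y := v) hl' h1).2.2
      have hc' := (level_node y).good.not_cont_not hc
      rw [cannonType_eq, hx, ctype, run, run, hr, hr]
      cases ε
      · rw [if_pos hc, if_neg (show ¬ Node.Cont true _ _ from hc')]; rfl
      · rw [if_pos hc, if_neg (show ¬ Node.Cont false _ _ from hc')]; rfl
  rw [modifiedType, mtype, cannonType_eq]
  by_cases h1 : ∃ P, IsOnePrimeOn P x
  · rw [if_pos h1, if_pos (e1.1 h1)]
  · rw [if_neg h1, if_neg (mt e1.2 h1)]
    by_cases h2 : IsTwoPrime x
    · rw [if_pos h2, if_pos (e2.1 h2)]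
    · rw [if_neg h2, if_neg (mt e2.2 h2)]

end

end SurfaceTiling

namespace SurfaceTiling

variable {g : ℕ}

open Node Vertex

/-! ### Modified types of successors -/

namespace Node

open Classical in
/-- The modified type of the end point of the edge `s` from `v`, or `none` if this edge goes
down. -/
noncomputable def look (v : Node g) (s : SurfaceLetter g) : Option TypeSymbol :=
  if IsBack v s then none else some (mtype (push v s))

/-- The Cannon type underlying a modified type. -/
def rank : TypeSymbol → ℕ
  | .cannon i => i
  | .onePrime => 1
  | .twoPrime => 2
  | .star => 0

open Classical in
/-- The modified type of the successor in the `j`-th direction, in terms of the modified type `τ`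
of the point. Directions are counted from an incoming edge, towards the polygon along which the
point has its type. -/
noncomputable def successorType (g : ℕ) (τ : TypeSymbol) (j : ℕ) : Option TypeSymbol :=
  if τ = .cannon (2 * g) then
    if j = 0 ∨ j + 1 = 4 * g then none
    else if j = 1 ∨ j + 2 = 4 * g then some (.cannon 2)
    else some (.cannon 1)
  else if j = 0 then none
  else if j = 1 then
    some (if τ = .onePrime then .twoPrime else .cannon (rank τ + 1))
  else if j + 1 = 4 * g then some (.cannon 2)
  else if j = 2 ∧ rank τ + 1 = 2 * g then some .onePrime
  else some (.cannon 1)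

theorem not_isOne_mkTwo {δ ε : Bool} {v w : Node g} {s t : SurfaceLetter g} :
    ¬ IsOne δ (mkTwo ε v s w t) := by
  cases ε <;> exact id

theorem not_isTwo_mkTwo {δ ε : Bool} {v w : Node g} {s t : SurfaceLetter g} :
    ¬ IsTwo δ (mkTwo ε v s w t) := by
  cases ε <;> exact id

theorem mtype_mkTwo (ε : Bool) (v w : Node g) (s t : SurfaceLetter g) :
    mtype (mkTwo ε v s w t) = .cannon (2 * g) := by
  rw [mtype, if_neg fun ⟨_, h⟩ => not_isOne_mkTwo h, if_neg fun ⟨_, h⟩ => not_isTwo_mkTwo h,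
    ctype_mkTwo]

theorem mtype_root : mtype (root : Node g) = .cannon 0 := by
  rw [mtype, if_neg fun ⟨_, h⟩ => h, if_neg fun ⟨_, h⟩ => h, ctype]

theorem mtype_cannon {v : Node g} (h1 : ∀ ε, ¬ IsOne ε v) (h2 : ∀ ε, ¬ IsTwo ε v) :
    mtype v = .cannon (ctype v) := by
  rw [mtype, if_neg fun ⟨_, h⟩ => h1 _ h, if_neg fun ⟨_, h⟩ => h2 _ h]

variable [hg : Fact (2 ≤ g)]

theorem IsOne.run_eq {m : ℕ} {v : Node g} {ε : Bool} (hv : Level m v) (h : IsOne ε v) (δ : Bool) :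
    run δ v = 1 := by
  cases v with
  | root => exact h.elim
  | two _ _ _ _ => exact h.elim
  | one y s =>
    obtain ⟨k, -, hy, -⟩ := hv.good.par_level true s rfl
    exact (run_of_isOne (y := y) hy h).2.2 δ

theorem IsOne.side_unique {m : ℕ} {v : Node g} {ε δ : Bool} (hv : Level m v) (h : IsOne ε v)
    (h' : IsOne δ v) : δ = ε := by
  have hg2 := hg.out
  rcases Bool.eq_or_eq_not δ ε with rfl | rfl
  · rfl
  cases v with
  | root => exact h.elim
  | two _ _ _ _ => exact h.elim
  | one y s =>
    obtain ⟨k, -, hy, -⟩ := hv.good.par_level true s rfl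
    change Level k y at hy
    have h1 := (isOne_one_iff.1 h).1
    have h2 := (isOne_one_iff.1 h').1
    have := hy.good.run_not (ε := ε) (by omega)
    omega

theorem IsTwo.run_eq {m : ℕ} {v : Node g} {ε : Bool} (hv : Level m v) (h : IsTwo ε v) :
    run ε v = 2 := by
  cases v with
  | root => exact h.elim
  | two _ _ _ _ => exact h.elim
  | one y s =>
    obtain ⟨k, -, hy, -⟩ := hv.good.par_level true s rfl
    change Level k y at hy
    rw [run, if_pos h.2, h.1.run_eq hy]

theorem IsTwo.not_isOne {m : ℕ} {v : Node g} {ε δ : Bool} (hv : Level m v) (h : IsTwo ε v) :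
    ¬ IsOne δ v := by
  intro h'
  have := h.run_eq hv
  rw [h'.run_eq hv] at this
  omega

omit hg in
theorem mtype_of_isOne {v : Node g} {ε : Bool} (h : IsOne ε v) : mtype v = .onePrime := by
  rw [mtype, if_pos ⟨ε, h⟩]

theorem mtype_of_isTwo {m : ℕ} {v : Node g} {ε : Bool} (hv : Level m v) (h : IsTwo ε v) :
    mtype v = .twoPrime := by
  rw [mtype, if_neg fun ⟨_, h'⟩ => h.not_isOne hv h', if_pos ⟨ε, h⟩]

omit hg in
theorem mtype_cases (v : Node g) : (∃ ε, IsOne ε v ∧ mtype v = .onePrime) ∨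
    (∃ ε, IsTwo ε v ∧ mtype v = .twoPrime) ∨
    ((∀ ε, ¬ IsOne ε v) ∧ (∀ ε, ¬ IsTwo ε v) ∧ mtype v = .cannon (ctype v)) := by
  rw [mtype]
  split_ifs with h1 h2
  · obtain ⟨ε, h⟩ := h1
    exact Or.inl ⟨ε, h, rfl⟩
  · obtain ⟨ε, h⟩ := h2
    exact Or.inr (Or.inl ⟨ε, h, rfl⟩)
  · push Not at h1 h2
    exact Or.inr (Or.inr ⟨h1, h2, rfl⟩)

omit hg in
theorem iterate_eq_of_lt {ε : Bool} {i j : ℕ} {t : SurfaceLetter g} (hi : i < 4 * g)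
    (hj : j < 4 * g) : (rot ε)^[i] t = (rot ε)^[j] t ↔ i = j := by
  rw [rot_iterate_eq_iff, Nat.ModEq, Nat.mod_eq_of_lt hi, Nat.mod_eq_of_lt hj]

open Classical in
/-- The modified types of the successors of a vertex with one predecessor. -/
theorem look_one {m : ℕ} {u : Node g} {a : SurfaceLetter g} (hv : Level m (one u a)) :
    ∃ ε, ∀ j < 4 * g, look (one u a) ((rot ε)^[j] (bar a)) =
      successorType g (mtype (one u a)) j := by
  have hg2 := hg.out
  have hne : one u a ≠ root := by simp
  -- the side of the polygon along which the vertex has its type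
  obtain ⟨ε, hr, hu⟩ : ∃ ε, run (!ε) (one u a) = 1 ∧ ∀ δ, IsOne δ (one u a) → δ = ε := by
    by_cases h : ∃ ε, IsOne ε (one u a)
    · obtain ⟨ε, h⟩ := h
      exact ⟨ε, h.run_eq hv _, fun δ h' => h.side_unique hv h'⟩
    · obtain ⟨δ, hδ⟩ := hv.good.run_le
      have := run_pos (ε := δ) hne
      exact ⟨!δ, by rw [Bool.not_not]; omega, fun δ' h' => absurd ⟨δ', h'⟩ h⟩
  refine ⟨ε, fun j hj => ?_⟩
  set s := (rot ε)^[j] (bar a) with hs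
  have hback : IsBack (one u a) s ↔ j = 0 := by
    rw [← iterate_eq_of_lt (ε := ε) (t := bar a) hj (by omega), ← hs]
    constructor
    · rintro ⟨δ, h⟩
      exact (bar_eq_iff.1 (Option.some_injective _ h).symm)
    · intro h
      refine ⟨true, ?_⟩
      change s = bar a at h
      rw [h, bar_bar]; rfl
  have hc1 : Cont ε (one u a) s ↔ j = 1 := by
    rw [← iterate_eq_of_lt (ε := ε) (t := bar a) hj (by omega), ← hs, cont_iff]
    constructor
    · rintro ⟨c, h, h'⟩
      obtain rfl := Option.some_injective _ h
      exact h'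
    · exact fun h => ⟨a, rfl, h⟩
  have hc2 : Cont (!ε) (one u a) s ↔ j + 1 = 4 * g := by
    have h1 : s = nx (!ε) a ↔ j + 1 = 4 * g := by
      rw [nx, eq_comm, rot_eq_iff, Bool.not_not, hs, ← Function.iterate_succ_apply' (rot ε),
        eq_comm]
      have := rot_iterate_eq_iff ε (j + 1) 0 (bar a)
      rw [Function.iterate_zero, id] at this
      rw [Nat.succ_eq_add_one, this, Nat.ModEq, Nat.zero_mod]
      constructor
      · intro h
        have := Nat.le_of_dvd (by omega) (Nat.dvd_of_mod_eq_zero h)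
        omega
      · intro h; rw [h, Nat.mod_self]
    rw [← h1, cont_iff]
    constructor
    · rintro ⟨c, h, h'⟩
      obtain rfl := Option.some_injective _ h
      exact h'
    · exact fun h => ⟨a, rfl, h⟩
  -- `ho`, `ht` and `hfull`: the directions leading to points of types `1'`, `2'` and `2g`
  have ho : ∀ δ, IsOne δ (one (one u a) s) ↔ δ = ε ∧ j = 2 ∧ run ε (one u a) + 1 = 2 * g := by
    intro δ
    rw [isOne_one_iff]
    rcases Bool.eq_or_eq_not δ ε with rfl | rfl
    · rw [← iterate_eq_of_lt (ε := δ) (t := bar a) hj (by omega), ← hs]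
      constructor
      · rintro ⟨h1, c, h, h'⟩
        obtain rfl := Option.some_injective _ h
        exact ⟨rfl, h', h1⟩
      · exact fun h => ⟨h.2.2, a, rfl, h.2.1⟩
    · constructor
      · rintro ⟨h1, -⟩; omega
      · rintro ⟨h1, -⟩
        cases ε <;> simp at h1
  have ht : ∀ δ, IsTwo δ (one (one u a) s) ↔ δ = ε ∧ j = 1 ∧ IsOne ε (one u a) := by
    intro δ
    constructor
    · rintro ⟨h1, h2⟩
      obtain rfl := hu δ h1
      exact ⟨rfl, hc1.1 h2, h1⟩
    · rintro ⟨rfl, h1, h2⟩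
      exact ⟨h2, hc1.2 h1⟩
  have hfull : ∀ δ, Full δ (one u a) s ↔ δ = ε ∧ j = 1 ∧ run ε (one u a) + 1 = 2 * g := by
    intro δ
    rcases Bool.eq_or_eq_not δ ε with rfl | rfl
    · rw [Full, hc1]; simp
    · constructor
      · rintro ⟨-, h⟩; omega
      · rintro ⟨h1, -⟩
        cases ε <;> simp at h1
  have hrun : ctype (one (one u a) s) =
      if j = 1 then run ε (one u a) + 1 else if j + 1 = 4 * g then 2 else 1 := by
    have h1 : ctype (one (one u a) s) =
        max (run ε (one (one u a) s)) (run (!ε) (one (one u a) s)) := by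
      cases ε
      · exact max_comm _ _
      · rfl
    have h2 : ∀ δ, run δ (one (one u a) s) =
        if Cont δ (one u a) s then run δ (one u a) + 1 else 1 := fun δ => by rw [run]
    rw [h1, h2, h2, hr]
    simp only [hc1, hc2]
    split_ifs <;> omega
  have hrank : rank (mtype (one u a)) = run ε (one u a) ∧ mtype (one u a) ≠ .cannon (2 * g) := by
    have h0 := run_pos (ε := ε) hne
    have h1 := hv.good.run_lt ε
    rcases mtype_cases (one u a) with ⟨δ, h, h'⟩ | ⟨δ, h, h'⟩ | ⟨-, -, h'⟩
    · rw [h', h.run_eq hv]; exact ⟨rfl, by simp⟩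
    · rw [h']
      have h2 := h.run_eq hv
      rcases Bool.eq_or_eq_not δ ε with rfl | rfl
      · rw [h2]; exact ⟨rfl, by simp⟩
      · omega
    · have h2 : ctype (one u a) = max (run ε (one u a)) (run (!ε) (one u a)) := by
        cases ε
        · exact max_comm _ _
        · rfl
      rw [hr, max_eq_left h0] at h2
      rw [h', h2]
      refine ⟨rfl, ?_⟩
      simp only [ne_eq, TypeSymbol.cannon.injEq]
      omega
  have hone : mtype (one u a) = .onePrime ↔ IsOne ε (one u a) := by
    constructor
    · intro h
      rcases mtype_cases (one u a) with ⟨δ, h1, -⟩ | ⟨δ, -, h'⟩ | ⟨-, -, h'⟩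
      · rwa [← hu δ h1]
      · rw [h] at h'; cases h'
      · rw [h] at h'; cases h'
    · exact mtype_of_isOne
  rw [look, successorType, if_neg hrank.2, hrank.1]
  simp only [hback]
  by_cases h0 : j = 0
  · rw [if_pos h0, if_pos h0]
  rw [if_neg h0, if_neg h0]
  rcases push_cases hv s with ⟨δ, w, t, hf, hp, -⟩ | ⟨hf, hp⟩
  · obtain ⟨-, h1, h2⟩ := (hfull δ).1 hf
    have h3 : ¬ IsOne ε (one u a) := by
      intro h
      have := h.run_eq hv ε
      omega
    rw [if_pos h1, hp, mtype_mkTwo, if_neg (mt hone.1 h3), h2]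
  rw [hp]
  by_cases h1 : j = 1
  · rw [if_pos h1]
    have hl : Level (m + 1) (one (one u a) s) := by
      rw [← hp]
      exact Level.step hv (by rw [hback]; exact h0)
    by_cases h2 : IsOne ε (one u a)
    · rw [if_pos (hone.2 h2), mtype_of_isTwo hl ((ht ε).2 ⟨rfl, h1, h2⟩)]
    · rw [if_neg (mt hone.1 h2), mtype_cannon, hrun, if_pos h1]
      · intro δ h; have := (ho δ).1 h; omega
      · intro δ h; exact h2 ((ht δ).1 h).2.2
  rw [if_neg h1]
  have htn : ∀ δ, ¬ IsTwo δ (one (one u a) s) := fun δ h => h1 ((ht δ).1 h).2.1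
  by_cases h2 : j + 1 = 4 * g
  · rw [if_pos h2, mtype_cannon _ htn, hrun, if_neg h1, if_pos h2]
    intro δ h; have := (ho δ).1 h; omega
  rw [if_neg h2]
  by_cases h3 : j = 2 ∧ run ε (one u a) + 1 = 2 * g
  · rw [if_pos h3, mtype_of_isOne ((ho ε).2 ⟨rfl, h3⟩)]
  · rw [if_neg h3, mtype_cannon _ htn, hrun, if_neg h1, if_neg h2]
    intro δ h; exact h3 ((ho δ).1 h).2

/-- The modified types of the successors of the top of a polygon. -/
theorem look_two {m : ℕ} {u w : Node g} {a c : SurfaceLetter g} (hv : Level m (two u a w c))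
    {j : ℕ} (hj : j < 4 * g) : look (two u a w c) ((rot true)^[j] (bar a)) =
      successorType g (mtype (two u a w c)) j := by
  have hg2 := hg.out
  set s := (rot true)^[j] (bar a) with hs
  have hca : bar c = rot false (bar a) := by
    rcases hv.good.back_adj true a c rfl rfl with ⟨h, -⟩ | h
    · cases h
    · exact (rot_eq_iff true).1 h
  have key : ∀ i, i < 4 * g → ((rot true)^[i] s = bar a ↔ j + i = 4 * g ∨ i + j = 0) := by
    intro i hi
    have := rot_iterate_eq_iff true (i + j) 0 (bar a)
    rw [Function.iterate_add_apply, ← hs, Function.iterate_zero, id] at this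
    rw [this, Nat.ModEq, Nat.zero_mod, ← Nat.dvd_iff_mod_eq_zero]
    constructor
    · rintro ⟨k, hk⟩
      obtain _ | _ | k := k
      · right; omega
      · left; omega
      · have : 4 * g * (k + 1 + 1) = 4 * g * k + 8 * g := by ring
        rw [this] at hk
        omega
    · rintro (h | h)
      · exact ⟨1, by omega⟩
      · rw [h]; exact dvd_zero _
  have k1 : s = bar c ↔ j + 1 = 4 * g := by
    rw [hca, eq_comm, rot_eq_iff, Bool.not_false, eq_comm]
    have := key 1 (by omega)
    rw [Function.iterate_one] at this
    rw [this]; omega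
  have hback : IsBack (two u a w c) s ↔ j = 0 ∨ j + 1 = 4 * g := by
    have h1 : s = bar a ↔ j = 0 := by
      have := key 0 (by omega)
      rw [Function.iterate_zero, id] at this
      rw [this]; omega
    rw [← h1, ← k1]
    constructor
    · rintro ⟨_ | _, h⟩
      · exact Or.inr (bar_eq_iff.1 (Option.some_injective _ h).symm)
      · exact Or.inl (bar_eq_iff.1 (Option.some_injective _ h).symm)
    · rintro (h | h)
      · exact ⟨true, by rw [h, bar_bar]; rfl⟩
      · exact ⟨false, by rw [h, bar_bar]; rfl⟩
  have hc1 : Cont true (two u a w c) s ↔ j = 1 := by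
    rw [← iterate_eq_of_lt (ε := true) (t := bar a) hj (by omega), ← hs, cont_iff]
    constructor
    · rintro ⟨c, h, h'⟩
      obtain rfl := Option.some_injective _ h
      exact h'
    · exact fun h => ⟨a, rfl, h⟩
  have hc2 : Cont false (two u a w c) s ↔ j + 2 = 4 * g := by
    have h1 : s = nx false c ↔ j + 2 = 4 * g := by
      rw [nx, hca, eq_comm, rot_eq_iff, rot_eq_iff, Bool.not_false, eq_comm]
      have := key 2 (by omega)
      rw [Function.iterate_succ, Function.iterate_one, Function.comp] at this
      rw [this]; omega
    rw [← h1, cont_iff]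
    constructor
    · rintro ⟨c, h, h'⟩
      obtain rfl := Option.some_injective _ h
      exact h'
    · exact fun h => ⟨c, rfl, h⟩
  have hfull : ∀ δ, ¬ Full δ (two u a w c) s := by
    rintro δ ⟨-, h⟩
    rw [run] at h
    omega
  have hm : mtype (two u a w c) = .cannon (2 * g) := mtype_mkTwo true u w a c
  have hp := push_of_not_full hfull
  rw [look, hm, successorType, if_pos rfl, hp, mtype_cannon]
  · have h1 : ctype (one (two u a w c) s) = if j = 1 ∨ j + 2 = 4 * g then 2 else 1 := by
      rw [ctype, run, run]
      simp only [hc1, hc2, run]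
      split_ifs <;> omega
    rw [h1]
    simp only [hback]
    split_ifs <;> rfl
  · intro δ h
    have := (isOne_one_iff.1 h).1
    rw [run] at this
    omega
  · rintro δ ⟨h, -⟩
    exact h

theorem look_root (s : SurfaceLetter g) : look root s = some (.cannon 1) := by
  have hf : ∀ ε, ¬ Full ε root s := by
    rintro ε ⟨h, -⟩
    simp [Node.Cont, lt] at h
  have hr : ∀ ε, run ε (one root s) = 1 := by
    intro ε
    rw [run, if_neg]
    intro h
    simp [Node.Cont, lt] at h
  rw [look, if_neg (by rintro ⟨ε, h⟩; simp [lt] at h), push_of_not_full hf, mtype_cannon,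
    ctype, hr, hr, max_self]
  · intro ε h
    have := (isOne_one_iff.1 h).1
    rw [run] at this
    have := hg.out
    omega
  · rintro ε ⟨h, -⟩
    exact h

/-- The modified types of the successors depend only on the modified type of the vertex. -/
theorem exists_look {m : ℕ} {v : Node g} (hv : Level m v) (hne : v ≠ root) :
    ∃ ε t, ∀ j < 4 * g, look v ((rot ε)^[j] t) = successorType g (mtype v) j := by
  cases v with
  | root => exact absurd rfl hne
  | one u a =>
    obtain ⟨ε, h⟩ := look_one hv
    exact ⟨ε, bar a, h⟩
  | two u a w c => exact ⟨true, bar a, fun j hj => look_two hv hj⟩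

omit hg in
theorem ctype_ne_zero {v : Node g} (hg : 0 < g) (h : v ≠ root) : ctype v ≠ 0 := by
  cases v with
  | root => exact absurd rfl h
  | one u a =>
    have := run_pos (ε := true) h
    rw [ctype]
    omega
  | two u a w c => rw [ctype]; omega

theorem mtype_eq_zero_iff {v : Node g} : mtype v = .cannon 0 ↔ v = root := by
  constructor
  · intro h
    by_contra hne
    rcases mtype_cases v with ⟨-, -, h'⟩ | ⟨-, -, h'⟩ | ⟨-, -, h'⟩
    · rw [h] at h'; cases h'
    · rw [h] at h'; cases h'
    · rw [h] at h'
      injection h' with h'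
      exact ctype_ne_zero (by have := hg.out; omega) hne h'.symm
  · rintro rfl
    exact mtype_root

omit hg in
/-- The letters in their cyclic order, starting from `t`. -/
theorem rot_bijective (ε : Bool) (t : SurfaceLetter g) :
    Function.Bijective fun j : Fin (4 * g) => (rot ε)^[j] t := by
  constructor
  · intro i j h
    exact Fin.ext ((iterate_eq_of_lt i.2 j.2).1 h)
  · intro s
    obtain ⟨j, hj, rfl⟩ := exists_rot_iterate ε t s
    exact ⟨⟨j, hj⟩, rfl⟩

/-- Vertices of the same modified type have matching edges. The matching turns or reflects the
cyclic order of the edges. -/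
theorem exists_equiv_look {m m' : ℕ} {v v' : Node g} (hv : Level m v) (hv' : Level m' v')
    (h : mtype v = mtype v') : ∃ θ : SurfaceLetter g ≃ SurfaceLetter g,
      ∀ s, look v' (θ s) = look v s := by
  by_cases hne : v = root
  · have hne' : v' = root := by
      rw [← mtype_eq_zero_iff, ← h, hne, mtype_root]
    exact ⟨Equiv.refl _, fun s => by rw [hne, hne']; rfl⟩
  · have hne' : v' ≠ root := by
      rw [ne_eq, ← mtype_eq_zero_iff, ← h, mtype_eq_zero_iff]
      exact hne
    obtain ⟨ε, t, h1⟩ := exists_look hv hne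
    obtain ⟨ε', t', h2⟩ := exists_look hv' hne'
    refine ⟨(Equiv.ofBijective _ (rot_bijective ε t)).symm.trans
      (Equiv.ofBijective _ (rot_bijective ε' t')), fun s => ?_⟩
    obtain ⟨j, rfl⟩ := (rot_bijective ε t).2 s
    have e : (Equiv.ofBijective _ (rot_bijective ε t)).symm ((rot ε)^[j] t) = j :=
      Equiv.ofBijective_symm_apply_apply _ (rot_bijective ε t) j
    rw [Equiv.trans_apply, e]
    simp only [Equiv.ofBijective_apply]
    rw [h1 j j.2, h2 j j.2, h]

end Node

variable [hg : Fact (2 ≤ g)]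

theorem look_node_eq_some {x : SurfaceGroup g} {s : SurfaceLetter g} {τ : TypeSymbol} :
    look (node x) s = some τ ↔
      ¬ IsBack (node x) s ∧ modifiedType (x * wordVal [s]) = τ := by
  rw [look]
  split_ifs with h
  · simp [h]
  · rw [modifiedType_eq, node_mul_push h]
    simp [h]

/-- Points of the same modified type have the same number of successors of each modified type. -/
theorem exists_equiv_letters {x x' : SurfaceGroup g} (h : modifiedType x = modifiedType x') :
    ∃ θ : SurfaceLetter g ≃ SurfaceLetter g, ∀ s,
      (IsBack (node x') (θ s) ↔ IsBack (node x) s) ∧ (¬ IsBack (node x) s →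
        modifiedType (x' * wordVal [θ s]) = modifiedType (x * wordVal [s])) := by
  rw [modifiedType_eq, modifiedType_eq] at h
  obtain ⟨θ, hθ⟩ := exists_equiv_look (level_node x) (level_node x') h
  refine ⟨θ, fun s => ?_⟩
  have h1 := hθ s
  constructor
  · rw [look, look] at h1
    split_ifs at h1 with h2 h3 h3 <;> tauto
  · intro h2
    exact (look_node_eq_some.1 (h1.trans (look_node_eq_some.2 ⟨h2, rfl⟩))).2

theorem exists_successor_of_modifiedType_eq {x x' y : SurfaceGroup g}
    (h : modifiedType x = modifiedType x') (hy : y ∈ successors (surfaceGens g) x) :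
    ∃ y' ∈ successors (surfaceGens g) x', modifiedType y' = modifiedType y := by
  obtain ⟨θ, hθ⟩ := exists_equiv_letters h
  obtain ⟨s, hs, rfl⟩ := mem_successors_iff.1 hy
  exact ⟨_, mem_successors_iff.2 ⟨θ s, fun hb => hs ((hθ s).1.1 hb), rfl⟩, (hθ s).2 hs⟩

theorem exists_successor_type_one (x : SurfaceGroup g) :
    ∃ y ∈ successors (surfaceGens g) x, modifiedType y = .cannon 1 := by
  have hg2 := hg.out
  obtain ⟨s, hs⟩ : ∃ s, look (node x) s = some (.cannon 1) := by
    by_cases h : node x = root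
    · exact ⟨(Sum.inl ⟨0, by omega⟩, true), by rw [h, look_root]⟩
    · obtain ⟨ε, t, ht⟩ := exists_look (level_node x) h
      refine ⟨(rot ε)^[3] t, ?_⟩
      rw [ht 3 (by omega), successorType]
      split_ifs <;> first | rfl | omega | grind
  obtain ⟨h1, h2⟩ := look_node_eq_some.1 hs
  exact ⟨_, mem_successors_iff.2 ⟨s, h1, rfl⟩, h2⟩

/-- A criterion for determining successors: it suffices that the value `σ x` determines the
modified type of `x` and, together with the modified type of a successor `y`, the value `τ y`. -/
theorem determinesSuccessors_of {α β : Type*} {σ : SurfaceGroup g → α} {τ : SurfaceGroup g → β}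
    (h1 : ∀ x x', σ x = σ x' → modifiedType x = modifiedType x')
    (h2 : ∀ x x', σ x = σ x' → ∀ y ∈ successors (surfaceGens g) x,
      ∀ y' ∈ successors (surfaceGens g) x', modifiedType y = modifiedType y' → τ y = τ y') :
    DeterminesSuccessors σ τ := by
  intro x x' h
  refine ⟨fun b => ?_, h2 x x' h⟩
  obtain ⟨θ, hθ⟩ := exists_equiv_letters (h1 x x' h)
  have key : ∀ z : SurfaceGroup g, {y | y ∈ successors (surfaceGens g) z ∧ τ y = b} =
      (fun s => z * wordVal [s]) '' {s | ¬ IsBack (node z) s ∧ τ (z * wordVal [s]) = b} := by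
    intro z
    ext y
    constructor
    · rintro ⟨hy, hb⟩
      obtain ⟨s, hs, rfl⟩ := mem_successors_iff.1 hy
      exact ⟨s, ⟨hs, hb⟩, rfl⟩
    · rintro ⟨s, ⟨hs, hb⟩, rfl⟩
      exact ⟨mem_successors_iff.2 ⟨s, hs, rfl⟩, hb⟩
  have hinj : ∀ z : SurfaceGroup g, Function.Injective fun s : SurfaceLetter g =>
      z * wordVal [s] := fun z s t h => wordVal_singleton_injective (mul_left_cancel h)
  rw [key, key, Set.ncard_image_of_injective _ (hinj x), Set.ncard_image_of_injective _ (hinj x')]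
  rw [← Set.ncard_image_of_injective _ θ.injective]
  congr 1
  ext t
  obtain ⟨s, rfl⟩ := θ.surjective t
  rw [Function.Injective.mem_set_image θ.injective]
  simp only [Set.mem_ofPred_eq]
  rw [(hθ s).1]
  refine and_congr_right fun hs => ?_
  rw [h2 x x' h _ (mem_successors_iff.2 ⟨s, hs, rfl⟩) _
    (mem_successors_iff.2 ⟨θ s, fun hb => hs ((hθ s).1.1 hb), rfl⟩) ((hθ s).2 hs).symm]

end SurfaceTiling

namespace SurfaceTiling

variable {g : ℕ}

open Node Vertex

/-! ### Essential types -/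

namespace Node

/-- The vertices at distance `i` from the root on the geodesics from the root to a vertex. -/
def pts : Node g → ℕ → Set (Node g)
  | root, _ => {root}
  | one v s, i => {p | if i ≤ depth v then p ∈ pts v i else p = one v s}
  | two v s w t, i => {p | if i ≤ depth v then p ∈ pts v i ∨ p ∈ pts w i else p = two v s w t}

open Classical in
/-- The entry of the essential type at distance `i` from the root. -/
noncomputable def entry (v : Node g) (i : ℕ) : TypeSymbol :=
  if h : ∃ u, pts v i = {u} then mtype h.choose else .star

/-- The last `n` entries of the essential type. -/
noncomputable def tailEntries (v : Node g) (n : ℕ) : List TypeSymbol :=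
  (List.range n).reverse.map (entry v)

theorem pts_one_of_le {v : Node g} {s : SurfaceLetter g} {i : ℕ} (h : i ≤ depth v) :
    pts (one v s) i = pts v i := by
  ext p
  simp [pts, h]

theorem pts_of_depth_le (v : Node g) {i : ℕ} (h : depth v ≤ i) : pts v i = {v} := by
  cases v with
  | root => rfl
  | one v s =>
    ext p
    rw [depth] at h
    simp [pts, show ¬ i ≤ depth v by omega]
  | two v s w t =>
    ext p
    rw [depth] at h
    simp [pts, show ¬ i ≤ depth v by omega]

theorem entry_of_pts {v u : Node g} {i : ℕ} (h : pts v i = {u}) : entry v i = mtype u := by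
  have h' : ∃ u, pts v i = {u} := ⟨u, h⟩
  have h2 := Set.singleton_eq_singleton_iff.1 (h.symm.trans h'.choose_spec)
  rw [entry, dif_pos h', ← h2]

theorem entry_eq_star {v p q : Node g} {i : ℕ} (hp : p ∈ pts v i) (hq : q ∈ pts v i)
    (h : p ≠ q) : entry v i = .star := by
  rw [entry, dif_neg]
  rintro ⟨u, hu⟩
  rw [hu] at hp hq
  exact h (hp.trans hq.symm)

theorem entry_congr {v w : Node g} {i : ℕ} (h : pts v i = pts w i) : entry v i = entry w i := by
  by_cases hw : ∃ u, pts w i = {u}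
  · obtain ⟨u, hu⟩ := hw
    rw [entry_of_pts hu, entry_of_pts (h.trans hu)]
  · rw [entry, entry, dif_neg hw, dif_neg (by rwa [h])]

theorem entry_self (v : Node g) : entry v (depth v) = mtype v :=
  entry_of_pts (pts_of_depth_le v le_rfl)

theorem tailEntries_succ (v : Node g) (n : ℕ) :
    tailEntries v (n + 1) = entry v n :: tailEntries v n := by
  simp [tailEntries, List.range_succ]

theorem length_tailEntries (v : Node g) (n : ℕ) : (tailEntries v n).length = n := by
  simp [tailEntries]

theorem tailEntries_congr {v w : Node g} {n : ℕ} (h : ∀ i < n, pts v i = pts w i) :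
    tailEntries v n = tailEntries w n := by
  rw [tailEntries, tailEntries]
  apply List.map_congr_left
  intro i hi
  rw [List.mem_reverse, List.mem_range] at hi
  exact entry_congr (h i hi)

theorem drop_tailEntries (v : Node g) (n k : ℕ) :
    (tailEntries v (n + k)).drop k = tailEntries v n := by
  induction k with
  | zero => rfl
  | succ k ih => rw [← add_assoc, tailEntries_succ, List.drop_succ_cons, ih]

theorem getElem?_tailEntries (v : Node g) (n k : ℕ) :
    (tailEntries v (n + 1 + k))[k]? = some (entry v n) := by
  rw [← List.head?_drop, drop_tailEntries, tailEntries_succ, List.head?_cons]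

/-- The essential type, read off from the combinatorial vertex. -/
noncomputable def ess (v : Node g) : List TypeSymbol := tailEntries v (depth v + 1)

theorem ess_eq (v : Node g) : ess v = mtype v :: tailEntries v (depth v) := by
  rw [ess, tailEntries_succ, entry_self]

theorem ess_one (v : Node g) (s : SurfaceLetter g) :
    ess (one v s) = mtype (one v s) :: ess v := by
  rw [ess_eq, ess]
  congr 1
  exact tailEntries_congr fun i hi => pts_one_of_le (by rw [depth] at hi; omega)

theorem mem_pts_mkTwo {ε : Bool} {v w : Node g} {s t : SurfaceLetter g} (h : depth v = depth w)
    {i : ℕ} (hi : i ≤ depth v) (p : Node g) :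
    p ∈ pts (mkTwo ε v s w t) i ↔ p ∈ pts v i ∨ p ∈ pts w i := by
  cases ε
  · simp [mkTwo, pts, ← h, hi, or_comm]
  · simp [mkTwo, pts, hi]

theorem depth_mkTwo {ε : Bool} {v w : Node g} {s t : SurfaceLetter g} (h : depth v = depth w) :
    depth (mkTwo ε v s w t) = depth v + 1 := by
  cases ε
  · rw [h]; rfl
  · rfl

theorem depth_arc (ε : Bool) (w : Node g) (a : SurfaceLetter g) (k : ℕ) :
    depth (arc ε w a k) = depth w + k := by
  induction k with
  | zero => rfl
  | succ k ih => rw [arc, depth, ih, add_assoc]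

theorem pts_arc_of_le (ε : Bool) {w : Node g} (a : SurfaceLetter g) (k : ℕ) {i : ℕ}
    (hi : i ≤ depth w) : pts (arc ε w a k) i = pts w i := by
  induction k with
  | zero => rfl
  | succ k ih => rw [arc, pts_one_of_le (by rw [depth_arc]; omega), ih]

theorem pts_arc (ε : Bool) (w : Node g) (a : SurfaceLetter g) {k i : ℕ} (hi : i ≤ k) :
    pts (arc ε w a k) (depth w + i) = {arc ε w a i} := by
  induction k with
  | zero =>
    obtain rfl : i = 0 := by omega
    exact pts_of_depth_le _ le_rfl
  | succ k ih =>
    by_cases h : i = k + 1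
    · rw [h]; exact pts_of_depth_le _ (by rw [depth_arc])
    · rw [arc, pts_one_of_le (by rw [depth_arc]; omega), ih (by omega)]

theorem arc_injective {ε δ : Bool} {w w' : Node g} {a a' : SurfaceLetter g} {k : ℕ}
    (h : arc ε w a k = arc δ w' a' k) : w = w' := by
  induction k with
  | zero => exact h
  | succ k ih =>
    injection h with h1 _
    exact ih h1

/-- `Starred g L M` describes how the essential type `L` of a point `x` of type `2g - 1` changes
on its successor of type `2g`, the top of a polygon: `M` is the essential type of this successor
without its first entry. The entries along the polygon become `*`. If the side through `x` starts
with points of types `1'` and `2'`, the other side starts with the top of another polygon with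
the same bottom, and the procedure continues from this bottom. -/
inductive Starred (g : ℕ) : List TypeSymbol → List TypeSymbol → Prop
  | last {L : List TypeSymbol} : 2 * g - 1 ≤ L.length →
      L[2 * g - 3]? ≠ some .twoPrime →
      Starred g L (List.replicate (2 * g - 1) .star ++ L.drop (2 * g - 1))
  | next {L M : List TypeSymbol} : 2 * g - 1 ≤ L.length →
      L[2 * g - 3]? = some .twoPrime → Starred g (L.drop (2 * g - 1)) M →
      Starred g L (List.replicate (2 * g - 1) .star ++ M)

variable [hg : Fact (2 ≤ g)]

theorem push_ne_push {m : ℕ} {b : Node g} (hb : Level m b) {a c : SurfaceLetter g} (h : a ≠ c) :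
    push b a ≠ push b c := by
  intro h'
  have h1 := congrArg val h'
  rw [val_push m b a hb, val_push m b c hb] at h1
  exact h (wordVal_singleton_injective (mul_left_cancel h1))

theorem pts_subset_push {m : ℕ} {b : Node g} (hb : Level m b) {a : SurfaceLetter g}
    (ha : ¬ IsBack b a) {i : ℕ} (hi : i ≤ m) : pts b i ⊆ pts (push b a) i := by
  have hd := hb.good.depth_eq
  rcases push_cases hb a with ⟨ε, w, t, -, hp, -⟩ | ⟨-, hp⟩
  · have h1 := Level.step hb ha
    rw [hp] at h1
    obtain ⟨k, hk, hw, -⟩ := h1.good.par_level ε t (lt_mkTwo ..)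
    rw [par_mkTwo] at hw
    have := hw.good.depth_eq
    intro p hpi
    rw [hp, mem_pts_mkTwo (by omega) (by omega)]
    exact Or.inr hpi
  · rw [hp, pts_one_of_le (by omega)]

/-- The essential type of the top of a polygon. Below the bottom `b`, a geodesic to the top is a
geodesic to the first vertex of one of the two sides. If both of these have `b` as their only
predecessor, the entries are those of `b`. If the first vertex of the other side is itself the top
of a polygon, it has all the geodesics that `b` has, and the entries are found by induction. The
two cases are told apart by the type `2'` of the second vertex on the side of `v`. -/
theorem ess_push_of_full : ∀ (m : ℕ) (v : Node g) (s : SurfaceLetter g) (ε : Bool), Level m v →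
    Full ε v s → ∃ M, ess (push v s) = .cannon (2 * g) :: M ∧ Starred g (ess v) M := by
  have hg2 := hg.out
  intro m
  induction m using Nat.strong_induction_on with
  | _ m IH =>
  intro v s ε hv hf
  obtain ⟨b, a, j, hm, hb, hba, hbr, hva, -, -, hp⟩ := exists_bottom (fun _ _ _ h => h.good) hv hf
  obtain ⟨r, hr⟩ : ∃ r, r = rot (!ε) a := ⟨_, rfl⟩
  rw [← hr] at hbr hp
  have hra : a = rot ε r := by rw [hr, rot_rot_not]
  have hnca : ¬ Cont ε b a := not_cont_of_not_isBack (by rwa [← hr])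
  have hncr : ¬ Cont (!ε) b r := not_cont_of_not_isBack (by rwa [Bool.not_not, ← hra])
  have hne : push b a ≠ push b r := push_ne_push hb (by rw [hra]; exact rot_ne _ _)
  have hdb := hb.good.depth_eq
  have hdw := (Level.step hb hba).good.depth_eq
  have hdw' := (Level.step hb hbr).good.depth_eq
  have hdv := hv.good.depth_eq
  obtain ⟨w, hw⟩ : ∃ w, w = push b a := ⟨_, rfl⟩
  obtain ⟨w', hw'⟩ : ∃ w', w' = push b r := ⟨_, rfl⟩
  obtain ⟨hrw, hlw, hpw⟩ := hb.good.push_of_bottom (ε := ε) (s := a) (by rwa [← hr])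
  have hlevw := Level.step hb hba
  have hlevw' := Level.step hb hbr
  rw [← hw] at hva hne hdw hrw hlw hpw hlevw
  rw [← hw'] at hp hne hdw' hlevw'
  obtain ⟨q, hq⟩ : ∃ q, q = arc (!ε) w' r (2 * g - 2) := ⟨_, rfl⟩
  have hdq : depth q = depth v := by rw [hq, depth_arc]; omega
  rw [← hq] at hp
  have hpts : ∀ i ≤ depth v, ∀ p, p ∈ pts (push v s) i ↔ p ∈ pts q i ∨ p ∈ pts v i := by
    intro i hi p
    rw [hp, mem_pts_mkTwo hdq (by omega)]
  have hdT : depth (push v s) = depth v + 1 := by rw [hp, depth_mkTwo hdq, hdq]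
  -- the entries strictly between the bottom and the top
  have hstar : ∀ k ≤ 2 * g - 1, tailEntries (push v s) (j + 1 + k) =
      List.replicate k .star ++ tailEntries (push v s) (j + 1) := by
    intro k
    induction k with
    | zero => intro _; rfl
    | succ k ih =>
      intro hk
      rw [← add_assoc, tailEntries_succ, ih (by omega), List.replicate_succ, List.cons_append]
      congr 1
      have h1 : arc (!ε) w' r k ∈ pts (push v s) (j + 1 + k) := by
        rw [hpts _ (by omega)]
        left
        rw [hq, ← hdw', pts_arc _ _ _ (by omega)]
        rfl
      have h2 : arc ε w a k ∈ pts (push v s) (j + 1 + k) := by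
        rw [hpts _ (by omega)]
        right
        rw [hva, ← hdw, pts_arc _ _ _ (by omega)]
        rfl
      exact entry_eq_star h2 h1 fun h => hne (arc_injective h)
  have hess : ess (push v s) = .cannon (2 * g) ::
      (List.replicate (2 * g - 1) .star ++ tailEntries (push v s) (j + 1)) := by
    rw [ess_eq, ← hstar _ le_rfl]
    congr 1
    · rw [hp, mtype_mkTwo]
    · rw [hdT]; congr 1; omega
  have hlen : 2 * g - 1 ≤ (ess v).length := by rw [ess, length_tailEntries]; omega
  have hdrop : (ess v).drop (2 * g - 1) = tailEntries v (j + 1) := by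
    rw [ess, ← drop_tailEntries v (j + 1) (2 * g - 1)]
    congr 2; omega
  have hget : (ess v)[2 * g - 3]? = some (mtype (arc ε w a 1)) := by
    have h1 := getElem?_tailEntries v (j + 2) (2 * g - 3)
    rw [show j + 2 + 1 + (2 * g - 3) = depth v + 1 by omega] at h1
    rw [ess, h1, entry_of_pts]
    rw [hva, show j + 2 = depth w + 1 by omega]
    exact pts_arc _ _ _ (by omega)
  have hvw : ∀ i ≤ j, pts v i = pts w i := fun i hi => by
    rw [hva, pts_arc_of_le _ _ _ (by omega)]
  have hqw : ∀ i ≤ j, pts q i = pts w' i := fun i hi => by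
    rw [hq, pts_arc_of_le _ _ _ (by omega)]
  have hcw : Cont ε w (nx ε a) := cont_iff.2 ⟨a, hlw, rfl⟩
  have harc : arc ε w a 1 = one w (nx ε a) := rfl
  rcases push_cases hb r with ⟨δ, x, t, hf', hp', -⟩ | ⟨hf', hp'⟩
  · -- the other side of the polygon starts with the top of another polygon
    have hδ : δ = ε := by
      rcases Bool.eq_or_eq_not δ ε with rfl | rfl
      · rfl
      · exact absurd hf'.1 hncr
    subst hδ
    obtain ⟨c, hc, hrc⟩ := cont_iff.1 hf'.1
    have hone : IsOne δ (one b a) := isOne_one_iff.2 ⟨hf'.2, c, hc, by rw [← hrc, hra]⟩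
    have hwone : w = one b a := by
      rcases push_cases hb a with ⟨η, x, t, hf'', -⟩ | ⟨-, h⟩
      · exact absurd hf''.1 ((run_of_isOne hb hone).2.1 η)
      · rw [hw, h]
    obtain ⟨M, hM, hS⟩ := IH j (by omega) b r δ hb hf'
    rw [← hw', ess_eq] at hM
    injection hM with _ hM
    rw [hdw'] at hM
    refine ⟨_, hess, Starred.next hlen ?_ ?_⟩
    · rw [hget, harc, hwone, mtype_of_isTwo (m := j + 2) (ε := δ)]
      · rw [← hwone]
        have h1 := arc_up (M := j + 2) (fun _ _ _ h => h.good) hlevw hrw hlw 1 (by omega) le_rfl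
        exact h1.1
      · exact ⟨hone, by rw [← hwone]; exact hcw⟩
    · rw [hdrop]
      have h1 : tailEntries v (j + 1) = ess b := by
        rw [ess, hdb]
        apply tailEntries_congr
        intro i hi
        rw [hvw i (by omega), hwone, pts_one_of_le (by omega)]
      have h2 : tailEntries (push v s) (j + 1) = M := by
        rw [← hM]
        apply tailEntries_congr
        intro i hi
        ext p
        rw [hpts i (by omega), hqw i (by omega), hvw i (by omega), hwone,
          pts_one_of_le (by omega)]
        constructor
        · rintro (h | h)
          · exact h
          · rw [hw']; exact pts_subset_push hb hbr (by omega) h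
        · exact Or.inl
      rw [h1, h2]
      exact hS
  · -- the other side of the polygon starts with a point with a single predecessor
    refine ⟨_, hess, ?_⟩
    have h1 : tailEntries (push v s) (j + 1) = (ess v).drop (2 * g - 1) := by
      rw [hdrop]
      apply tailEntries_congr
      intro i hi
      ext p
      rw [hpts i (by omega), hqw i (by omega), hvw i (by omega), hw', hp',
        pts_one_of_le (by omega)]
      constructor
      · rintro (h | h)
        · rw [hw]; exact pts_subset_push hb hba (by omega) h
        · exact h
      · exact Or.inr
    rw [h1]
    refine Starred.last hlen ?_
    rw [hget, harc]
    intro h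
    rcases mtype_cases (one w (nx ε a)) with ⟨-, -, h'⟩ | ⟨δ, h2, -⟩ | ⟨-, -, h'⟩
    · rw [h'] at h; cases h
    · obtain ⟨h3, h4⟩ := h2
      have hδ : δ = ε := by
        rcases Bool.eq_or_eq_not δ ε with rfl | rfl
        · rfl
        · exact absurd h4 (hlevw.good.not_cont_not hcw)
      subst hδ
      cases w with
      | root => exact h3
      | two _ _ _ _ => exact h3
      | one y d =>
        obtain rfl : y = b := hpw
        obtain rfl : d = a := Option.some_injective _ hlw
        obtain ⟨h5, c, h6, h7⟩ := isOne_one_iff.1 h3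
        refine hf' δ ⟨cont_iff.2 ⟨c, h6, ?_⟩, h5⟩
        rw [hr, h7, rot_not_rot]
    · rw [h'] at h; cases h

end Node

variable [hg : Fact (2 ≤ g)]

theorem length_of_isGeodesicWord {c : List (SurfaceLetter g)} {x : SurfaceGroup g}
    (h : IsGeodesicWord c x) : c.length = depth (node x) := by
  rw [h.2, surfaceLength_eq_depth]

/-- `pts` is what its description says in terms of geodesic words. -/
theorem mem_pts_iff : ∀ (m : ℕ) (x : SurfaceGroup g), depth (node x) = m → ∀ (i : ℕ) (p : Node g),
    p ∈ pts (node x) i ↔ ∃ c, IsGeodesicWord c x ∧ node (wordVal (c.take i)) = p := by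
  intro m
  induction m using Nat.strong_induction_on with
  | _ m IH =>
  intro x hx i p
  by_cases hi : depth (node x) ≤ i
  · rw [pts_of_depth_le _ hi]
    constructor
    · rintro rfl
      obtain ⟨c, hc⟩ := exists_isGeodesicWord x
      refine ⟨c, hc, ?_⟩
      rw [List.take_of_length_le (by rwa [length_of_isGeodesicWord hc]), hc.1]
    · rintro ⟨c, hc, rfl⟩
      rw [List.take_of_length_le (by rwa [length_of_isGeodesicWord hc]), hc.1]
      rfl
  -- a geodesic of positive length passes through one of the predecessors
  have key : (∃ c, IsGeodesicWord c x ∧ node (wordVal (c.take i)) = p) ↔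
      ∃ ε, ∃ a, lt ε (node x) = some a ∧ p ∈ pts (par ε (node x)) i := by
    constructor
    · rintro ⟨c, hc, rfl⟩
      obtain rfl | ⟨d, s, rfl⟩ := List.eq_nil_or_concat' c
      · have := length_of_isGeodesicWord hc
        simp only [List.length_nil] at this
        omega
      · obtain ⟨⟨ε, h⟩, hd⟩ := isGeodesicWord_append_singleton.1 hc
        have h' := depth_node_mul_back ⟨ε, h⟩
        rw [bar_bar] at h
        refine ⟨ε, s, h, ?_⟩
        rw [← node_mul_bar h, IH _ (by omega) _ rfl]
        refine ⟨d, hd, ?_⟩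
        rw [List.take_append_of_le_length (by rw [length_of_isGeodesicWord hd]; omega)]
    · rintro ⟨ε, a, h, hp⟩
      have hb : IsBack (node x) (bar a) := ⟨ε, by rwa [bar_bar]⟩
      have h' := depth_node_mul_back hb
      rw [← node_mul_bar h, IH _ (by omega) _ rfl] at hp
      obtain ⟨d, hd, rfl⟩ := hp
      refine ⟨d ++ [a], isGeodesicWord_append_singleton.2 ⟨hb, hd⟩, ?_⟩
      rw [List.take_append_of_le_length (by rw [length_of_isGeodesicWord hd]; omega)]
  rw [key]
  cases hx' : node x with
  | root => rw [hx'] at hi; exact absurd (Nat.zero_le _) hi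
  | one v s =>
    rw [hx', depth] at hi
    rw [pts_one_of_le (by omega)]
    exact ⟨fun h => ⟨true, s, rfl, h⟩, fun ⟨_, _, _, h⟩ => h⟩
  | two v s w t =>
    rw [hx', depth] at hi
    have : i ≤ depth v := by omega
    constructor
    · intro h
      simp only [pts, this, if_true] at h
      rcases h with h | h
      · exact ⟨true, s, rfl, h⟩
      · exact ⟨false, t, rfl, h⟩
    · rintro ⟨ε, _, _, h⟩
      simp only [pts, this, if_true]
      cases ε
      · exact Or.inr h
      · exact Or.inl h

theorem modifiedTypeOrStar_essentialPoint (x : SurfaceGroup g) (i : ℕ) :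
    modifiedTypeOrStar (essentialPoint x i) = entry (node x) i := by
  have key : ∀ u, (∀ c, IsGeodesicWord c x → wordVal (c.take i) = u) ↔
      pts (node x) i = {node u} := by
    intro u
    constructor
    · intro h
      ext p
      rw [mem_pts_iff _ x rfl, Set.mem_singleton_iff]
      constructor
      · rintro ⟨c, hc, rfl⟩
        rw [h c hc]
      · rintro rfl
        obtain ⟨c, hc⟩ := exists_isGeodesicWord x
        exact ⟨c, hc, by rw [h c hc]⟩
    · intro h c hc
      have h1 : node (wordVal (c.take i)) ∈ pts (node x) i :=
        (mem_pts_iff _ x rfl i _).2 ⟨c, hc, rfl⟩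
      rw [h] at h1
      exact node_injective h1
  rw [essentialPoint]
  split_ifs with h
  · rw [modifiedTypeOrStar, modifiedType_eq, entry_of_pts ((key _).1 h.choose_spec)]
  · rw [modifiedTypeOrStar, entry, dif_neg]
    rintro ⟨u, hu⟩
    have h1 : u ∈ pts (node x) i := by rw [hu]; rfl
    obtain ⟨c, -, rfl⟩ := (mem_pts_iff _ x rfl i u).1 h1
    exact h ⟨_, (key _).2 hu⟩

theorem essentialType_eq (x : SurfaceGroup g) : essentialType x = ess (node x) := by
  rw [essentialType, ess, tailEntries, surfaceLength_eq_depth]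
  exact List.map_congr_left fun i _ => modifiedTypeOrStar_essentialPoint x i

/-- The essential type starts with the modified type. -/
theorem essentialType_eq_cons (x : SurfaceGroup g) :
    ∃ M, essentialType x = modifiedType x :: M :=
  ⟨_, by rw [essentialType_eq, modifiedType_eq, ess_eq]⟩

/-- The essential type of a successor of a point with essential type `L`, without its first entry
`τ`. -/
def Continues (g : ℕ) (τ : TypeSymbol) (L M : List TypeSymbol) : Prop :=
  (τ ≠ .cannon (2 * g) ∧ M = L) ∨ (τ = .cannon (2 * g) ∧ Starred g L M)

theorem essentialType_successor {x y : SurfaceGroup g} (hy : y ∈ successors (surfaceGens g) x) :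
    ∃ M, essentialType y = modifiedType y :: M ∧ Continues g (modifiedType y) (essentialType x) M := by
  obtain ⟨s, hs, rfl⟩ := mem_successors_iff.1 hy
  rw [essentialType_eq, essentialType_eq, modifiedType_eq, node_mul_push hs]
  have hl := level_node x
  rcases push_cases hl s with ⟨ε, w, t, hf, hp, -⟩ | ⟨hf, hp⟩
  · obtain ⟨M, h1, h2⟩ := ess_push_of_full _ _ s ε hl hf
    have h3 : mtype (push (node x) s) = .cannon (2 * g) := by rw [hp, mtype_mkTwo]
    exact ⟨M, by rw [h1, h3], Or.inr ⟨h3, h2⟩⟩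
  · refine ⟨ess (node x), by rw [hp, ess_one], Or.inl ⟨?_, rfl⟩⟩
    intro h
    have hl' := Level.step hl hs
    rw [hp] at h hl'
    rcases mtype_cases (one (node x) s) with ⟨-, -, h'⟩ | ⟨-, -, h'⟩ | ⟨-, -, h'⟩
    · rw [h] at h'; cases h'
    · rw [h] at h'; cases h'
    · rw [h] at h'
      injection h' with h'
      have h1 := hl'.good.run_lt true
      have h2 := hl'.good.run_lt false
      rw [ctype] at h'
      omega

end SurfaceTiling

namespace SurfaceTiling

variable {g : ℕ}

open Node Vertex

/-! ### Truncated essential types -/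

/-- The passage to the top of a polygon is causal: the first `k` entries of the result depend only
on the first `k` entries. -/
theorem Node.Starred.take_eq (hg : 2 ≤ g) {L M : List TypeSymbol} (h : Starred g L M) :
    ∀ {L' M' : List TypeSymbol} {k : ℕ}, Starred g L' M' → L.take k = L'.take k →
      M.take k = M'.take k := by
  have hrep : ∀ {A B : List TypeSymbol} {k : ℕ}, k ≤ 2 * g - 1 →
      (List.replicate (2 * g - 1) TypeSymbol.star ++ A).take k =
        (List.replicate (2 * g - 1) TypeSymbol.star ++ B).take k := by
    intro A B k hk
    rw [List.take_append_of_le_length (by simpa using hk),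
      List.take_append_of_le_length (by simpa using hk)]
  have happ : ∀ {A B : List TypeSymbol} {k : ℕ}, A.take (k - (2 * g - 1)) = B.take (k - (2 * g - 1)) →
      (List.replicate (2 * g - 1) TypeSymbol.star ++ A).take k =
        (List.replicate (2 * g - 1) TypeSymbol.star ++ B).take k := by
    intro A B k hk
    simp only [List.take_append, List.length_replicate, hk]
  have hget : ∀ {L L' : List TypeSymbol} {k : ℕ}, ¬ k ≤ 2 * g - 1 → L.take k = L'.take k →
      L[2 * g - 3]? = L'[2 * g - 3]? := by
    intro L L' k hk h
    have := congrArg (fun l => l[2 * g - 3]?) h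
    simpa [List.getElem?_take, show 2 * g - 3 < k by omega] using this
  have hdrop : ∀ {L L' : List TypeSymbol} {k : ℕ}, L.take k = L'.take k →
      (L.drop (2 * g - 1)).take (k - (2 * g - 1)) =
        (L'.drop (2 * g - 1)).take (k - (2 * g - 1)) := by
    intro L L' k h
    rw [← List.drop_take, ← List.drop_take, h]
  induction h with
  | last hl hn =>
    intro L' M' k h' e
    by_cases hk : k ≤ 2 * g - 1
    · cases h' <;> exact hrep hk
    · cases h' with
      | last hl' hn' => exact happ (hdrop e)
      | next hl' hn' _ => exact absurd ((hget hk e).trans hn') hn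
  | next hl hn hS ih =>
    intro L' M' k h' e
    by_cases hk : k ≤ 2 * g - 1
    · cases h' <;> exact hrep hk
    · cases h' with
      | last hl' hn' => exact absurd ((hget hk e).symm.trans hn) hn'
      | next hl' hn' hS' => exact happ (ih hS' (hdrop e))

/-- The passage to the top of a polygon only replaces entries by `*`. -/
theorem Node.Starred.forall₂ {L M : List TypeSymbol} (h : Starred g L M) :
    List.Forall₂ (fun a b => b = a ∨ b = .star) L M := by
  have hrep : ∀ (n : ℕ) (L M : List TypeSymbol), n ≤ L.length →
      List.Forall₂ (fun a b => b = a ∨ b = TypeSymbol.star) (L.drop n) M →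
      List.Forall₂ (fun a b => b = a ∨ b = TypeSymbol.star) L
        (List.replicate n .star ++ M) := by
    intro n
    induction n with
    | zero => exact fun L M _ h => h
    | succ n ih =>
      rintro (_ | ⟨a, L⟩) M hn h
      · simp at hn
      · exact List.Forall₂.cons (Or.inr rfl) (ih L M (by simpa using hn) h)
  induction h with
  | last hl _ => exact hrep _ _ _ hl (List.forall₂_same.2 fun a _ => Or.inl rfl)
  | next hl _ _ ih => exact hrep _ _ _ hl ih

theorem Continues.take_eq (hg : 2 ≤ g) {τ : TypeSymbol} {L M L' M' : List TypeSymbol} {k : ℕ}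
    (h : Continues g τ L M) (h' : Continues g τ L' M') (e : L.take k = L'.take k) :
    M.take k = M'.take k := by
  rcases h with ⟨h1, rfl⟩ | ⟨h1, h2⟩
  · rcases h' with ⟨-, rfl⟩ | ⟨h3, -⟩
    · exact e
    · exact absurd h3 h1
  · rcases h' with ⟨h3, -⟩ | ⟨-, h3⟩
    · exact absurd h1 h3
    · exact h2.take_eq hg h3 e

theorem Continues.forall₂ {τ : TypeSymbol} {L M : List TypeSymbol} (h : Continues g τ L M) :
    List.Forall₂ (fun a b => b = a ∨ b = .star) L M := by
  rcases h with ⟨-, rfl⟩ | ⟨-, h⟩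
  · exact List.forall₂_same.2 fun a _ => Or.inl rfl
  · exact h.forall₂

theorem Continues.eq (hg : 2 ≤ g) {τ : TypeSymbol} {L M M' : List TypeSymbol}
    (h : Continues g τ L M) (h' : Continues g τ L M') : M = M' := by
  have := h.take_eq hg h' (k := max M.length M'.length) rfl
  rwa [List.take_of_length_le (le_max_left _ _), List.take_of_length_le (le_max_right _ _)] at this

theorem weightTruncate_prefix (w : TypeSymbol → ℝ) (k : ℝ) (L : List TypeSymbol) :
    weightTruncate w k L <+: L := by
  induction L generalizing k with
  | nil => exact List.nil_prefix
  | cons a L ih =>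
    rw [weightTruncate]
    split_ifs
    · exact ⟨L, rfl⟩
    · exact (List.prefix_cons_inj a).2 (ih _)

theorem weightTruncate_eq_or (w : TypeSymbol → ℝ) (k : ℝ) (L : List TypeSymbol) :
    weightTruncate w k L = L ∨ k < ((weightTruncate w k L).map w).sum := by
  induction L generalizing k with
  | nil => exact Or.inl rfl
  | cons a L ih =>
    rw [weightTruncate]
    split_ifs with h
    · right; simpa using h
    · rcases ih (k - w a) with h1 | h1
      · left; rw [h1]
      · right
        rw [List.map_cons, List.sum_cons]
        linarith

theorem weightTruncate_take (w : TypeSymbol → ℝ) (L : List TypeSymbol) :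
    ∀ {k : ℝ} {m : ℕ}, 0 < m → k < ((L.take m).map w).sum →
      weightTruncate w k L = weightTruncate w k (L.take m) := by
  induction L with
  | nil => intro k m _ _; rw [List.take_nil]
  | cons a L ih =>
    intro k m hm h
    obtain ⟨m, rfl⟩ : ∃ n, m = n + 1 := ⟨m - 1, by omega⟩
    rw [List.take_succ_cons, List.map_cons, List.sum_cons] at h
    rw [List.take_succ_cons, weightTruncate, weightTruncate]
    split_ifs with hk
    · rfl
    · obtain _ | m := m
      · simp only [List.take_zero, List.map_nil, List.sum_nil, add_zero] at h
        exact absurd h hk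
      · rw [ih (Nat.succ_pos m) (by linarith)]

theorem weightTruncate_length_le (w : TypeSymbol → ℝ) {δ : ℝ} (hδ : 0 < δ) (N : ℕ) :
    ∀ (k : ℝ) (L : List TypeSymbol), k ≤ N * δ → (∀ a ∈ L.dropLast, δ ≤ w a) →
      (weightTruncate w k L).length ≤ N + 2 := by
  induction N with
  | zero =>
    rintro k (_ | ⟨a, _ | ⟨b, L⟩⟩) hk h
    · simp [weightTruncate]
    · exact (weightTruncate_prefix w k [a]).length_le.trans (by simp)
    · have := h a (by simp)
      rw [Nat.cast_zero, zero_mul] at hk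
      rw [weightTruncate, if_pos (by linarith)]
      simp
  | succ N ih =>
    rintro k (_ | ⟨a, _ | ⟨b, L⟩⟩) hk h
    · simp [weightTruncate]
    · exact (weightTruncate_prefix w k [a]).length_le.trans (by simp)
    · have h1 := h a (by simp)
      rw [weightTruncate]
      split_ifs
      · simp
      · have h2 := ih (k - w a) (b :: L) (by push_cast at hk; linarith)
          (fun c hc => h c (by rw [List.dropLast_cons_of_ne_nil (by simp)];
                               exact List.mem_cons_of_mem _ hc))
        rw [List.length_cons]
        omega

section

variable [hg : Fact (2 ≤ g)]

theorem modifiedType_mem (x : SurfaceGroup g) : modifiedType x ∈ typeAlphabet g := by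
  rw [modifiedType_eq]
  rcases mtype_cases (node x) with ⟨-, -, h⟩ | ⟨-, -, h⟩ | ⟨-, -, h⟩
  · rw [h]; exact Or.inr (Or.inl rfl)
  · rw [h]; exact Or.inr (Or.inr (Or.inl rfl))
  · rw [h]; exact Or.inl ⟨_, ctype_le (level_node x), rfl⟩

theorem essentialType_mem (x : SurfaceGroup g) : ∀ a ∈ essentialType x, a ∈ typeAlphabet g := by
  intro a ha
  obtain ⟨i, -, rfl⟩ := List.mem_map.1 ha
  cases essentialPoint x i with
  | none => exact Or.inr (Or.inr (Or.inr rfl))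
  | some u => exact modifiedType_mem u

omit hg in
theorem finite_typeAlphabet : (typeAlphabet g).Finite := by
  have : typeAlphabet g ⊆ TypeSymbol.cannon '' Set.Iic (2 * g) ∪
      {.onePrime, .twoPrime, .star} := by
    rintro a (⟨i, hi, rfl⟩ | rfl | rfl | rfl)
    · exact Or.inl ⟨i, hi, rfl⟩
    all_goals simp
  exact (((Set.finite_Iic _).image _).union (by simp)).subset this

omit hg in
theorem finite_lists {α : Type*} {S : Set α} (hS : S.Finite) (n : ℕ) :
    {l : List α | (∀ a ∈ l, a ∈ S) ∧ l.length ≤ n}.Finite := by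
  have : Finite S := hS
  refine ((List.finite_length_le S n).image (List.map (↑))).subset ?_
  rintro l ⟨h1, h2⟩
  lift l to List S using h1
  exact ⟨l, by simpa using h2, rfl⟩

/-- Only the last entry of an essential type is the type `0` of the identity. -/
theorem essentialType_dropLast (x : SurfaceGroup g) :
    ∀ a ∈ (essentialType x).dropLast, a ≠ .cannon 0 := by
  intro a ha
  rw [essentialType, List.range_succ_eq_map, List.reverse_cons, List.map_append,
    List.map_singleton, List.dropLast_concat, List.mem_map] at ha
  obtain ⟨i, hi, rfl⟩ := ha
  rw [List.mem_reverse, List.mem_map] at hi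
  obtain ⟨i, hi, rfl⟩ := hi
  rw [List.mem_range] at hi
  intro h
  rw [essentialPoint] at h
  split_ifs at h with hu
  · rw [modifiedTypeOrStar, modifiedType_eq, mtype_eq_zero_iff, node_eq_root_iff] at h
    obtain ⟨c, hc⟩ := exists_isGeodesicWord x
    have h1 : wordVal (c.take (i + 1)) = 1 := (hu.choose_spec c hc).trans h
    have h2 : wordVal (c.drop (i + 1)) = x := by
      rw [← hc.1]
      conv_rhs => rw [← List.take_append_drop (i + 1) c]
      rw [wordVal_append]
      rw [h1]
      rw [one_mul]
    have h3 := depth_wordVal_le (c.drop (i + 1))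
    rw [h2, List.length_drop, hc.2, ← surfaceLength_eq_depth] at h3
    omega
  · cases h

theorem determines_essentialType :
    DeterminesSuccessors (essentialType (g := g)) (essentialType (g := g)) := by
  apply determinesSuccessors_of
  · intro x x' h
    obtain ⟨M, hM⟩ := essentialType_eq_cons x
    obtain ⟨M', hM'⟩ := essentialType_eq_cons x'
    rw [hM, hM'] at h
    injection h
  · intro x x' h y hy y' hy' hyy
    obtain ⟨M, h1, h2⟩ := essentialType_successor hy
    obtain ⟨M', h1', h2'⟩ := essentialType_successor hy'
    rw [← h, ← hyy] at h2'
    rw [h1, h1', hyy, h2.eq hg.out h2']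

theorem modifiedType_eq_of_take {k : ℕ} (hk : 0 < k) {x x' : SurfaceGroup g}
    (h : essentialTypeLen k x = essentialTypeLen k x') : modifiedType x = modifiedType x' := by
  obtain ⟨M, hM⟩ := essentialType_eq_cons x
  obtain ⟨M', hM'⟩ := essentialType_eq_cons x'
  obtain ⟨k, rfl⟩ : ∃ j, k = j + 1 := ⟨k - 1, by omega⟩
  rw [essentialTypeLen, essentialTypeLen, hM, hM', List.take_succ_cons, List.take_succ_cons] at h
  injection h

theorem essentialTypeLen_successor {k : ℕ} {x x' : SurfaceGroup g}
    (h : essentialTypeLen k x = essentialTypeLen k x') {y y' : SurfaceGroup g}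
    (hy : y ∈ successors (surfaceGens g) x) (hy' : y' ∈ successors (surfaceGens g) x')
    (hyy : modifiedType y = modifiedType y') :
    essentialTypeLen (k + 1) y = essentialTypeLen (k + 1) y' := by
  obtain ⟨M, h1, h2⟩ := essentialType_successor hy
  obtain ⟨M', h1', h2'⟩ := essentialType_successor hy'
  rw [← hyy] at h2'
  rw [essentialTypeLen, essentialTypeLen, h1, h1', hyy, List.take_succ_cons, List.take_succ_cons,
    h2.take_eq hg.out h2' h]

omit hg in
theorem essentialTypeLen_of_le {j k : ℕ} (hjk : j ≤ k) {x x' : SurfaceGroup g}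
    (h : essentialTypeLen k x = essentialTypeLen k x') :
    essentialTypeLen j x = essentialTypeLen j x' := by
  have := congrArg (List.take j) h
  rwa [essentialTypeLen, essentialTypeLen, List.take_take, List.take_take, min_eq_left hjk] at this

theorem determines_essentialTypeLen_succ {k : ℕ} (hk : 0 < k) :
    DeterminesSuccessors (essentialTypeLen (g := g) k) (essentialTypeLen (g := g) (k + 1)) :=
  determinesSuccessors_of (fun _ _ h => modifiedType_eq_of_take hk h)
    fun _ _ h _ hy _ hy' hyy => essentialTypeLen_successor h hy hy' hyy

theorem determines_essentialTypeLen {k : ℕ} (hk : 0 < k) :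
    DeterminesSuccessors (essentialTypeLen (g := g) k) (essentialTypeLen (g := g) k) :=
  determinesSuccessors_of (fun _ _ h => modifiedType_eq_of_take hk h)
    fun _ _ h _ hy _ hy' hyy =>
      essentialTypeLen_of_le k.le_succ (essentialTypeLen_successor h hy hy' hyy)

/-- Truncations by weights that agree come from equal sequences, or from a common prefix whose
weight exceeds the threshold. -/
theorem weightTruncate_eq_cases {w : TypeSymbol → ℝ} {k : ℝ} {a b : TypeSymbol}
    {L L' : List TypeSymbol}
    (h : weightTruncate w k (a :: L) = weightTruncate w k (b :: L')) :
    a :: L = b :: L' ∨ ∃ m, 0 < m ∧ (a :: L).take m = (b :: L').take m ∧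
      k < (((a :: L).take m).map w).sum := by
  have hp := List.prefix_iff_eq_take.1 (weightTruncate_prefix w k (a :: L))
  have hp' := List.prefix_iff_eq_take.1 (weightTruncate_prefix w k (b :: L'))
  have hpos : 0 < (weightTruncate w k (a :: L)).length := by
    rw [weightTruncate]
    split_ifs <;> simp
  have key : k < ((weightTruncate w k (a :: L)).map w).sum →
      ∃ m, 0 < m ∧ (a :: L).take m = (b :: L').take m ∧
        k < (((a :: L).take m).map w).sum := by
    intro hk
    refine ⟨_, hpos, ?_, by rwa [← hp]⟩
    rw [← hp, h, ← hp']
  rcases weightTruncate_eq_or w k (a :: L) with h1 | h1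
  · rcases weightTruncate_eq_or w k (b :: L') with h2 | h2
    · left; rw [← h1, h, h2]
    · rw [← h] at h2
      exact Or.inr (key h2)
  · exact Or.inr (key h1)

theorem determines_essentialTypeWeight {w : TypeSymbol → ℝ} {k : ℝ}
    (hw : ∀ a ∈ typeAlphabet g, 0 ≤ w a ∧ w a ≤ w TypeSymbol.star) :
    DeterminesSuccessors (essentialTypeWeight (g := g) w k)
      (essentialTypeWeight (g := g) w k) := by
  have key : ∀ x x' : SurfaceGroup g, essentialTypeWeight w k x = essentialTypeWeight w k x' →
      essentialType x = essentialType x' ∨ ∃ m, 0 < m ∧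
        (essentialType x).take m = (essentialType x').take m ∧
        k < (((essentialType x).take m).map w).sum := by
    intro x x' h
    obtain ⟨M, hM⟩ := essentialType_eq_cons x
    obtain ⟨M', hM'⟩ := essentialType_eq_cons x'
    rw [essentialTypeWeight, essentialTypeWeight, hM, hM'] at h
    rw [hM, hM']
    exact weightTruncate_eq_cases h
  apply determinesSuccessors_of
  · intro x x' h
    rcases key x x' h with h | ⟨m, hm, h, -⟩
    · exact modifiedType_eq_of_take one_pos (by rw [essentialTypeLen, h]; rfl)
    · exact modifiedType_eq_of_take hm h
  · intro x x' h y hy y' hy' hyy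
    rcases key x x' h with h | ⟨m, hm, h, hk⟩
    · rw [essentialTypeWeight, essentialTypeWeight,
        (determines_essentialType x x' h).2 y hy y' hy' hyy]
    · obtain ⟨M, h1, h2⟩ := essentialType_successor hy
      have h3 : essentialTypeLen (m + 1) y = essentialTypeLen (m + 1) y' :=
        essentialTypeLen_successor h hy hy' hyy
      -- passing to a successor can only turn entries into `*`, which increases the weight
      have h4 : ∀ {m : ℕ} {L M : List TypeSymbol},
          List.Forall₂ (fun a b => b = a ∨ b = TypeSymbol.star) L M →
          (∀ a ∈ L, a ∈ typeAlphabet g) →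
          ((L.take m).map w).sum ≤ ((M.take m).map w).sum := by
        intro m L M h hL
        induction h generalizing m with
        | nil => exact le_rfl
        | @cons a b L M hab _ ih =>
          obtain _ | m := m
          · exact le_rfl
          · rw [List.take_succ_cons, List.take_succ_cons, List.map_cons, List.map_cons,
              List.sum_cons, List.sum_cons]
            refine add_le_add ?_ (ih fun c hc => hL c (List.mem_cons_of_mem _ hc))
            rcases hab with rfl | rfl
            · exact le_rfl
            · exact (hw a (hL a List.mem_cons_self)).2
      have h5 := h4 (m := m) h2.forall₂ (essentialType_mem x)
      have h6 : k < (((essentialType y).take (m + 1)).map w).sum := by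
        rw [h1, List.take_succ_cons, List.map_cons, List.sum_cons]
        have := (hw _ (modifiedType_mem y)).1
        linarith
      have h7 : k < (((essentialType y').take (m + 1)).map w).sum := by
        rw [essentialTypeLen, essentialTypeLen] at h3
        rwa [← h3]
      rw [essentialTypeWeight, essentialTypeWeight, weightTruncate_take w _ m.succ_pos h6,
        weightTruncate_take w _ m.succ_pos h7]
      exact congrArg _ h3

/-! ### Perron-Frobenius type systems -/

/-- `Path m x y` says that `y` is reached from `x` by passing `m` times to a successor. -/
inductive Path : ℕ → SurfaceGroup g → SurfaceGroup g → Prop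
  | nil (x : SurfaceGroup g) : Path 0 x x
  | snoc {m : ℕ} {x y z : SurfaceGroup g} : Path m x y → z ∈ successors (surfaceGens g) y →
      Path (m + 1) x z

omit hg in
theorem Path.trans {k m : ℕ} {x y z : SurfaceGroup g} (h : Path k x y) (h' : Path m y z) :
    Path (k + m) x z := by
  induction h' with
  | nil => exact h
  | snoc _ hz ih => exact (ih h).snoc hz

/-- A path can be copied from any point of the same modified type as its starting point; the copy
passes through points with the same modified types, and this fixes the essential type back to the
start. -/
theorem Path.lift {m : ℕ} {x z : SurfaceGroup g} (h : Path m x z) {v : SurfaceGroup g}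
    (hv : modifiedType x = modifiedType v) :
    ∃ z', Path m v z' ∧ essentialTypeLen (m + 1) z = essentialTypeLen (m + 1) z' := by
  induction h with
  | nil x =>
    refine ⟨v, .nil v, ?_⟩
    obtain ⟨M, hM⟩ := essentialType_eq_cons x
    obtain ⟨M', hM'⟩ := essentialType_eq_cons v
    rw [essentialTypeLen, essentialTypeLen, hM, hM', hv]
    rfl
  | @snoc m x y z _ hz ih =>
    obtain ⟨y', h1, h2⟩ := ih hv
    obtain ⟨z', h3, h4⟩ := exists_successor_of_modifiedType_eq
      (modifiedType_eq_of_take m.succ_pos h2) hz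
    exact ⟨z', h1.snoc h3, essentialTypeLen_successor h2 hz h3 h4.symm⟩

theorem exists_path_type_one (m : ℕ) (x : SurfaceGroup g) :
    ∃ v, Path (m + 1) x v ∧ modifiedType v = .cannon 1 := by
  induction m with
  | zero =>
    obtain ⟨y, hy, h⟩ := exists_successor_type_one x
    exact ⟨y, (Path.nil x).snoc hy, h⟩
  | succ m ih =>
    obtain ⟨v, hv, -⟩ := ih
    obtain ⟨y, hy, h⟩ := exists_successor_type_one v
    exact ⟨y, hv.snoc hy, h⟩

theorem exists_path_from_type_one : ∀ (n : ℕ) (z : SurfaceGroup g), surfaceLength z = n + 1 →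
    ∃ x, modifiedType x = .cannon 1 ∧ Path n x z := by
  intro n
  induction n with
  | zero =>
    intro z hz
    refine ⟨z, ?_, .nil z⟩
    obtain ⟨c, hc⟩ := exists_isGeodesicWord z
    obtain ⟨s, rfl⟩ := List.length_eq_one_iff.1 (hc.2.trans hz)
    have h1 := (look_node_eq_some (x := (1 : SurfaceGroup g)) (s := s) (τ := .cannon 1)).1
      (by rw [node_one, look_root])
    rw [← hc.1, ← h1.2, one_mul]
  | succ n ih =>
    intro z hz
    rw [surfaceLength_eq_depth] at hz
    have hne : node z ≠ root := by
      intro h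
      rw [h] at hz
      simp [depth] at hz
    obtain ⟨a, ha⟩ := exists_lt_of_ne_root hne true
    obtain ⟨k, -, -, hb, -⟩ := (level_node z).good.par_level true a ha
    have h1 := depth_node_mul_back (x := z) (s := bar a) ⟨true, by rwa [bar_bar]⟩
    rw [← node_mul_bar ha] at hb
    obtain ⟨x, hx, hp⟩ := ih (z * wordVal [bar a]) (by rw [surfaceLength_eq_depth]; omega)
    refine ⟨x, hx, hp.snoc (mem_successors_iff.2 ⟨a, hb, ?_⟩)⟩
    rw [wordVal_bar, inv_mul_cancel_right]

/-- Every initial part of an essential type is found above every point, at every sufficiently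
large distance: first follow points of type `1`, then copy a geodesic to `z`. -/
theorem exists_path_essentialTypeLen {n N : ℕ} {z : SurfaceGroup g} (hz : surfaceLength z = n)
    (hn : 0 < n) (hN : n ≤ N) (x : SurfaceGroup g) :
    ∃ z', Path N x z' ∧ essentialTypeLen n z = essentialTypeLen n z' := by
  obtain ⟨n, rfl⟩ : ∃ j, n = j + 1 := ⟨n - 1, by omega⟩
  obtain ⟨x₁, h1, h2⟩ := exists_path_from_type_one n z hz
  obtain ⟨v, h3, h4⟩ := exists_path_type_one (N - (n + 1)) x
  obtain ⟨z', h5, h6⟩ := h2.lift (h1.trans h4.symm)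
  refine ⟨z', ?_, h6⟩
  have := h3.trans h5
  rwa [show N - (n + 1) + 1 + n = N by omega] at this

theorem finite_ball (m : ℕ) : {x : SurfaceGroup g | surfaceLength x < m}.Finite := by
  refine ((List.finite_length_le (SurfaceLetter g) m).image wordVal).subset ?_
  intro x hx
  obtain ⟨c, hc⟩ := exists_isGeodesicWord x
  refine ⟨c, ?_, hc.1⟩
  have := hc.2
  simp only [Set.mem_ofPred_eq] at hx ⊢
  omega

omit hg in
theorem surfaceLength_successor {x y : SurfaceGroup g} (hy : y ∈ successors (surfaceGens g) x) :
    surfaceLength y = surfaceLength x + 1 := hy.2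

theorem exists_surfaceLength_eq (m : ℕ) : ∃ x : SurfaceGroup g, surfaceLength x = m := by
  induction m with
  | zero =>
    exact ⟨1, by rw [surfaceLength_eq_depth, node_one]; rfl⟩
  | succ m ih =>
    obtain ⟨x, rfl⟩ := ih
    obtain ⟨y, hy, -⟩ := exists_successor_type_one x
    exact ⟨y, surfaceLength_successor hy⟩

omit hg in
/-- The number of paths between two types is positive if there is a path. -/
theorem pow_pos_of_path {T : Type*} [Fintype T] [DecidableEq T] {M : Matrix T T ℝ}
    {t : SurfaceGroup g → T} {L : ℕ} (h0 : ∀ i j, 0 ≤ M i j)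
    (h1 : ∀ x y, L ≤ surfaceLength x → y ∈ successors (surfaceGens g) x → 0 < M (t y) (t x))
    {m : ℕ} {x z : SurfaceGroup g} (h : Path m x z) (hx : L ≤ surfaceLength x) :
    0 < (M ^ m) (t z) (t x) ∧ L ≤ surfaceLength z := by
  have hnn : ∀ (k : ℕ) (i j : T), 0 ≤ (M ^ k) i j := by
    intro k
    induction k with
    | zero =>
      intro i j
      rw [pow_zero, Matrix.one_apply]
      split_ifs <;> norm_num
    | succ k ih =>
      intro i j
      rw [pow_succ', Matrix.mul_apply]
      exact Finset.sum_nonneg fun l _ => mul_nonneg (h0 _ _) (ih _ _)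
  induction h with
  | nil x => simp [hx]
  | @snoc m x y z _ hz ih =>
    obtain ⟨h2, h3⟩ := ih hx
    refine ⟨?_, by rw [surfaceLength_successor hz]; omega⟩
    rw [pow_succ', Matrix.mul_apply]
    exact Finset.sum_pos' (fun k _ => mul_nonneg (h0 _ _) (hnn m _ _))
      ⟨t y, Finset.mem_univ _, mul_pos (h1 y z h3 hz) h2⟩

/-- A function of the truncated essential type that takes finitely many values and determines
itself on successors is a Perron-Frobenius type system. -/
theorem formsPerronFrobeniusTypeSystem_of {A : Type*} {f : SurfaceGroup g → A}
    {φ : List TypeSymbol → A} {K : ℕ} (hf : ∀ x, f x = φ (essentialTypeLen K x))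
    (hfin : (Set.range f).Finite) (hdet : DeterminesSuccessors f f) :
    FormsPerronFrobeniusTypeSystem (surfaceGens g) f := by
  classical
  have hT : {a | {x | f x = a}.Infinite}.Finite := by
    refine hfin.subset fun a ha => ?_
    obtain ⟨x, hx⟩ := ha.nonempty
    exact ⟨x, hx⟩
  -- beyond distance `L₀`, only values that are attained infinitely often occur
  obtain ⟨L₀, hL₀⟩ : ∃ L₀, ∀ x : SurfaceGroup g, L₀ ≤ surfaceLength x → f x ∈ hT.toFinset := by
    have hB : {x | ¬ {z | f z = f x}.Infinite}.Finite := by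
      have h1 : {x | ¬ {z | f z = f x}.Infinite} ⊆
          ⋃ a ∈ Set.range f ∩ {a | ¬ {z | f z = a}.Infinite}, {z | f z = a} := by
        intro x hx
        simp only [Set.mem_iUnion]
        exact ⟨f x, ⟨⟨x, rfl⟩, hx⟩, rfl⟩
      refine Set.Finite.subset (Set.Finite.biUnion (hfin.inter_of_left _) ?_) h1
      rintro a ⟨-, ha⟩
      exact Set.not_infinite.1 ha
    obtain ⟨m, hm⟩ := (hB.image surfaceLength).bddAbove
    refine ⟨m + 1, fun x hx => ?_⟩
    rw [Set.Finite.mem_toFinset]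
    by_contra hx'
    have := hm ⟨x, hx', rfl⟩
    omega
  have hlong : ∀ (j : hT.toFinset) (m : ℕ), ∃ x, f x = j ∧ m ≤ surfaceLength x := by
    intro j m
    have hj : {x | f x = (j : A)}.Infinite := (Set.Finite.mem_toFinset hT).1 j.2
    obtain ⟨x, h1, h2⟩ := hj.exists_notMem_finite (finite_ball m)
    exact ⟨x, h1, not_lt.1 h2⟩
  obtain ⟨x₀, hx₀⟩ := exists_surfaceLength_eq (g := g) L₀
  set t : SurfaceGroup g → hT.toFinset := fun x =>
    if h : f x ∈ hT.toFinset then ⟨f x, h⟩ else ⟨f x₀, hL₀ x₀ hx₀.ge⟩ with ht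
  have htf : ∀ x, L₀ ≤ surfaceLength x → (t x : A) = f x := by
    intro x hx
    simp only [ht, dif_pos (hL₀ x hx)]
  choose p hp1 hp2 using fun j => hlong j L₀
  set M : Matrix hT.toFinset hT.toFinset ℝ := fun i j =>
    (({y | y ∈ successors (surfaceGens g) (p j) ∧ t y = i}.ncard : ℕ) : ℝ) with hM
  have hcount : ∀ x, L₀ ≤ surfaceLength x → ∀ i,
      (({y | y ∈ successors (surfaceGens g) x ∧ t y = i}.ncard : ℕ) : ℝ) = M i (t x) := by
    intro x hx i
    have h1 : ∀ z, L₀ ≤ surfaceLength z → {y | y ∈ successors (surfaceGens g) z ∧ t y = i} =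
        {y | y ∈ successors (surfaceGens g) z ∧ f y = i} := by
      intro z hz
      ext y
      refine and_congr_right fun hy => ?_
      rw [← htf y (by rw [surfaceLength_successor hy]; omega), Subtype.ext_iff]
    have h2 : f x = f (p (t x)) := by rw [hp1, htf x hx]
    simp only [hM]
    rw [h1 x hx, h1 _ (hp2 _), (hdet x (p (t x)) h2).1 i]
  have hM0 : ∀ i j, 0 ≤ M i j := fun i j => Nat.cast_nonneg _
  have hMpos : ∀ x y, L₀ ≤ surfaceLength x → y ∈ successors (surfaceGens g) x →
      0 < M (t y) (t x) := by
    intro x y hx hy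
    have hfinS : {z | z ∈ successors (surfaceGens g) x ∧ t z = t y}.Finite := by
      refine (finite_ball (surfaceLength x + 2)).subset ?_
      rintro z ⟨hz, -⟩
      have := surfaceLength_successor hz
      simp only [Set.mem_ofPred_eq]
      omega
    rw [← hcount x hx, Nat.cast_pos, Set.ncard_pos hfinS]
    exact ⟨y, hy, rfl⟩
  refine ⟨hT.toFinset, t, M, fun a => Set.Finite.mem_toFinset hT, ?_, ?_, hM0, ?_⟩
  · refine (finite_ball L₀).subset fun x hx => ?_
    by_contra h
    exact hx (htf x (not_lt.1 h))
  · intro i j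
    refine (finite_ball L₀).subset ?_
    rintro x ⟨rfl, hx⟩
    by_contra h
    exact hx (hcount x (not_lt.1 h) i)
  · choose q hq1 hq2 using fun j => hlong j (max (K + 1) L₀)
    -- a power that works for all target types at once
    refine ⟨∑ i, surfaceLength (q i) + 1, Nat.succ_pos _, fun i j => ?_⟩
    have h1 : surfaceLength (q i) ≤ ∑ i, surfaceLength (q i) :=
      Finset.single_le_sum (f := fun i => surfaceLength (q i)) (fun _ _ => Nat.zero_le _)
        (Finset.mem_univ i)
    have h2 := hq2 i
    obtain ⟨z, h3, h4⟩ := exists_path_essentialTypeLen (n := surfaceLength (q i))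
      (N := ∑ i, surfaceLength (q i) + 1) rfl (by omega) (by omega) (p j)
    obtain ⟨h5, h6⟩ := pow_pos_of_path hM0 hMpos h3 (hp2 j)
    have h7 : t z = i := by
      apply Subtype.ext
      rw [htf z h6, ← hq1 i, hf, hf, essentialTypeLen_of_le (by omega) h4]
    have h8 : t (p j) = j := by
      apply Subtype.ext
      rw [htf _ (hp2 j), hp1]
    rwa [h7, h8] at h5

theorem formsPerronFrobeniusTypeSystem_essentialTypeLen {k : ℕ} (hk : 0 < k) :
    FormsPerronFrobeniusTypeSystem (surfaceGens g) (essentialTypeLen (g := g) k) := by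
  refine formsPerronFrobeniusTypeSystem_of (φ := id) (K := k) (fun _ => rfl) ?_
    (determines_essentialTypeLen hk)
  refine (finite_lists (finite_typeAlphabet (g := g)) k).subset ?_
  rintro _ ⟨x, rfl⟩
  refine ⟨fun a ha => essentialType_mem x a (List.mem_of_mem_take ha), ?_⟩
  rw [essentialTypeLen, List.length_take]
  exact min_le_left _ _

theorem formsPerronFrobeniusTypeSystem_essentialTypeWeight {w : TypeSymbol → ℝ} {k : ℝ}
    (hw : ∀ a ∈ typeAlphabet g, 0 ≤ w a ∧ w a ≤ w TypeSymbol.star)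
    (hfin : (Set.range (essentialTypeWeight (g := g) w k)).Finite) :
    FormsPerronFrobeniusTypeSystem (surfaceGens g) (essentialTypeWeight (g := g) w k) := by
  obtain ⟨K, hK⟩ := (hfin.image List.length).bddAbove
  refine formsPerronFrobeniusTypeSystem_of (φ := weightTruncate w k) (K := K) (fun x => ?_) hfin
    (determines_essentialTypeWeight hw)
  have hl : (essentialTypeWeight w k x).length ≤ K := hK ⟨_, ⟨x, rfl⟩, rfl⟩
  obtain ⟨M, hM⟩ := essentialType_eq_cons x
  have hp := List.prefix_iff_eq_take.1 (weightTruncate_prefix w k (essentialType x))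
  have hpos : 0 < (weightTruncate w k (essentialType x)).length := by
    rw [hM, weightTruncate]
    split_ifs <;> simp
  rw [essentialTypeWeight] at hl ⊢
  rw [essentialTypeLen]
  rcases weightTruncate_eq_or w k (essentialType x) with h | h
  · rw [h] at hl
    rw [List.take_of_length_le hl]
  · rw [hp] at h
    have h2 := h
    rw [← min_eq_left hl, ← List.take_take] at h2
    rw [weightTruncate_take w _ hpos h, weightTruncate_take w _ hpos h2, List.take_take,
      min_eq_left hl]

/-- The type `0` may have weight zero, since it only occurs as the last entry. -/
theorem finite_range_essentialTypeWeight {w : TypeSymbol → ℝ} (k : ℝ)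
    (hpos : ∀ a ∈ typeAlphabet g, a ≠ TypeSymbol.cannon 0 → 0 < w a) :
    (Set.range (essentialTypeWeight (g := g) w k)).Finite := by
  obtain ⟨δ, hδ, hδw⟩ : ∃ δ, 0 < δ ∧ ∀ a ∈ typeAlphabet g \ {TypeSymbol.cannon 0}, δ ≤ w a := by
    have h1 : TypeSymbol.star ∈ typeAlphabet g \ {TypeSymbol.cannon 0} :=
      ⟨Or.inr (Or.inr (Or.inr rfl)), by simp⟩
    obtain ⟨a, ha, h⟩ := Set.exists_min_image _ w
      ((finite_typeAlphabet (g := g)).subset (Set.sdiff_subset (t := {TypeSymbol.cannon 0})))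
      ⟨_, h1⟩
    exact ⟨w a, hpos a ha.1 ha.2, h⟩
  obtain ⟨N, hN⟩ := exists_nat_ge (k / δ)
  refine (finite_lists (finite_typeAlphabet (g := g)) (N + 2)).subset ?_
  rintro _ ⟨x, rfl⟩
  refine ⟨fun a ha => essentialType_mem x a
    ((weightTruncate_prefix w k _).subset ha), ?_⟩
  refine weightTruncate_length_le w hδ N k _ ((div_le_iff₀ hδ).1 hN) fun a ha => ?_
  exact hδw a ⟨essentialType_mem x a (List.dropLast_subset _ ha), essentialType_dropLast x a ha⟩

end

end SurfaceTiling

theorem mainTheorem6 (g : ℕ) (hg : 2 ≤ g) :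
    DeterminesSuccessors (essentialType (g := g)) (essentialType (g := g)) ∧
    (∀ k : ℕ, 0 < k →
      DeterminesSuccessors (essentialTypeLen (g := g) k) (essentialTypeLen (g := g) (k + 1)) ∧
      DeterminesSuccessors (essentialTypeLen (g := g) k) (essentialTypeLen (g := g) k) ∧
      FormsPerronFrobeniusTypeSystem (surfaceGens g) (essentialTypeLen (g := g) k)) ∧
    (∀ (w : TypeSymbol → ℝ) (k : ℝ),
      (∀ a ∈ typeAlphabet g, 0 ≤ w a ∧ w a ≤ w TypeSymbol.star) →
      DeterminesSuccessors (essentialTypeWeight (g := g) w k)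
        (essentialTypeWeight (g := g) w k) ∧
      ((Set.range (essentialTypeWeight (g := g) w k)).Finite →
        FormsPerronFrobeniusTypeSystem (surfaceGens g) (essentialTypeWeight (g := g) w k)) ∧
      ((∀ a ∈ typeAlphabet g, a ≠ TypeSymbol.cannon 0 → 0 < w a) →
        FormsPerronFrobeniusTypeSystem (surfaceGens g) (essentialTypeWeight (g := g) w k))) := by
  have : Fact (2 ≤ g) := ⟨hg⟩
  exact ⟨SurfaceTiling.determines_essentialType,
    fun k hk => ⟨SurfaceTiling.determines_essentialTypeLen_succ hk,
      SurfaceTiling.determines_essentialTypeLen hk,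
      SurfaceTiling.formsPerronFrobeniusTypeSystem_essentialTypeLen hk⟩,
    fun w k hw => ⟨SurfaceTiling.determines_essentialTypeWeight hw,
      SurfaceTiling.formsPerronFrobeniusTypeSystem_essentialTypeWeight hw,
      fun hpos => SurfaceTiling.formsPerronFrobeniusTypeSystem_essentialTypeWeight hw
        (SurfaceTiling.finite_range_essentialTypeWeight k hpos)⟩⟩
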